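/- **Setting.** Let $n\ge r\ge 1$ and let $X\in\mathbb R^{n\times n}$ have rank $r$, with reduced singular value decomposition $X=U\Sigma V^*$, $\Sigma=\mathrm{diag}(\sigma_1\ge\dots\ge\sigma_r>0)$, and condition number $\kappa=\sigma_1/\sigma_r$. Let $\|\cdot\|$ be the spectral norm of a matrix and the Euclidean norm of a vector, $\langle\cdot,\cdot\rangle$ and $\|\cdot\|_F$ the Frobenius inner product and norm, and $\|\cdot\|_\infty$ the largest absolute value of an entry. Assume that for some $\mu_0>0$ and $\mu_1$ $$\|UU^*e_i\|\le\sqrt{\mu_0r/n},\quad \|VV^*e_j\|\le\sqrt{\mu_0r/n}\quad(1\le i,j\le n),\qquad \|X\|_\infty\le\mu_1\sqrt{r/n^2}\,\|X\| .$$ Fix a routine that returns a singular value decomposition $Z=P\Lambda Q^*$ (decreasing singular values) of every $Z\in\mathbb R^{n\times n}$. Let $\mathcal H_r(Z)=P\Lambda_rQ^*$, where $\Lambda_r$ keeps the $r$ largest singular values and sets the others to zero. For a matrix $Y$ let $U_Y,V_Y\in\mathbb R^{n\times r}$ consist of its first $r$ left and right singular vectors, let $\Sigma_Y$ be the diagonal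 matrix of its $r$ largest singular values, and let $\mathcal P_{T_Y}(Z)=U_YU_Y^*Z+ZV_YV_Y^*-U_YU_Y^*ZV_YV_Y^*$ be the orthogonal projection onto the tangent space $T_Y=\{U_YZ_1^*+Z_2V_Y^*: Z_1,Z_2\in\mathbb R^{n\times r}\}$ of the manifold of rank $r$ matrices. For a finite family $\Omega$ of indices (with multiplicity) let $\mathcal P_\Omega(Z)$ be the entrywise product of $Z$ with $\sum_{(i,j)\in\Omega}e_ie_j^*$. Quotients $0/0$ below are read as $0$. **RGrad.** From $X_0$, with $G_l=\mathcal P_\Omega(X-X_l)$, $T_l=T_{X_l}$ and $\alpha_l=\dfrac{\|\mathcal P_{T_l}(G_l)\|_F^2}{\langle \mathcal P_{T_l}(G_l),\mathcal P_\Omega\mathcal P_{T_l}(G_l)\rangle}$, set $X_{l+1}=\mathcal H_r(X_l+\alpha_l\mathcal P_{T_l}(G_l))$. **Restarted RCG** with parameters $\kappa_1,\kappa_2\ge0$. From $X_0$ and $P_{-1}=0$, with $G_l$ and $T_l$ as above: let $$\beta_l=-\frac{\langle \mathcal P_{T_l}(G_l),\mathcal P_\Omega\mathcal P_{T_l}(P_{l-1})\rangle}{\langle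 \mathcal P_{T_l}(P_{l-1}),\mathcal P_\Omega\mathcal P_{T_l}(P_{l-1})\rangle}$$ if both $$\frac{|\langle \mathcal P_{T_l}(G_l),\mathcal P_{T_l}(P_{l-1})\rangle|}{\|\mathcal P_{T_l}(G_l)\|_F\|\mathcal P_{T_l}(P_{l-1})\|_F}\le\kappa_1\quad\text{and}\quad\|\mathcal P_{T_l}(G_l)\|_F\le\kappa_2\|\mathcal P_{T_l}(P_{l-1})\|_F$$ hold, and $\beta_l=0$ otherwise (in particular $\beta_0=0$). Then $P_l=\mathcal P_{T_l}(G_l)+\beta_l\mathcal P_{T_l}(P_{l-1})$, $\alpha_l=\dfrac{\langle \mathcal P_{T_l}(G_l),\mathcal P_{T_l}(P_l)\rangle}{\langle \mathcal P_{T_l}(P_l),\mathcal P_\Omega\mathcal P_{T_l}(P_l)\rangle}$ and $X_{l+1}=\mathcal H_r(X_l+\alpha_lP_l)$. **Initialization.** Partition $\Omega$, $|\Omega|=m$, into $L+1$ groups $\Omega_0,\dots,\Omega_L$ of equal size $\widehat m$ (the partition being fixed in advance). Set $Z_0=\mathcal H_r\big(\tfrac{n^2}{\widehat m}\mathcal P_{\Omega_0}(X)\big)$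 and, for $0\le l<L$, $$\widehat Z_l=\mathrm{trim}(Z_l),\qquad Z_{l+1}=\mathcal H_r\Big(\widehat Z_l+\tfrac{n^2}{\widehat m}\mathcal P_{T_{\widehat Z_l}}\mathcal P_{\Omega_{l+1}}(X-\widehat Z_l)\Big),$$ where $\mathrm{trim}(Z)=A\Sigma_ZB^*$ and $A,B$ arise from $U_Z,V_Z$ by multiplying each nonzero row $w$ by $\min(\|w\|,\sqrt{\mu_0r/n})/\|w\|$. Set $X_0=Z_L$. **Parameters.** Call $\varepsilon_0>0$ admissible for RGrad if $4\varepsilon_0<1$ and $\nu_g:=\frac{18\varepsilon_0}{1-4\varepsilon_0}<1$. Call $\varepsilon_0>0$ admissible for RCG with $\kappa_1,\kappa_2$ if $4\varepsilon_0<1$, $\kappa_1(1+4\varepsilon_0)<1-4\varepsilon_0$ and $\tau_1+\tau_2<1$, where $$\tau_1=\frac{18\varepsilon_0-10\kappa_1\varepsilon_0(1+4\varepsilon_0)}{(1-4\varepsilon_0)-\kappa_1(1+4\varepsilon_0)}+\frac{4\kappa_2\varepsilon_0+\kappa_1\kappa_2}{1-4\varepsilon_0},\qquad \tau_2=\frac{8\kappa_2\varepsilon_0+2\kappa_1\kappa_2}{1-4\varepsilon_0};$$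 put $\nu_{cg}=\frac12\big(\tau_1+\sqrt{\tau_1^2+4\tau_2}\big)$. **Theorem (Recovery Guarantee II).** (a) If $0\le\kappa_1<1$, $\kappa_2\ge0$ and $\kappa_1\kappa_2<1/3$, then all sufficiently small $\varepsilon_0>0$ are admissible for RCG with $\kappa_1,\kappa_2$. (b) There is an absolute constant $C>0$ such that the following holds for all $n,r,X,\mu_0,\mu_1$ as above, all $\beta>1$ and $\varepsilon_0>0$, and $L=\big\lceil 6\log\frac{\beta n\log n}{24\varepsilon_0}\big\rceil$ (read as $0$ if negative). Let $\Omega$ consist of $m$ indices drawn independently and uniformly from $\{1,\dots,n\}^2$ with replacement, where $m=(L+1)\widehat m$ and $$m\ \ge\ C\beta\max\Big\{\frac{\mu_0}{\varepsilon_0^2},\mu_1^2\Big\}\kappa^6nr^2\log(n)\log\Big(\frac{\beta n\log n}{24\varepsilon_0}\Big),$$ and let $X_0$ be the output of the initialization. If $\varepsilon_0$ is admissible for RGrad, then with probability at least $$1-2n^{1-\beta}-\Big(24\log\Big(\frac{\beta n\log n}{24\varepsilon_0}\Big)+3\Big)n^{2-2\beta}$$ the iterates of RGrad converge to $X$ and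 $\|X_l-X\|_F\le\nu_g^l\|X_0-X\|_F$ for all $l\ge0$, with $\nu_g<1$. If $\kappa_1,\kappa_2\ge0$, $\kappa_1\kappa_2<1/3$ and $\varepsilon_0$ is admissible for RCG with $\kappa_1,\kappa_2$, then with at least the same probability both this holds and the iterates of restarted RCG converge to $X$ with $\|X_l-X\|_F\le\nu_{cg}^l\|X_0-X\|_F$ for all $l\ge0$ and $\nu_{cg}<1$. (For $n=1$, where $\log n=0$, the bounds are void.) -/

import Mathlib

open MeasureTheory ProbabilityTheory Filter Topology
open scoped Matrix

namespace MatrixCompletion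

noncomputable section

/-- Euclidean norm of a vector in `ℝ^k`. -/
def vecNorm {k : ℕ} (v : Fin k → ℝ) : ℝ := Real.sqrt (∑ i, v i ^ 2)

/-- Frobenius (trace) inner product `⟨A, B⟩ = ∑ A_{ij} B_{ij}`. -/
def frobInner {n : ℕ} (A B : Matrix (Fin n) (Fin n) ℝ) : ℝ := ∑ i, ∑ j, A i j * B i j

/-- Frobenius norm. -/
def frobNorm {n : ℕ} (A : Matrix (Fin n) (Fin n) ℝ) : ℝ := Real.sqrt (∑ i, ∑ j, A i j ^ 2)

/-- Spectral norm: the operator norm with respect to the Euclidean norms. -/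
def specNorm {n : ℕ} (A : Matrix (Fin n) (Fin n) ℝ) : ℝ :=
  ‖Matrix.toEuclideanCLM (n := Fin n) (𝕜 := ℝ) A‖

/-- `X = U Σ Vᵀ` is a reduced singular value decomposition of a rank `r` matrix: `U`, `V` have
orthonormal columns and `Σ = diag (σ₁ ≥ … ≥ σ_r > 0)`. -/
structure IsReducedSVD {n r : ℕ} (X : Matrix (Fin n) (Fin n) ℝ)
    (U : Matrix (Fin n) (Fin r) ℝ) (σ : Fin r → ℝ) (V : Matrix (Fin n) (Fin r) ℝ) : Prop where
  left_orth : Uᵀ * U = 1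
  right_orth : Vᵀ * V = 1
  antitone : Antitone σ
  pos : ∀ k, 0 < σ k
  eq : X = U * Matrix.diagonal σ * Vᵀ

/-- Condition number: largest over smallest (nonzero) singular value; `σ` lists the nonzero
singular values. -/
def condNumber {r : ℕ} (σ : Fin r → ℝ) : ℝ := (⨆ k, σ k) / (⨅ k, σ k)

/-- `‖P_U e_i‖ ≤ √(μ₀ r / n)` and `‖P_V e_j‖ ≤ √(μ₀ r / n)` for all `i, j`, where `P_U = U Uᵀ`
and `P_V = V Vᵀ` are the projections onto the column and row spaces. -/
def IsIncoherent {n r : ℕ} (U V : Matrix (Fin n) (Fin r) ℝ) (μ₀ : ℝ) : Prop :=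
  (∀ i, vecNorm ((U * Uᵀ) *ᵥ Pi.single i 1) ≤ Real.sqrt (μ₀ * r / n)) ∧
  (∀ j, vecNorm ((V * Vᵀ) *ᵥ Pi.single j 1) ≤ Real.sqrt (μ₀ * r / n))

/-- `‖X‖_∞ ≤ μ₁ √(r / n²) ‖X‖` with the entrywise maximum norm on the left and the spectral norm
on the right. -/
def IsNonSpiky {n : ℕ} (r : ℕ) (X : Matrix (Fin n) (Fin n) ℝ) (μ₁ : ℝ) : Prop :=
  ∀ i j, |X i j| ≤ μ₁ * Real.sqrt (r / (n : ℝ) ^ 2) * specNorm X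

/-- A routine that returns a full singular value decomposition `Z = P Λ Qᵀ` of every `n × n`
matrix (singular values in decreasing order). It fixes the choice of singular vectors, which is
not unique. -/
structure SVDRoutine (n : ℕ) where
  left : Matrix (Fin n) (Fin n) ℝ → Matrix (Fin n) (Fin n) ℝ
  sv : Matrix (Fin n) (Fin n) ℝ → Fin n → ℝ
  right : Matrix (Fin n) (Fin n) ℝ → Matrix (Fin n) (Fin n) ℝ
  left_orth : ∀ Z, (left Z)ᵀ * left Z = 1
  right_orth : ∀ Z, (right Z)ᵀ * right Z = 1
  sv_nonneg : ∀ Z i, 0 ≤ sv Z i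
  sv_antitone : ∀ Z, Antitone (sv Z)
  eq : ∀ Z, Z = left Z * Matrix.diagonal (sv Z) * (right Z)ᵀ

theorem exists_svd {n : ℕ} (Z : Matrix (Fin n) (Fin n) ℝ) :
    ∃ (P : Matrix (Fin n) (Fin n) ℝ) (s : Fin n → ℝ) (Q : Matrix (Fin n) (Fin n) ℝ),
      Pᵀ * P = 1 ∧ Qᵀ * Q = 1 ∧ (∀ i, 0 ≤ s i) ∧ Antitone s ∧
        Z = P * Matrix.diagonal s * Qᵀ := by
  classical
  set T : EuclideanSpace ℝ (Fin n) →ₗ[ℝ] EuclideanSpace ℝ (Fin n) := Matrix.toEuclideanLin Z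
    with hT
  have hn : Module.finrank ℝ (EuclideanSpace ℝ (Fin n)) = n := finrank_euclideanSpace_fin
  set v := T.isSymmetric_adjoint_comp_self.eigenvectorBasis hn with hv
  set s : Fin n → ℝ := fun i => T.singularValues i with hs
  have hin : ∀ i j, inner ℝ (T (v i)) (T (v j)) = s i ^ 2 * (if i = j then 1 else 0) := by
    intro i j
    rw [← LinearMap.adjoint_inner_left, ← LinearMap.comp_apply, hv,
      LinearMap.IsSymmetric.apply_eigenvectorBasis, ← hv, inner_smul_left,
      orthonormal_iff_ite.mp v.orthonormal i j, hs, LinearMap.sq_singularValues_fin T hn i]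
    simp
  have hon : Orthonormal ℝ (fun i : ({i | s i ≠ 0} : Set (Fin n)) =>
      (s i)⁻¹ • T (v i)) := by
    rw [orthonormal_iff_ite]
    rintro ⟨i, hi⟩ ⟨j, hj⟩
    have hi' : s i ≠ 0 := hi
    have hj' : s j ≠ 0 := hj
    simp only [real_inner_smul_left, real_inner_smul_right, hin, Subtype.mk.injEq]
    by_cases h : i = j
    · subst h
      simp only [if_true]
      field_simp
    · simp [h]
  obtain ⟨b, hb⟩ := Orthonormal.exists_orthonormalBasis_extension_of_card_eq
    (𝕜 := ℝ) (v := fun i => (s i)⁻¹ • T (v i)) (by simp) hon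
  have hTv : ∀ i, T (v i) = s i • b i := by
    intro i
    by_cases h : s i = 0
    · have : inner ℝ (T (v i)) (T (v i)) = 0 := by rw [hin, h]; simp
      rw [inner_self_eq_zero.mp this, h, zero_smul]
    · rw [hb i h, smul_smul, mul_inv_cancel₀ h, one_smul]
  have horth : ∀ c : OrthonormalBasis (Fin n) ℝ (EuclideanSpace ℝ (Fin n)),
      (Matrix.of fun i k => c k i)ᵀ * (Matrix.of fun i k => c k i) = 1 := by
    intro c
    ext i j
    have := orthonormal_iff_ite.mp c.orthonormal i j
    rw [Matrix.mul_apply, Matrix.one_apply, ← this]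
    simp [PiLp.inner_apply, mul_comm]
  refine ⟨Matrix.of fun i k => b k i, s, Matrix.of fun i k => v k i, horth b, horth v,
    fun i => LinearMap.singularValues_nonneg T i, fun i j h => T.singularValues_antitone h, ?_⟩
  have hZ : Z * (Matrix.of fun i k => v k i) =
      (Matrix.of fun i k => b k i) * Matrix.diagonal s := by
    ext i k
    have := congrArg (fun w : EuclideanSpace ℝ (Fin n) => w i) (hTv k)
    simp only [hT, Matrix.toLpLin_apply, PiLp.smul_apply, smul_eq_mul] at this
    rw [Matrix.mul_diagonal, Matrix.of_apply, mul_comm, ← this]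
    simp [Matrix.mul_apply, Matrix.mulVec, dotProduct]
  rw [← hZ, Matrix.mul_assoc, mul_eq_one_comm.mp (horth v), Matrix.mul_one]

instance {n : ℕ} : Nonempty (SVDRoutine n) := by
  choose P s Q h1 h2 h3 h4 h5 using @exists_svd n
  exact ⟨⟨P, s, Q, h1, h2, h3, h4, h5⟩⟩

namespace SVDRoutine

variable {n : ℕ} (S : SVDRoutine n)

/-- Hard thresholding `H_r(Z) = P Λ_r Qᵀ`: all but the `r` largest singular values are set to
zero. -/
def hardThreshold (r : ℕ) (Z : Matrix (Fin n) (Fin n) ℝ) : Matrix (Fin n) (Fin n) ℝ :=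
  S.left Z * Matrix.diagonal (fun i : Fin n => if (i : ℕ) < r then S.sv Z i else 0) * (S.right Z)ᵀ

/-- The first `r` left singular vectors. -/
def leftFactor {r : ℕ} (hr : r ≤ n) (Z : Matrix (Fin n) (Fin n) ℝ) : Matrix (Fin n) (Fin r) ℝ :=
  (S.left Z).submatrix id (Fin.castLE hr)

/-- The first `r` right singular vectors. -/
def rightFactor {r : ℕ} (hr : r ≤ n) (Z : Matrix (Fin n) (Fin n) ℝ) : Matrix (Fin n) (Fin r) ℝ :=
  (S.right Z).submatrix id (Fin.castLE hr)

/-- The `r` largest singular values. -/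
def topSV {r : ℕ} (hr : r ≤ n) (Z : Matrix (Fin n) (Fin n) ℝ) : Fin r → ℝ :=
  fun k => S.sv Z (Fin.castLE hr k)

end SVDRoutine

/-- Orthogonal projection onto the tangent space `{U Z₁ᵀ + Z₂ Vᵀ}` of the manifold of rank `r`
matrices at a matrix with singular vectors `U`, `V` (orthonormal columns). -/
def tangentProj {n r : ℕ} (U V : Matrix (Fin n) (Fin r) ℝ) (Z : Matrix (Fin n) (Fin n) ℝ) :
    Matrix (Fin n) (Fin n) ℝ :=
  U * Uᵀ * Z + Z * (V * Vᵀ) - U * Uᵀ * Z * (V * Vᵀ)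

/-- `P_T`, where `T` is the tangent space of the manifold of rank `r` matrices at `Y`. -/
def tangentProjAt {n r : ℕ} (S : SVDRoutine n) (hr : r ≤ n) (Y Z : Matrix (Fin n) (Fin n) ℝ) :
    Matrix (Fin n) (Fin n) ℝ :=
  tangentProj (S.leftFactor hr Y) (S.rightFactor hr Y) Z

/-- Sampling operator of the multiset of indices `ω k`, `k ∈ s`: entrywise product with
`∑ e_i e_jᵀ`, the sum running over the samples with multiplicity. -/
def samplingOp {n m : ℕ} (ω : Fin m → Fin n × Fin n) (s : Finset (Fin m))
    (Z : Matrix (Fin n) (Fin n) ℝ) : Matrix (Fin n) (Fin n) ℝ :=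
  Matrix.hadamard (∑ k ∈ s, Matrix.single (ω k).1 (ω k).2 (1 : ℝ)) Z

/-- Every row `A^{(i)}` is replaced by `A^{(i)} / ‖A^{(i)}‖ * min (‖A^{(i)}‖, c)` (a zero row
stays zero). -/
def trimRows {n r : ℕ} (c : ℝ) (A : Matrix (Fin n) (Fin r) ℝ) : Matrix (Fin n) (Fin r) ℝ :=
  Matrix.of fun i k => A i k / vecNorm (A i) * min (vecNorm (A i)) c

/-- The trimming procedure: `U Σ Vᵀ ↦ A Σ Bᵀ` with `A`, `B` the trimmed `U`, `V`. -/
def trim {n r : ℕ} (S : SVDRoutine n) (hr : r ≤ n) (μ₀ : ℝ) (Z : Matrix (Fin n) (Fin n) ℝ) :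
    Matrix (Fin n) (Fin n) ℝ :=
  trimRows (Real.sqrt (μ₀ * r / n)) (S.leftFactor hr Z) * Matrix.diagonal (S.topSV hr Z) *
    (trimRows (Real.sqrt (μ₀ * r / n)) (S.rightFactor hr Z))ᵀ

/-- The iterates `Z_l` of the initialization by resampled Riemannian gradient descent and
trimming. The samples `k` with `g k = l` form the group `Ω_l`, and `mhat` is the size of each
group. -/
def initIter {n r m : ℕ} (S : SVDRoutine n) (hr : r ≤ n) (μ₀ : ℝ)
    (X : Matrix (Fin n) (Fin n) ℝ) (ω : Fin m → Fin n × Fin n) (g : Fin m → ℕ) (mhat : ℕ) :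
    ℕ → Matrix (Fin n) (Fin n) ℝ
  | 0 => S.hardThreshold r
      (((n : ℝ) ^ 2 / mhat) • samplingOp ω (Finset.univ.filter fun k => g k = 0) X)
  | l + 1 =>
      let Zhat := trim S hr μ₀ (initIter S hr μ₀ X ω g mhat l)
      S.hardThreshold r (Zhat + ((n : ℝ) ^ 2 / mhat) • tangentProjAt S hr Zhat
        (samplingOp ω (Finset.univ.filter fun k => g k = l + 1) (X - Zhat)))

/-- One step of Riemannian gradient descent with the steepest descent stepsize. -/
def rgradStep {n r m : ℕ} (S : SVDRoutine n) (hr : r ≤ n) (X : Matrix (Fin n) (Fin n) ℝ)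
    (ω : Fin m → Fin n × Fin n) (Y : Matrix (Fin n) (Fin n) ℝ) : Matrix (Fin n) (Fin n) ℝ :=
  let POm := samplingOp ω Finset.univ
  let PT := tangentProjAt S hr Y
  let G := POm (X - Y)
  let α := frobNorm (PT G) ^ 2 / frobInner (PT G) (POm (PT G))
  S.hardThreshold r (Y + α • PT G)

/-- The iterates of Riemannian gradient descent (RGrad) started at `X₀`. -/
def rgradIter {n r m : ℕ} (S : SVDRoutine n) (hr : r ≤ n) (X : Matrix (Fin n) (Fin n) ℝ)
    (ω : Fin m → Fin n × Fin n) (X₀ : Matrix (Fin n) (Fin n) ℝ) :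
    ℕ → Matrix (Fin n) (Fin n) ℝ
  | 0 => X₀
  | l + 1 => rgradStep S hr X ω (rgradIter S hr X ω X₀ l)

open Classical in
/-- One step of restarted Riemannian conjugate gradient descent, from `(X_l, P_{l-1})` to
`(X_{l+1}, P_l)`. The weight `β` is reset to zero when one of the two conditions fails. For
`P_{l-1} = 0` (in particular for `l = 0`) both branches give `β = 0`. -/
def rcgStep {n r m : ℕ} (S : SVDRoutine n) (hr : r ≤ n) (κ₁ κ₂ : ℝ)
    (X : Matrix (Fin n) (Fin n) ℝ) (ω : Fin m → Fin n × Fin n)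
    (st : Matrix (Fin n) (Fin n) ℝ × Matrix (Fin n) (Fin n) ℝ) :
    Matrix (Fin n) (Fin n) ℝ × Matrix (Fin n) (Fin n) ℝ :=
  let POm := samplingOp ω Finset.univ
  let PT := tangentProjAt S hr st.1
  let G := POm (X - st.1)
  let β : ℝ :=
    if |frobInner (PT G) (PT st.2)| / (frobNorm (PT G) * frobNorm (PT st.2)) ≤ κ₁ ∧
        frobNorm (PT G) ≤ κ₂ * frobNorm (PT st.2) then
      -(frobInner (PT G) (POm (PT st.2)) / frobInner (PT st.2) (POm (PT st.2)))
    else 0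
  let P := PT G + β • PT st.2
  let α := frobInner (PT G) (PT P) / frobInner (PT P) (POm (PT P))
  (S.hardThreshold r (st.1 + α • P), P)

/-- The states `(X_l, P_{l-1})` of restarted Riemannian conjugate gradient descent, with
`P_{-1} = 0`. -/
def rcgState {n r m : ℕ} (S : SVDRoutine n) (hr : r ≤ n) (κ₁ κ₂ : ℝ)
    (X : Matrix (Fin n) (Fin n) ℝ) (ω : Fin m → Fin n × Fin n)
    (X₀ : Matrix (Fin n) (Fin n) ℝ) :
    ℕ → Matrix (Fin n) (Fin n) ℝ × Matrix (Fin n) (Fin n) ℝ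
  | 0 => (X₀, 0)
  | l + 1 => rcgStep S hr κ₁ κ₂ X ω (rcgState S hr κ₁ κ₂ X ω X₀ l)

/-- The iterates `X_l` of restarted Riemannian conjugate gradient descent (RCG). -/
def rcgIter {n r m : ℕ} (S : SVDRoutine n) (hr : r ≤ n) (κ₁ κ₂ : ℝ)
    (X : Matrix (Fin n) (Fin n) ℝ) (ω : Fin m → Fin n × Fin n)
    (X₀ : Matrix (Fin n) (Fin n) ℝ) (l : ℕ) : Matrix (Fin n) (Fin n) ℝ :=
  (rcgState S hr κ₁ κ₂ X ω X₀ l).1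

/-- The contraction factor `ν_g` of RGrad. -/
def rgradRate (ε₀ : ℝ) : ℝ := 18 * ε₀ / (1 - 4 * ε₀)

def rcgTau₁ (κ₁ κ₂ ε₀ : ℝ) : ℝ :=
  (18 * ε₀ - 10 * κ₁ * ε₀ * (1 + 4 * ε₀)) / ((1 - 4 * ε₀) - κ₁ * (1 + 4 * ε₀)) +
    (4 * κ₂ * ε₀ + κ₁ * κ₂) / (1 - 4 * ε₀)

def rcgTau₂ (κ₁ κ₂ ε₀ : ℝ) : ℝ := (8 * κ₂ * ε₀ + 2 * κ₁ * κ₂) / (1 - 4 * ε₀)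

/-- The contraction factor `ν_cg` of restarted RCG. -/
def rcgRate (κ₁ κ₂ ε₀ : ℝ) : ℝ :=
  (rcgTau₁ κ₁ κ₂ ε₀ + Real.sqrt (rcgTau₁ κ₁ κ₂ ε₀ ^ 2 + 4 * rcgTau₂ κ₁ κ₂ ε₀)) / 2

/-- The neighborhood size `ε₀` is admissible for RGrad: `ν_g < 1` (with positive denominator). -/
def RGradAdmissible (ε₀ : ℝ) : Prop := 0 < ε₀ ∧ 4 * ε₀ < 1 ∧ rgradRate ε₀ < 1

/-- The neighborhood size `ε₀` is admissible for RCG with restarting parameters `κ₁, κ₂`: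
`τ₁ + τ₂ < 1` (with positive denominators). -/
def RCGAdmissible (κ₁ κ₂ ε₀ : ℝ) : Prop :=
  0 < ε₀ ∧ 4 * ε₀ < 1 ∧ κ₁ * (1 + 4 * ε₀) < 1 - 4 * ε₀ ∧
    rcgTau₁ κ₁ κ₂ ε₀ + rcgTau₂ κ₁ κ₂ ε₀ < 1

/-- `Y_l → X`, linearly with contraction factor `ν < 1`. -/
def ConvergesLinearly {n : ℕ} (Y : ℕ → Matrix (Fin n) (Fin n) ℝ)
    (X : Matrix (Fin n) (Fin n) ℝ) (ν : ℝ) : Prop :=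
  0 ≤ ν ∧ ν < 1 ∧ (∀ l, frobNorm (Y l - X) ≤ ν ^ l * frobNorm (Y 0 - X)) ∧
    Tendsto Y atTop (𝓝 X)

/-- The law of `m` independent indices, each uniform on `{1,…,n} × {1,…,n}`. -/
def sampleLaw (n m : ℕ) : Measure (Fin m → Fin n × Fin n) :=
  Measure.pi fun _ => (uniformOn Set.univ : Measure (Fin n × Fin n))

end

end MatrixCompletion

open MatrixCompletion

/-! Part (a) is continuity: at ε₀ = 0 the sum τ₁ + τ₂ equals 3κ₁κ₂ < 1, and both denominators are
positive there.

Part (b) separates a deterministic local analysis from three concentration estimates. Write p =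
m/n², let w be the matrix of sampling multiplicities, s the smallest nonzero singular value of X,
and e the current error. The local analysis rests on `IsRegularAt`: at an iterate Y, the form ⟨A,
w∘B⟩ is close to p⟨A, B⟩ on the tangent space, and the part of X normal to that space is small, also
when tested through w. Then the gradient step of length 1/p is nearly exact (`fn_add_gradient_le`),
exact line search differs from 1/p by a relative O(η), and a new direction conjugate to the old one
has no more sampling energy than the gradient itself (`fn_step_le`). Hard thresholding at most
doubles the error by Eckart–Young. With η = ε₀/10 an RGrad step contracts by ε₀ ≤ ν_g; for RCG the
errors obey a two-term recursion dominated by x² = τ₁x + τ₂, whose positive root is ν_cg.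

Regularity is inherited from the restricted isometry property on the single tangent space at X
(`isRegularAt_of_near`). The tangent projections at X and Y differ by O(e/s), and the normal part of
X is O(e²/s). Passing such perturbations through w costs a factor n, because multiplicities are
trivially at most m = pn². Hence the neighbourhood has radius of order ε₀s/n. All Y in it are
covered at once by one event, so the later iterations may reuse every sample without any
independence.

The initialization must enter this neighbourhood. The spectral error of the first sampled matrix
places Z₀ within O(s/κ²) in Frobenius norm. Trimming restores incoherence at the cost of a factor
4κ, and one resampled gradient step with relative deviation 1/(32κ) then halves the error
(`fn_initStep_le`). The number L of groups is such that 2^L absorbs n/ε₀.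

The probabilistic input is a matrix Bernstein inequality, obtained from Golden–Thompson and the
Laplace transform. Since the law is uniform on a finite set, probabilities are kept as numbers of
exceptional sample sequences. Bernstein is applied to rank one sums (`card_not_rip_le`), to the
spectral error of Z₀ (`card_norm_sampling_sub_gt_le`), and to a projected sampling operator at a
fixed matrix (`card_fn_tangentProj_sampling_gt_le`). The last applies to the random iterates because
Z_l depends only on groups up to l, so group l + 1 is fresh (`card_isBadStep_le`). A union bound in
`exists_exceptional_samples` and the choice of constants in `sampleLaw_real_ge_of_regular` finish
the proof. -/

namespace MatrixCompletion

noncomputable section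

set_option linter.unusedSectionVars false

section

open scoped Matrix.Norms.L2Operator

/-! ### The Golden–Thompson inequality -/

section GoldenThompson

variable {d : Type*} [Fintype d] [DecidableEq d]

theorem mul_pow_succ_cyclic {R : Type*} [Monoid R] (X Y : R) (N : ℕ) :
    (X * Y) ^ (N + 1) = X * ((Y * X) ^ N * Y) := by
  induction N with
  | zero => simp
  | succ N ih => rw [pow_succ', ih, pow_succ' (Y * X)]; simp only [mul_assoc]

theorem trace_mul_pow_comm (X Y : Matrix d d ℝ) (N : ℕ) :
    ((X * Y) ^ N).trace = ((Y * X) ^ N).trace := by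
  cases N with
  | zero => simp
  | succ N =>
    rw [mul_pow_succ_cyclic, Matrix.trace_mul_comm, pow_succ, Matrix.mul_assoc]

theorem trace_mul_transpose_self_nonneg {a b : Type*} [Fintype a] [Fintype b]
    (X : Matrix a b ℝ) : 0 ≤ (X * Xᵀ).trace := by
  simp only [Matrix.trace, Matrix.diag_apply, Matrix.mul_apply, Matrix.transpose_apply]
  exact Finset.sum_nonneg fun i _ => Finset.sum_nonneg fun j _ => mul_self_nonneg _

/-- Expand the nonnegative traces of (X ∓ Yᵀ)(X ∓ Yᵀ)ᵀ. This is the two-factor base case of the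
Hölder inequality below. -/
theorem abs_trace_mul_le (X Y : Matrix d d ℝ) :
    |(X * Y).trace| ≤ ((X * Xᵀ).trace + (Y * Yᵀ).trace) / 2 := by
  have h1 := trace_mul_transpose_self_nonneg (X - Yᵀ)
  have h2 := trace_mul_transpose_self_nonneg (X + Yᵀ)
  simp only [Matrix.transpose_sub, Matrix.transpose_add, Matrix.transpose_transpose,
    Matrix.sub_mul, Matrix.mul_sub, Matrix.add_mul, Matrix.mul_add, Matrix.trace_sub,
    Matrix.trace_add] at h1 h2
  have e1 : (Yᵀ * Xᵀ).trace = (X * Y).trace := by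
    rw [← Matrix.transpose_mul, Matrix.trace_transpose]
  have e2 : (Yᵀ * Y).trace = (Y * Yᵀ).trace := Matrix.trace_mul_comm _ _
  rw [e1, e2] at h1 h2
  rw [abs_le]
  constructor <;> linarith

/-- The ordered product `X 0 * X 1 * ⋯ * X (N - 1)`. -/
def rangeProd {R : Type*} [Monoid R] (X : ℕ → R) (N : ℕ) : R := ((List.range N).map X).prod

theorem rangeProd_succ {R : Type*} [Monoid R] (X : ℕ → R) (N : ℕ) :
    rangeProd X (N + 1) = rangeProd X N * X N := by
  simp [rangeProd, List.range_succ]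

theorem rangeProd_two_mul {R : Type*} [Monoid R] (X : ℕ → R) (N : ℕ) :
    rangeProd X (2 * N) = rangeProd (fun j => X (2 * j) * X (2 * j + 1)) N := by
  induction N with
  | zero => simp [rangeProd]
  | succ N ih =>
    rw [Nat.mul_succ, rangeProd_succ, rangeProd_succ, ih, rangeProd_succ, mul_assoc]

theorem rangeProd_const {R : Type*} [Monoid R] (x : R) (N : ℕ) :
    rangeProd (fun _ => x) N = x ^ N := by
  simp [rangeProd]

theorem sum_range_two_mul (f : ℕ → ℝ) (N : ℕ) :
    ∑ i ∈ Finset.range (2 * N), f i = ∑ j ∈ Finset.range N, (f (2 * j) + f (2 * j + 1)) := by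
  induction N with
  | zero => simp
  | succ N ih =>
    rw [Nat.mul_succ, Finset.sum_range_succ, Finset.sum_range_succ, ih, Finset.sum_range_succ]
    ring

/-- A Hölder type trace inequality for products of `2 ^ (k + 1)` matrices. -/
theorem abs_trace_rangeProd_le (k : ℕ) (X : ℕ → Matrix d d ℝ) :
    |(rangeProd X (2 ^ (k + 1))).trace| ≤
      (∑ i ∈ Finset.range (2 ^ (k + 1)), ((X i * (X i)ᵀ) ^ 2 ^ k).trace) / 2 ^ (k + 1) := by
  induction k generalizing X with
  | zero =>
    have := abs_trace_mul_le (X 0) (X 1)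
    simpa [rangeProd, List.range_succ, Finset.sum_range_succ] using this
  | succ k ih =>
    have step : ∀ A B : Matrix d d ℝ, (((A * B) * (A * B)ᵀ) ^ 2 ^ k).trace ≤
        (((A * Aᵀ) ^ 2 ^ (k + 1)).trace + ((B * Bᵀ) ^ 2 ^ (k + 1)).trace) / 2 := by
      intro A B
      have e1 : (((A * B) * (A * B)ᵀ) ^ 2 ^ k).trace = (((Aᵀ * A) * (B * Bᵀ)) ^ 2 ^ k).trace := by
        rw [Matrix.transpose_mul, show A * B * (Bᵀ * Aᵀ) = A * ((B * Bᵀ) * Aᵀ) by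
          simp only [Matrix.mul_assoc], trace_mul_pow_comm, Matrix.mul_assoc (B * Bᵀ),
          trace_mul_pow_comm]
      -- The alternating sequence AᵀA, BBᵀ has ordered product (AᵀA·BBᵀ)^(2^k), so the induction
      -- hypothesis itself separates a power of one pair into pure powers of AAᵀ and BBᵀ.
      set Y : ℕ → Matrix d d ℝ := fun i => if i % 2 = 0 then Aᵀ * A else B * Bᵀ with hY
      have hY0 : ∀ j, Y (2 * j) = Aᵀ * A := fun j => by simp [hY]
      have hY1 : ∀ j, Y (2 * j + 1) = B * Bᵀ := fun j => by
        have : (2 * j + 1) % 2 = 1 := by omega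
        simp [hY, this]
      clear_value Y
      have e2 : rangeProd Y (2 ^ (k + 1)) = ((Aᵀ * A) * (B * Bᵀ)) ^ 2 ^ k := by
        rw [pow_succ' 2 k, rangeProd_two_mul, ← rangeProd_const _ (2 ^ k)]
        simp only [hY0, hY1]
      have h := ih Y
      rw [e2, ← e1] at h
      refine (le_abs_self _).trans (h.trans_eq ?_)
      rw [pow_succ' 2 k, sum_range_two_mul]
      have e3 : ((Aᵀ * A * (Aᵀ * A)ᵀ) ^ 2 ^ k).trace = ((A * Aᵀ) ^ 2 ^ (k + 1)).trace := by
        rw [Matrix.transpose_mul, Matrix.transpose_transpose, ← sq, ← pow_mul, ← pow_succ',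
          trace_mul_pow_comm]
      have e4 : ((B * Bᵀ * (B * Bᵀ)ᵀ) ^ 2 ^ k).trace = ((B * Bᵀ) ^ 2 ^ (k + 1)).trace := by
        rw [Matrix.transpose_mul, Matrix.transpose_transpose, ← sq, ← pow_mul, ← pow_succ']
      simp only [hY0, hY1, e3, e4, Finset.sum_const, Finset.card_range, nsmul_eq_mul]
      push_cast
      rw [pow_succ' (2 : ℝ)]
      field_simp
      rw [pow_succ' 2 k]
    -- Adjacent factors are merged, which halves their number; `step` then splits each merged term.
    rw [pow_succ' 2 (k + 1), rangeProd_two_mul, sum_range_two_mul]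
    refine (ih _).trans ?_
    rw [pow_succ' (2 : ℝ) (k + 1), mul_comm (2 : ℝ), ← div_div, div_right_comm]
    gcongr
    rw [Finset.sum_div]
    exact Finset.sum_le_sum fun j _ => step _ _

/-- Hölder with all factors equal to AB bounds the trace by that of ((AB)(AB)ᵀ)^(2^k). By symmetry
and cyclicity this is the trace of (A²B²)^(2^k), and induction applies to the pair A², B². -/
theorem trace_mul_pow_two_pow_le (k : ℕ) : ∀ {A B : Matrix d d ℝ}, Aᵀ = A → Bᵀ = B →
    ((A * B) ^ 2 ^ k).trace ≤ (A ^ 2 ^ k * B ^ 2 ^ k).trace := by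
  induction k with
  | zero => intro A B _ _; simp
  | succ k ih =>
    intro A B hA hB
    have h := abs_trace_rangeProd_le k (fun _ => A * B)
    rw [rangeProd_const] at h
    have h' : ((A * B) ^ 2 ^ (k + 1)).trace ≤ (((A * B) * (A * B)ᵀ) ^ 2 ^ k).trace := by
      refine (le_abs_self _).trans (h.trans_eq ?_)
      simp only [Finset.sum_const, Finset.card_range, nsmul_eq_mul]
      push_cast
      field_simp
    have e : (((A * B) * (A * B)ᵀ) ^ 2 ^ k).trace = ((A ^ 2 * B ^ 2) ^ 2 ^ k).trace := by
      rw [Matrix.transpose_mul, hA, hB, ← Matrix.mul_assoc, trace_mul_pow_comm, sq, sq]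
      simp only [Matrix.mul_assoc]
    rw [e] at h'
    refine h'.trans ((ih ?_ ?_).trans_eq ?_)
    · rw [Matrix.transpose_pow, hA]
    · rw [Matrix.transpose_pow, hB]
    · rw [← pow_mul, ← pow_mul, ← pow_succ']

/-- Telescoping over the factors. In the product formula N is 2^k and M^N stays bounded, so an error
of o(2^-k) in each factor disappears in the limit. -/
theorem norm_pow_sub_pow_le {R : Type*} [NormedRing R] [NormOneClass R] {X Y : R} {M : ℝ}
    (hX : ‖X‖ ≤ M) (hY : ‖Y‖ ≤ M) (hM : 1 ≤ M) (N : ℕ) :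
    ‖X ^ N - Y ^ N‖ ≤ N * M ^ N * ‖X - Y‖ := by
  have hM0 : 0 ≤ M := zero_le_one.trans hM
  induction N with
  | zero => simp
  | succ N ih =>
    have e : X ^ (N + 1) - Y ^ (N + 1) = (X ^ N - Y ^ N) * X + Y ^ N * (X - Y) := by
      rw [pow_succ, pow_succ]; noncomm_ring
    rw [e]
    calc ‖(X ^ N - Y ^ N) * X + Y ^ N * (X - Y)‖
        ≤ ‖X ^ N - Y ^ N‖ * ‖X‖ + ‖Y ^ N‖ * ‖X - Y‖ :=
          (norm_add_le _ _).trans (add_le_add (norm_mul_le _ _) (norm_mul_le _ _))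
      _ ≤ (N * M ^ N * ‖X - Y‖) * M + M ^ N * ‖X - Y‖ := by
          gcongr
          exact (norm_pow_le _ _).trans (pow_le_pow_left₀ (norm_nonneg _) hY _)
      _ ≤ (N * M ^ N * ‖X - Y‖) * M + M ^ (N + 1) * ‖X - Y‖ := by
          gcongr
          exact Nat.le_succ N
      _ = ((N + 1 : ℕ) : ℝ) * M ^ (N + 1) * ‖X - Y‖ := by push_cast; ring

theorem norm_exp_le_exp_norm {R : Type*} [NormedRing R] [NormedAlgebra ℝ R] [NormOneClass R]
    [CompleteSpace R] (Z : R) : ‖NormedSpace.exp Z‖ ≤ Real.exp ‖Z‖ := by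
  let _ : NormedAlgebra ℚ R := NormedAlgebra.restrictScalars ℚ ℝ R
  have h := NormedSpace.exp_series_hasSum_exp' (𝕂 := ℝ) ‖Z‖
  rw [← Real.exp_eq_exp_ℝ] at h
  rw [← (NormedSpace.exp_series_hasSum_exp' (𝕂 := ℝ) Z).tsum_eq]
  refine tsum_of_norm_bounded h fun n => ?_
  rw [norm_smul, norm_inv, Real.norm_natCast, smul_eq_mul]
  gcongr
  exact norm_pow_le _ _

/-- The Lie–Trotter product formula along powers of two. -/
theorem tendsto_exp_mul_exp_pow {R : Type*} [NormedRing R] [NormedAlgebra ℝ R] [NormOneClass R]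
    [CompleteSpace R] (A B : R) :
    Tendsto (fun k : ℕ => (NormedSpace.exp ((2 ^ k : ℝ)⁻¹ • A) *
      NormedSpace.exp ((2 ^ k : ℝ)⁻¹ • B)) ^ 2 ^ k) atTop (𝓝 (NormedSpace.exp (A + B))) := by
  let _ : NormedAlgebra ℚ R := NormedAlgebra.restrictScalars ℚ ℝ R
  -- The curves exp(tA)exp(tB) and exp(t(A+B)) agree to first order at 0, so their difference is
  -- o(t). With t = 2^-k this beats the loss of 2^k factors.
  have hd : HasDerivAt (fun t : ℝ => NormedSpace.exp (t • A) * NormedSpace.exp (t • B) -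
      NormedSpace.exp (t • (A + B))) 0 0 := by
    have h := ((hasDerivAt_exp_smul_const A (0 : ℝ)).mul
      (hasDerivAt_exp_smul_const B (0 : ℝ))).sub (hasDerivAt_exp_smul_const (A + B) (0 : ℝ))
    simp only [zero_smul, NormedSpace.exp_zero, one_mul, mul_one] at h
    rw [show A + B - (A + B) = 0 from sub_self _] at h
    exact h
  have ho := hasDerivAt_iff_isLittleO.1 hd
  simp only [zero_smul, NormedSpace.exp_zero, mul_one, sub_self, sub_zero, smul_zero] at ho
  have ht : Tendsto (fun k : ℕ => (2 ^ k : ℝ)⁻¹) atTop (𝓝 0) :=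
    tendsto_inv_atTop_zero.comp (tendsto_pow_atTop_atTop_of_one_lt one_lt_two)
  have ho' := ho.comp_tendsto ht
  rw [Metric.tendsto_atTop]
  intro ε hε
  set K := Real.exp (‖A‖ + ‖B‖) with hK
  have hK0 : 0 < K := Real.exp_pos _
  obtain ⟨k₀, hk₀⟩ := Filter.eventually_atTop.1 (ho'.bound (show 0 < ε / (2 * K) by positivity))
  refine ⟨k₀, fun k hk => ?_⟩
  have hb := hk₀ k hk
  simp only [Function.comp] at hb
  set t : ℝ := (2 ^ k : ℝ)⁻¹ with htdef
  have ht0 : 0 < t := by positivity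
  have hexp : ∀ Z : R, ‖NormedSpace.exp Z‖ ≤ Real.exp ‖Z‖ := norm_exp_le_exp_norm
  have hX : ‖NormedSpace.exp (t • A) * NormedSpace.exp (t • B)‖ ≤
      Real.exp (t * (‖A‖ + ‖B‖)) := by
    rw [mul_add, Real.exp_add]
    refine (norm_mul_le _ _).trans (mul_le_mul ?_ ?_ (norm_nonneg _) (Real.exp_pos _).le)
    · refine (hexp _).trans_eq ?_
      rw [norm_smul, Real.norm_of_nonneg ht0.le]
    · refine (hexp _).trans_eq ?_
      rw [norm_smul, Real.norm_of_nonneg ht0.le]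
  have hY : ‖NormedSpace.exp (t • (A + B))‖ ≤ Real.exp (t * (‖A‖ + ‖B‖)) := by
    refine (hexp _).trans (Real.exp_le_exp.2 ?_)
    rw [norm_smul, Real.norm_of_nonneg ht0.le]
    gcongr
    exact norm_add_le _ _
  have h2 : (2 ^ k : ℕ) * t = 1 := by rw [htdef]; push_cast; field_simp
  have hpow : NormedSpace.exp (t • (A + B)) ^ 2 ^ k = NormedSpace.exp (A + B) := by
    rw [← NormedSpace.exp_nsmul, ← Nat.cast_smul_eq_nsmul ℝ, smul_smul, h2, one_smul]
  have hMpow : Real.exp (t * (‖A‖ + ‖B‖)) ^ 2 ^ k = K := by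
    rw [← Real.exp_nat_mul, ← mul_assoc, h2, one_mul]
  rw [dist_eq_norm, ← hpow]
  refine (norm_pow_sub_pow_le hX hY (Real.one_le_exp (by positivity)) _).trans_lt ?_
  rw [hMpow]
  calc ((2 ^ k : ℕ) : ℝ) * K * _ ≤ ((2 ^ k : ℕ) : ℝ) * K * (ε / (2 * K) * ‖t‖) := by
        gcongr
    _ = ((2 ^ k : ℕ) * t) * (ε / 2) := by
        rw [Real.norm_of_nonneg ht0.le]; field_simp
    _ < ε := by rw [h2]; linarith

/-- The Golden–Thompson inequality. -/
theorem trace_exp_add_le {A B : Matrix d d ℝ} (hA : Aᵀ = A) (hB : Bᵀ = B) :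
    (NormedSpace.exp (A + B)).trace ≤ (NormedSpace.exp A * NormedSpace.exp B).trace := by
  rcases isEmpty_or_nonempty d with hd | hd
  · simp [Matrix.trace]
  have hlim := ((Matrix.traceLinearMap d ℝ ℝ).continuous_of_finiteDimensional.tendsto _).comp
    (tendsto_exp_mul_exp_pow A B)
  refine le_of_tendsto hlim (Eventually.of_forall fun k => ?_)
  -- Raising exp(A/2^k) and exp(B/2^k) to the power 2^k makes the right side independent of k, so
  -- only the left side has to pass to the limit.
  have h := trace_mul_pow_two_pow_le k (A := NormedSpace.exp ((2 ^ k : ℝ)⁻¹ • A))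
    (B := NormedSpace.exp ((2 ^ k : ℝ)⁻¹ • B))
    (by rw [← Matrix.exp_transpose, Matrix.transpose_smul, hA])
    (by rw [← Matrix.exp_transpose, Matrix.transpose_smul, hB])
  have e : ∀ Z : Matrix d d ℝ, NormedSpace.exp ((2 ^ k : ℝ)⁻¹ • Z) ^ 2 ^ k =
      NormedSpace.exp Z := fun Z => by
    rw [← Matrix.exp_nsmul, ← Nat.cast_smul_eq_nsmul ℝ, smul_smul]
    push_cast
    rw [mul_inv_cancel₀ (by positivity), one_smul]
  rw [e, e] at h
  exact h

end GoldenThompson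

end

/-! ### A matrix Bernstein inequality for uniform sampling -/

section Bernstein

variable {d : Type*} [Fintype d] [DecidableEq d]

theorem exists_orthogonal_diagonalization {S : Matrix d d ℝ} (hS : Sᵀ = S) :
    ∃ (U : Matrix d d ℝ) (l : d → ℝ), Uᵀ * U = 1 ∧ U * Uᵀ = 1 ∧
      S = U * Matrix.diagonal l * Uᵀ := by
  have hH : S.IsHermitian := by
    rw [Matrix.IsHermitian, Matrix.conjTranspose_eq_transpose_of_trivial, hS]
  have h1 := (Matrix.mem_unitaryGroup_iff'.1 hH.eigenvectorUnitary.2)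
  have h2 := (Matrix.mem_unitaryGroup_iff.1 hH.eigenvectorUnitary.2)
  rw [Matrix.star_eq_conjTranspose, Matrix.conjTranspose_eq_transpose_of_trivial] at h1 h2
  refine ⟨hH.eigenvectorUnitary, hH.eigenvalues, h1, h2, ?_⟩
  have h := hH.spectral_theorem
  rw [Unitary.conjStarAlgAut_apply] at h
  rw [← Matrix.conjTranspose_eq_transpose_of_trivial]
  exact h

theorem exp_conj_diagonal {U : Matrix d d ℝ} (hU : U * Uᵀ = 1) (l : d → ℝ) :
    NormedSpace.exp (U * Matrix.diagonal l * Uᵀ) =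
      U * Matrix.diagonal (fun i => Real.exp (l i)) * Uᵀ := by
  have hinv : U⁻¹ = Uᵀ := Matrix.inv_eq_right_inv hU
  have hunit : IsUnit U := IsUnit.of_mul_eq_one _ hU
  rw [← hinv, Matrix.exp_conj _ _ hunit, Matrix.exp_diagonal]
  congr 3
  funext i
  rw [Pi.coe_exp, Real.exp_eq_exp_ℝ]

theorem dotProduct_mulVec_mulVec (A B : Matrix d d ℝ) (x : d → ℝ) :
    (A *ᵥ x) ⬝ᵥ (B *ᵥ x) = x ⬝ᵥ ((Aᵀ * B) *ᵥ x) := by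
  rw [← Matrix.mulVec_mulVec, Matrix.dotProduct_mulVec x, Matrix.vecMul_transpose]

theorem dotProduct_conj_diagonal (U : Matrix d d ℝ) (l x : d → ℝ) :
    x ⬝ᵥ ((U * Matrix.diagonal l * Uᵀ) *ᵥ x) = ∑ i, l i * (Uᵀ *ᵥ x) i ^ 2 := by
  rw [← Matrix.mulVec_mulVec, ← Matrix.mulVec_mulVec, Matrix.dotProduct_mulVec,
    ← Matrix.mulVec_transpose]
  simp only [dotProduct, Matrix.mulVec_diagonal]
  exact Finset.sum_congr rfl fun i _ => by ring

theorem dotProduct_self_eq_sum_sq {U : Matrix d d ℝ} (hU : U * Uᵀ = 1) (x : d → ℝ) :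
    x ⬝ᵥ x = ∑ i, (Uᵀ *ᵥ x) i ^ 2 := by
  have h := dotProduct_conj_diagonal U (fun _ => 1) x
  rw [Matrix.diagonal_one, Matrix.mul_one, hU, Matrix.one_mulVec] at h
  simpa using h

/-- A symmetric matrix with quadratic form at most one satisfies `exp S ≤ 1 + S + S²`. -/
theorem dotProduct_exp_mulVec_le {S : Matrix d d ℝ} (hS : Sᵀ = S)
    (h1 : ∀ x, x ⬝ᵥ (S *ᵥ x) ≤ x ⬝ᵥ x) (x : d → ℝ) :
    x ⬝ᵥ (NormedSpace.exp S *ᵥ x) ≤ x ⬝ᵥ x + x ⬝ᵥ (S *ᵥ x) + (S *ᵥ x) ⬝ᵥ (S *ᵥ x) := by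
  obtain ⟨U, l, hU', hU, rfl⟩ := exists_orthogonal_diagonalization hS
  have hl : ∀ i, l i ≤ 1 := by
    intro i
    have h := h1 (U *ᵥ Pi.single i 1)
    rw [dotProduct_conj_diagonal, dotProduct_self_eq_sum_sq hU] at h
    simp only [Matrix.mulVec_mulVec, hU', Matrix.one_mulVec] at h
    simpa [Pi.single_apply] using h
  rw [dotProduct_mulVec_mulVec, hS]
  have e : U * Matrix.diagonal l * Uᵀ * (U * Matrix.diagonal l * Uᵀ) =
      U * Matrix.diagonal (fun i => l i * l i) * Uᵀ := by
    rw [← Matrix.diagonal_mul_diagonal]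
    simp only [Matrix.mul_assoc]
    rw [← Matrix.mul_assoc Uᵀ U, hU', Matrix.one_mul]
  rw [e, exp_conj_diagonal hU, dotProduct_conj_diagonal, dotProduct_conj_diagonal,
    dotProduct_conj_diagonal, dotProduct_self_eq_sum_sq hU, ← Finset.sum_add_distrib,
    ← Finset.sum_add_distrib]
  refine Finset.sum_le_sum fun i _ => ?_
  -- Only an upper bound on the eigenvalues is needed: below −1 the exponential is at most 1, and 1
  -- + x + x² exceeds 1 there.
  have he : Real.exp (l i) ≤ 1 + l i + l i * l i := by
    rcases le_total (-1) (l i) with h | h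
    · have := Real.abs_exp_sub_one_sub_id_le (abs_le.2 ⟨h, hl i⟩)
      have := (abs_le.1 this).2
      nlinarith
    · have : Real.exp (l i) ≤ 1 := Real.exp_le_one_iff.2 (by linarith)
      nlinarith
  nlinarith [sq_nonneg ((Uᵀ *ᵥ x) i)]

/-- Some eigenvalue exceeds t, and the trace of the exponential is a sum of positive terms, one of
which belongs to that eigenvalue. -/
theorem exp_le_trace_exp {S : Matrix d d ℝ} (hS : Sᵀ = S) {t : ℝ} {x : d → ℝ}
    (hx : t * (x ⬝ᵥ x) < x ⬝ᵥ (S *ᵥ x)) : Real.exp t ≤ (NormedSpace.exp S).trace := by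
  obtain ⟨U, l, hU', hU, rfl⟩ := exists_orthogonal_diagonalization hS
  rw [exp_conj_diagonal hU, Matrix.trace_mul_comm, ← Matrix.mul_assoc, hU', Matrix.one_mul,
    Matrix.trace_diagonal]
  obtain ⟨i, hi⟩ : ∃ i, t < l i := by
    by_contra! h
    rw [dotProduct_conj_diagonal, dotProduct_self_eq_sum_sq hU, Finset.mul_sum] at hx
    refine hx.not_ge (Finset.sum_le_sum fun i _ => ?_)
    exact mul_le_mul_of_nonneg_right (h i) (sq_nonneg _)
  exact (Real.exp_le_exp.2 hi.le).trans
    (Finset.single_le_sum (f := fun i => Real.exp (l i)) (fun i _ => (Real.exp_pos _).le)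
      (Finset.mem_univ i))

theorem trace_exp_nonneg {S : Matrix d d ℝ} (hS : Sᵀ = S) : 0 ≤ (NormedSpace.exp S).trace := by
  obtain ⟨U, l, hU', hU, rfl⟩ := exists_orthogonal_diagonalization hS
  rw [exp_conj_diagonal hU, Matrix.trace_mul_comm, ← Matrix.mul_assoc, hU', Matrix.one_mul,
    Matrix.trace_diagonal]
  exact Finset.sum_nonneg fun i _ => (Real.exp_pos _).le

/-- With G = exp(H/2), symmetric, the trace of G·G·Y is the sum of the quadratic forms of Y at the
columns of G. -/
theorem trace_exp_mul_le {H Y : Matrix d d ℝ} (hH : Hᵀ = H) {c : ℝ}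
    (hY : ∀ x, x ⬝ᵥ (Y *ᵥ x) ≤ c * (x ⬝ᵥ x)) :
    (NormedSpace.exp H * Y).trace ≤ c * (NormedSpace.exp H).trace := by
  set G := NormedSpace.exp ((2 : ℝ)⁻¹ • H) with hG
  have hGs : Gᵀ = G := by rw [hG, ← Matrix.exp_transpose, Matrix.transpose_smul, hH]
  have hGG : NormedSpace.exp H = G * G := by
    rw [← sq, hG, ← Matrix.exp_nsmul, ← Nat.cast_smul_eq_nsmul ℝ, smul_smul]
    norm_num
  have key : ∀ Z : Matrix d d ℝ, (G * G * Z).trace =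
      ∑ j, (G *ᵥ Pi.single j 1) ⬝ᵥ (Z *ᵥ (G *ᵥ Pi.single j 1)) := by
    intro Z
    rw [Matrix.mul_assoc, Matrix.trace_mul_comm, Matrix.trace]
    refine Finset.sum_congr rfl fun j _ => ?_
    rw [Matrix.mulVec_mulVec, dotProduct_mulVec_mulVec, hGs, ← Matrix.mul_assoc,
      single_one_dotProduct]
    simp [Matrix.col_apply, Matrix.mul_assoc]
  rw [hGG, key Y, ← Matrix.mul_one (G * G), key 1, Finset.mul_sum]
  exact Finset.sum_le_sum fun j _ => by simpa using hY _

variable {ι κ : Type*} [Fintype ι] [Fintype κ] [DecidableEq κ]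

/-- Exchanging the a-th coordinate with the extra sample is an involution on pairs. This is Fubini
in counting form: resampling one coordinate preserves averages. -/
theorem sum_sum_update (a : κ) (f : (κ → ι) → ℝ) :
    ∑ ω : κ → ι, ∑ i, f (Function.update ω a i) = Fintype.card ι * ∑ ω, f ω := by
  have hinv : Function.Involutive
      (fun p : (κ → ι) × ι => (Function.update p.1 a p.2, p.1 a)) := by
    rintro ⟨ω, i⟩
    simp
  rw [← Fintype.sum_prod_type' (f := fun ω i => f (Function.update ω a i)),
    ← Equiv.sum_comp hinv.toPerm]
  simp [Fintype.sum_prod_type, Finset.mul_sum, Function.Involutive.toPerm]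

/-- The same involution for a block of coordinates. It expresses the independence of the samples in
s from the others. -/
theorem sum_sum_piecewise (s : Finset κ) (f : (κ → ι) → ℝ) :
    ∑ ω : κ → ι, ∑ ω' : κ → ι, f (s.piecewise ω' ω) =
      (Fintype.card ι : ℝ) ^ Fintype.card κ * ∑ ω, f ω := by
  have hinv : Function.Involutive
      (fun p : (κ → ι) × (κ → ι) => (s.piecewise p.2 p.1, s.piecewise p.1 p.2)) := by
    rintro ⟨ω, i⟩
    ext k <;> by_cases hk : k ∈ s <;> simp [hk]
  rw [← Fintype.sum_prod_type' (f := fun ω ω' => f (s.piecewise ω' ω)),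
    ← Equiv.sum_comp hinv.toPerm]
  have : ∀ p : (κ → ι) × (κ → ι), s.piecewise (s.piecewise p.1 p.2) (s.piecewise p.2 p.1) =
      p.1 := by
    intro p
    ext k; by_cases hk : k ∈ s <;> simp [hk]
  simp [Fintype.sum_prod_type, Finset.mul_sum, Function.Involutive.toPerm, this]

/-- Matrix moment generating function bound for sums of independent uniform samples of a centered
family of symmetric matrices. -/
theorem sum_trace_exp_le [Nonempty ι] {M : ι → Matrix d d ℝ} (hsym : ∀ i, (M i)ᵀ = M i)
    (hmean : ∑ i, M i = 0) {R v θ : ℝ} (hR : ∀ i x, x ⬝ᵥ (M i *ᵥ x) ≤ R * (x ⬝ᵥ x))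
    (hv : ∀ x, ∑ i, (M i *ᵥ x) ⬝ᵥ (M i *ᵥ x) ≤ Fintype.card ι * (v * (x ⬝ᵥ x)))
    (hθ : 0 ≤ θ) (hθR : θ * R ≤ 1) (s : Finset κ) :
    ∑ ω : κ → ι, (NormedSpace.exp (θ • ∑ k ∈ s, M (ω k))).trace ≤
      (Fintype.card ι : ℝ) ^ Fintype.card κ *
        (Fintype.card d * Real.exp (θ ^ 2 * v * s.card)) := by
  have hN : (0 : ℝ) < Fintype.card ι := by exact_mod_cast Fintype.card_pos
  have hsumsym : ∀ (s : Finset κ) (ω : κ → ι), (θ • ∑ k ∈ s, M (ω k))ᵀ = θ • ∑ k ∈ s, M (ω k) :=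
    fun s ω => by rw [Matrix.transpose_smul, Matrix.transpose_sum]; simp [hsym]
  induction s using Finset.induction_on with
  | empty =>
    simp [Matrix.trace_one]
  | insert a s ha ih =>
    -- Averaged over one sample, exp(θM) ≤ 1 + θM + θ²M² loses its linear term because the family is
    -- centered, and 1 + θ²v ≤ exp(θ²v).
    have hquad : ∀ x : d → ℝ, x ⬝ᵥ ((∑ i, NormedSpace.exp (θ • M i)) *ᵥ x) ≤
        (Fintype.card ι * Real.exp (θ ^ 2 * v)) * (x ⬝ᵥ x) := by
      intro x
      have hx0 : 0 ≤ x ⬝ᵥ x := Finset.sum_nonneg fun i _ => mul_self_nonneg _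
      have h1 : ∀ i, x ⬝ᵥ (NormedSpace.exp (θ • M i) *ᵥ x) ≤
          x ⬝ᵥ x + θ * (x ⬝ᵥ (M i *ᵥ x)) + θ ^ 2 * ((M i *ᵥ x) ⬝ᵥ (M i *ᵥ x)) := by
        intro i
        have h := dotProduct_exp_mulVec_le (S := θ • M i)
          (by rw [Matrix.transpose_smul, hsym]) (fun y => by
            have hy0 : 0 ≤ y ⬝ᵥ y := Finset.sum_nonneg fun i _ => mul_self_nonneg _
            rw [Matrix.smul_mulVec, dotProduct_smul, smul_eq_mul]
            nlinarith [mul_le_mul_of_nonneg_left (hR i y) hθ]) x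
        rw [Matrix.smul_mulVec, dotProduct_smul, dotProduct_smul, smul_dotProduct] at h
        simp only [smul_eq_mul] at h
        linarith
      rw [Matrix.sum_mulVec, dotProduct_sum]
      have h2 : ∑ i, θ * (x ⬝ᵥ (M i *ᵥ x)) = 0 := by
        rw [← Finset.mul_sum, ← dotProduct_sum, ← Matrix.sum_mulVec, hmean]
        simp
      calc _ ≤ ∑ i, (x ⬝ᵥ x + θ * (x ⬝ᵥ (M i *ᵥ x)) + θ ^ 2 * ((M i *ᵥ x) ⬝ᵥ (M i *ᵥ x))) :=
            Finset.sum_le_sum fun i _ => h1 i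
        _ = Fintype.card ι * (x ⬝ᵥ x) + θ ^ 2 * ∑ i, (M i *ᵥ x) ⬝ᵥ (M i *ᵥ x) := by
            rw [Finset.sum_add_distrib, Finset.sum_add_distrib, h2, ← Finset.mul_sum]
            simp
        _ ≤ Fintype.card ι * (x ⬝ᵥ x) + θ ^ 2 * (Fintype.card ι * (v * (x ⬝ᵥ x))) := by
            gcongr
            exact hv x
        _ = Fintype.card ι * (θ ^ 2 * v + 1) * (x ⬝ᵥ x) := by ring
        _ ≤ _ := by
            gcongr
            exact Real.add_one_le_exp _
    -- With the other samples frozen, Golden–Thompson splits the new sample off as a factor, whose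
    -- sum over its values is controlled by `hquad`.
    have hstep : ∀ ω : κ → ι,
        ∑ i, (NormedSpace.exp (θ • ∑ k ∈ insert a s, M (Function.update ω a i k))).trace ≤
          (Fintype.card ι * Real.exp (θ ^ 2 * v)) *
            (NormedSpace.exp (θ • ∑ k ∈ s, M (ω k))).trace := by
      intro ω
      refine le_trans ?_ (trace_exp_mul_le (hsumsym s ω) hquad)
      rw [Matrix.mul_sum, Matrix.trace_sum]
      refine Finset.sum_le_sum fun i _ => ?_
      have e : θ • ∑ k ∈ insert a s, M (Function.update ω a i k) =
          θ • ∑ k ∈ s, M (ω k) + θ • M i := by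
        rw [Finset.sum_insert ha, Function.update_self, add_comm, smul_add]
        congr 2
        refine Finset.sum_congr rfl fun k hk => ?_
        rw [Function.update_of_ne (by rintro rfl; exact ha hk)]
      rw [e]
      exact trace_exp_add_le (hsumsym s ω) (by rw [Matrix.transpose_smul, hsym])
    have h := sum_sum_update (ι := ι) a
      (fun ω : κ → ι => (NormedSpace.exp (θ • ∑ k ∈ insert a s, M (ω k))).trace)
    have h' : (Fintype.card ι : ℝ) * ∑ ω : κ → ι,
          (NormedSpace.exp (θ • ∑ k ∈ insert a s, M (ω k))).trace ≤
        (Fintype.card ι * Real.exp (θ ^ 2 * v)) * ((Fintype.card ι : ℝ) ^ Fintype.card κ *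
          (Fintype.card d * Real.exp (θ ^ 2 * v * s.card))) := by
      rw [← h]
      refine (Finset.sum_le_sum fun ω _ => hstep ω).trans ?_
      rw [← Finset.mul_sum]
      gcongr
    refine le_of_mul_le_mul_left (h'.trans_eq ?_) hN
    rw [Finset.card_insert_of_notMem ha]
    push_cast
    rw [mul_add, Real.exp_add, mul_one]
    ring

/-- Matrix Bernstein inequality: tail bound for the largest eigenvalue. -/
theorem card_filter_lt_le [Nonempty ι] {M : ι → Matrix d d ℝ} (hsym : ∀ i, (M i)ᵀ = M i)
    (hmean : ∑ i, M i = 0) {R v θ : ℝ} (hR : ∀ i x, x ⬝ᵥ (M i *ᵥ x) ≤ R * (x ⬝ᵥ x))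
    (hv : ∀ x, ∑ i, (M i *ᵥ x) ⬝ᵥ (M i *ᵥ x) ≤ Fintype.card ι * (v * (x ⬝ᵥ x)))
    (hθ : 0 < θ) (hθR : θ * R ≤ 1) (s : Finset κ) (t : ℝ) (B : Finset (κ → ι))
    (hB : ∀ ω ∈ B, ∃ x, t * (x ⬝ᵥ x) < x ⬝ᵥ ((∑ k ∈ s, M (ω k)) *ᵥ x)) :
    (B.card : ℝ) ≤ (Fintype.card ι : ℝ) ^ Fintype.card κ *
        (Fintype.card d * Real.exp (-(θ * t) + θ ^ 2 * v * s.card)) := by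
  have hsumsym : ∀ (ω : κ → ι), (θ • ∑ k ∈ s, M (ω k))ᵀ = θ • ∑ k ∈ s, M (ω k) :=
    fun ω => by rw [Matrix.transpose_smul, Matrix.transpose_sum]; simp [hsym]
  have h := sum_trace_exp_le hsym hmean hR hv hθ.le hθR s
  -- Markov's inequality in counting form: every exceptional sequence contributes at least exp(θt).
  have h1 : B.card * Real.exp (θ * t) ≤
      ∑ ω : κ → ι, (NormedSpace.exp (θ • ∑ k ∈ s, M (ω k))).trace := by
    rw [← nsmul_eq_mul, ← Finset.sum_const]
    refine (Finset.sum_le_sum fun ω hω => ?_).trans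
      (Finset.sum_le_sum_of_subset_of_nonneg (Finset.subset_univ B)
        fun ω _ _ => trace_exp_nonneg (hsumsym ω))
    obtain ⟨x, hx⟩ := hB ω hω
    refine exp_le_trace_exp (hsumsym ω) (x := x) ?_
    rw [Matrix.smul_mulVec, dotProduct_smul, smul_eq_mul, mul_assoc]
    exact mul_lt_mul_of_pos_left hx hθ
  rw [Real.exp_add, Real.exp_neg]
  have h2 := h1.trans h
  have := Real.exp_pos (θ * t)
  rw [← le_div_iff₀ this] at h2
  refine h2.trans_eq ?_
  field_simp

end Bernstein

section

open scoped Matrix.Norms.L2Operator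

/-! ### Frobenius and operator norms of rectangular matrices -/

section Norms

variable {a b c : Type*} [Fintype a] [Fintype b] [Fintype c]

/-- A matrix as a vector of its entries. -/
def toVec (A : Matrix a b ℝ) : EuclideanSpace ℝ (a × b) := WithLp.toLp 2 fun p => A p.1 p.2

/-- Frobenius norm of a rectangular matrix. -/
def fn (A : Matrix a b ℝ) : ℝ := Real.sqrt (∑ i, ∑ j, A i j ^ 2)

/-- Frobenius inner product of rectangular matrices. -/
def fi (A B : Matrix a b ℝ) : ℝ := ∑ i, ∑ j, A i j * B i j

theorem specNorm_eq_norm {n : ℕ} (A : Matrix (Fin n) (Fin n) ℝ) : specNorm A = ‖A‖ := rfl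

theorem fn_eq_norm (A : Matrix a b ℝ) : fn A = ‖toVec A‖ := by
  rw [EuclideanSpace.norm_eq, fn, Fintype.sum_prod_type]
  simp [toVec]

theorem fi_eq_inner (A B : Matrix a b ℝ) : fi A B = inner ℝ (toVec A) (toVec B) := by
  rw [PiLp.inner_apply, fi, Fintype.sum_prod_type]
  simp [toVec, mul_comm]

theorem fn_sq (A : Matrix a b ℝ) : fn A ^ 2 = ∑ i, ∑ j, A i j ^ 2 :=
  Real.sq_sqrt (Finset.sum_nonneg fun _ _ => Finset.sum_nonneg fun _ _ => sq_nonneg _)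

theorem fi_self (A : Matrix a b ℝ) : fi A A = fn A ^ 2 := by
  rw [fn_sq, fi]; simp only [sq]

theorem fn_nonneg (A : Matrix a b ℝ) : 0 ≤ fn A := Real.sqrt_nonneg _

theorem abs_fi_le (A B : Matrix a b ℝ) : |fi A B| ≤ fn A * fn B := by
  rw [fi_eq_inner, fn_eq_norm, fn_eq_norm]
  exact abs_real_inner_le_norm _ _

theorem fi_le (A B : Matrix a b ℝ) : fi A B ≤ fn A * fn B := (le_abs_self _).trans (abs_fi_le A B)

theorem fn_add_le (A B : Matrix a b ℝ) : fn (A + B) ≤ fn A + fn B := by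
  simp only [fn_eq_norm]
  exact norm_add_le (toVec A) (toVec B)

theorem fn_sub_le (A B : Matrix a b ℝ) : fn (A - B) ≤ fn A + fn B := by
  simp only [fn_eq_norm]
  exact norm_sub_le (toVec A) (toVec B)

theorem fn_smul (t : ℝ) (A : Matrix a b ℝ) : fn (t • A) = |t| * fn A := by
  simp only [fn_eq_norm]
  exact norm_smul t (toVec A)

theorem fn_neg (A : Matrix a b ℝ) : fn (-A) = fn A := by
  simp only [fn_eq_norm]
  exact norm_neg (toVec A)

theorem fn_sub_comm (A B : Matrix a b ℝ) : fn (A - B) = fn (B - A) := by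
  rw [← fn_neg, neg_sub]

@[simp] theorem fn_zero : fn (0 : Matrix a b ℝ) = 0 := by simp [fn]

theorem eq_zero_of_fn_eq_zero {A : Matrix a b ℝ} (h : fn A = 0) : A = 0 := by
  have h2 : ∑ i, ∑ j, A i j ^ 2 = 0 := by rw [← fn_sq, h]; norm_num
  ext i j
  have h3 := (Finset.sum_eq_zero_iff_of_nonneg
    (fun i _ => Finset.sum_nonneg fun j _ => sq_nonneg (A i j))).1 h2 i (Finset.mem_univ i)
  have h4 := (Finset.sum_eq_zero_iff_of_nonneg (fun j _ => sq_nonneg (A i j))).1 h3 j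
    (Finset.mem_univ j)
  simpa using h4

theorem abs_apply_le_fn (A : Matrix a b ℝ) (i : a) (j : b) : |A i j| ≤ fn A := by
  rw [← Real.sqrt_sq_eq_abs]
  refine Real.sqrt_le_sqrt ?_
  refine (Finset.single_le_sum (f := fun j => A i j ^ 2) (fun j _ => sq_nonneg _)
    (Finset.mem_univ j)).trans ?_
  exact Finset.single_le_sum (f := fun i => ∑ j, A i j ^ 2)
    (fun i _ => Finset.sum_nonneg fun j _ => sq_nonneg _) (Finset.mem_univ i)

theorem fn_transpose (A : Matrix a b ℝ) : fn Aᵀ = fn A := by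
  rw [fn, fn, Finset.sum_comm]; rfl

theorem fi_comm (A B : Matrix a b ℝ) : fi A B = fi B A := by
  simp only [fi, mul_comm]

theorem fi_transpose (A B : Matrix a b ℝ) : fi Aᵀ Bᵀ = fi A B := by
  rw [fi, fi, Finset.sum_comm]; rfl

theorem fi_add_left (A B C : Matrix a b ℝ) : fi (A + B) C = fi A C + fi B C := by
  simp [fi, add_mul, Finset.sum_add_distrib]

theorem fi_sub_left (A B C : Matrix a b ℝ) : fi (A - B) C = fi A C - fi B C := by
  simp [fi, sub_mul, Finset.sum_sub_distrib]

theorem fi_smul_left (t : ℝ) (A B : Matrix a b ℝ) : fi (t • A) B = t * fi A B := by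
  simp [fi, mul_assoc, Finset.mul_sum]

theorem fi_add_right (A B C : Matrix a b ℝ) : fi A (B + C) = fi A B + fi A C := by
  rw [fi_comm, fi_add_left, fi_comm B, fi_comm C]

theorem fi_sub_right (A B C : Matrix a b ℝ) : fi A (B - C) = fi A B - fi A C := by
  rw [fi_comm, fi_sub_left, fi_comm B, fi_comm C]

theorem fi_smul_right (t : ℝ) (A B : Matrix a b ℝ) : fi A (t • B) = t * fi A B := by
  rw [fi_comm, fi_smul_left, fi_comm]

theorem fi_mul_left (A : Matrix a b ℝ) (B : Matrix b c ℝ) (C : Matrix a c ℝ) :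
    fi (A * B) C = fi B (Aᵀ * C) := by
  simp only [fi, Matrix.mul_apply, Matrix.transpose_apply, Finset.sum_mul, Finset.mul_sum]
  rw [Finset.sum_congr rfl fun i _ => Finset.sum_comm, Finset.sum_comm]
  refine Finset.sum_congr rfl fun k _ => ?_
  rw [Finset.sum_comm]
  exact Finset.sum_congr rfl fun i _ => Finset.sum_congr rfl fun j _ => by ring

theorem fi_mul_right (A : Matrix a b ℝ) (B : Matrix b c ℝ) (C : Matrix a c ℝ) :
    fi (A * B) C = fi A (C * Bᵀ) := by
  rw [← fi_transpose, Matrix.transpose_mul, fi_mul_left, ← fi_transpose]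
  simp [Matrix.transpose_mul]

theorem vecNorm_eq_norm {k : ℕ} (v : Fin k → ℝ) :
    vecNorm v = ‖(WithLp.toLp 2 v : EuclideanSpace ℝ (Fin k))‖ := by
  simp [EuclideanSpace.norm_eq, vecNorm]

variable [DecidableEq a] [DecidableEq b] [DecidableEq c]

theorem norm_le_of_mulVec_le {A : Matrix a b ℝ} {t : ℝ} (ht : 0 ≤ t)
    (h : ∀ x : EuclideanSpace ℝ b,
      ‖(WithLp.toLp 2 (A *ᵥ x.ofLp) : EuclideanSpace ℝ a)‖ ≤ t * ‖x‖) : ‖A‖ ≤ t := by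
  rw [Matrix.l2_opNorm_def]
  exact ContinuousLinearMap.opNorm_le_bound _ ht h

theorem norm_transpose (A : Matrix a b ℝ) : ‖Aᵀ‖ = ‖A‖ := by
  rw [← Matrix.conjTranspose_eq_transpose_of_trivial, Matrix.l2_opNorm_conjTranspose]

theorem fn_mul_le (A : Matrix a b ℝ) (B : Matrix b c ℝ) : fn (A * B) ≤ ‖A‖ * fn B := by
  refine Real.sqrt_le_iff.2 ⟨mul_nonneg (norm_nonneg _) (fn_nonneg _), ?_⟩
  rw [mul_pow, fn_sq, Finset.sum_comm, Finset.sum_comm (s := (Finset.univ : Finset b)),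
    Finset.mul_sum]
  refine Finset.sum_le_sum fun j _ => ?_
  have h := Matrix.l2_opNorm_mulVec A (WithLp.toLp 2 fun k => B k j)
  have h2 := pow_le_pow_left₀ (norm_nonneg _) h 2
  rw [mul_pow, EuclideanSpace.norm_sq_eq, EuclideanSpace.norm_sq_eq] at h2
  simpa [Matrix.mul_apply, Matrix.mulVec, dotProduct] using h2

theorem fn_mul_le' (A : Matrix a b ℝ) (B : Matrix b c ℝ) : fn (A * B) ≤ fn A * ‖B‖ := by
  rw [← fn_transpose, Matrix.transpose_mul, ← fn_transpose A, ← norm_transpose B, mul_comm]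
  exact fn_mul_le _ _

theorem norm_le_fn (A : Matrix a b ℝ) : ‖A‖ ≤ fn A := by
  refine norm_le_of_mulVec_le (fn_nonneg _) fun x => ?_
  refine (sq_le_sq₀ (norm_nonneg _) (mul_nonneg (fn_nonneg _) (norm_nonneg _))).1 ?_
  rw [mul_pow, fn_sq, EuclideanSpace.norm_sq_eq, EuclideanSpace.norm_sq_eq, Finset.sum_mul]
  refine Finset.sum_le_sum fun i _ => ?_
  simp only [Real.norm_eq_abs, sq_abs, Matrix.mulVec, dotProduct]
  exact Finset.sum_mul_sq_le_sq_mul_sq _ _ _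

theorem norm_le_one_of_transpose_mul_self {U : Matrix a b ℝ} (hU : Uᵀ * U = 1) : ‖U‖ ≤ 1 := by
  have h := Matrix.l2_opNorm_conjTranspose_mul_self U
  rw [Matrix.conjTranspose_eq_transpose_of_trivial, hU] at h
  have h1 : ‖(1 : Matrix b b ℝ)‖ ≤ 1 := by
    rw [← Matrix.diagonal_one, Matrix.l2_opNorm_diagonal]
    exact (pi_norm_le_iff_of_nonneg zero_le_one).2 fun i => by simp
  nlinarith [norm_nonneg U]

theorem fn_mul_of_orth {U : Matrix a b ℝ} (hU : Uᵀ * U = 1) (A : Matrix b c ℝ) :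
    fn (U * A) = fn A := by
  refine (sq_eq_sq₀ (fn_nonneg _) (fn_nonneg _)).1 ?_
  rw [← fi_self, fi_mul_left, ← Matrix.mul_assoc, hU, Matrix.one_mul, fi_self]

theorem fn_mul_transpose_of_orth {V : Matrix a b ℝ} (hV : Vᵀ * V = 1) (A : Matrix c b ℝ) :
    fn (A * Vᵀ) = fn A := by
  rw [← fn_transpose, Matrix.transpose_mul, Matrix.transpose_transpose, fn_mul_of_orth hV,
    fn_transpose]

theorem norm_diagonal_le {v : a → ℝ} {t : ℝ} (ht : 0 ≤ t) (h : ∀ i, |v i| ≤ t) :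
    ‖(Matrix.diagonal v : Matrix a a ℝ)‖ ≤ t := by
  rw [Matrix.l2_opNorm_diagonal]
  exact (pi_norm_le_iff_of_nonneg ht).2 h

/-- `N = 1 - U Uᵀ` is symmetric and idempotent. -/
theorem compl_proj_mul_self {U : Matrix a b ℝ} (hU : Uᵀ * U = 1) :
    (1 - U * Uᵀ) * (1 - U * Uᵀ) = 1 - U * Uᵀ := by
  rw [Matrix.mul_sub, Matrix.mul_one, Matrix.sub_mul, Matrix.one_mul, Matrix.mul_assoc U,
    ← Matrix.mul_assoc Uᵀ, hU, Matrix.one_mul, sub_self, sub_zero]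

theorem compl_proj_transpose (U : Matrix a b ℝ) : (1 - U * Uᵀ)ᵀ = 1 - U * Uᵀ := by
  simp [Matrix.transpose_mul]

/-- The C*-identity gives ‖N‖² = ‖N‖. -/
theorem norm_le_one_of_symm_idem {N : Matrix a a ℝ} (h1 : Nᵀ = N) (h2 : N * N = N) :
    ‖N‖ ≤ 1 := by
  have h := Matrix.l2_opNorm_conjTranspose_mul_self N
  rw [Matrix.conjTranspose_eq_transpose_of_trivial, h1, h2] at h
  by_contra! hc
  nlinarith

theorem norm_compl_proj_le {U : Matrix a b ℝ} (hU : Uᵀ * U = 1) : ‖1 - U * Uᵀ‖ ≤ 1 :=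
  norm_le_one_of_symm_idem (compl_proj_transpose U) (compl_proj_mul_self hU)

theorem compl_proj_mul {U : Matrix a b ℝ} (hU : Uᵀ * U = 1) (A : Matrix b c ℝ) :
    (1 - U * Uᵀ) * (U * A) = 0 := by
  rw [Matrix.sub_mul, Matrix.one_mul, Matrix.mul_assoc U, ← Matrix.mul_assoc Uᵀ, hU,
    Matrix.one_mul, sub_self]

end Norms

end

section

open scoped Matrix.Norms.L2Operator

/-! ### Singular value decompositions and tangent spaces -/

section Geometry

variable {n r : ℕ}

theorem IsReducedSVD.transpose {X : Matrix (Fin n) (Fin n) ℝ} {U V : Matrix (Fin n) (Fin r) ℝ}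
    {σ : Fin r → ℝ} (h : IsReducedSVD X U σ V) : IsReducedSVD Xᵀ V σ U where
  left_orth := h.right_orth
  right_orth := h.left_orth
  antitone := h.antitone
  pos := h.pos
  eq := by
    rw [h.eq]
    simp [Matrix.transpose_mul, Matrix.mul_assoc]

/-- With U written as X·VΣ⁻¹, anything that annihilates a matrix close to X nearly annihilates U,
with loss 1/s. -/
theorem IsReducedSVD.left_eq {X : Matrix (Fin n) (Fin n) ℝ} {U V : Matrix (Fin n) (Fin r) ℝ}
    {σ : Fin r → ℝ} (h : IsReducedSVD X U σ V) :
    U = X * (V * Matrix.diagonal fun k => (σ k)⁻¹) := by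
  have e : Matrix.diagonal σ * Matrix.diagonal (fun k => (σ k)⁻¹) = 1 := by
    rw [Matrix.diagonal_mul_diagonal, ← Matrix.diagonal_one]
    congr 1
    funext k
    exact mul_inv_cancel₀ (h.pos k).ne'
  conv_rhs => rw [h.eq]
  rw [Matrix.mul_assoc, ← Matrix.mul_assoc Vᵀ, h.right_orth, Matrix.one_mul, Matrix.mul_assoc, e,
    Matrix.mul_one]

theorem IsReducedSVD.compl_left_mul {X : Matrix (Fin n) (Fin n) ℝ}
    {U V : Matrix (Fin n) (Fin r) ℝ} {σ : Fin r → ℝ} (h : IsReducedSVD X U σ V) :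
    (1 - U * Uᵀ) * X = 0 := by
  conv_lhs => rw [h.eq]
  rw [Matrix.mul_assoc U, compl_proj_mul h.left_orth]

theorem IsReducedSVD.mul_compl_right {X : Matrix (Fin n) (Fin n) ℝ}
    {U V : Matrix (Fin n) (Fin r) ℝ} {σ : Fin r → ℝ} (h : IsReducedSVD X U σ V) :
    X * (1 - V * Vᵀ) = 0 := by
  have := congrArg Matrix.transpose h.transpose.compl_left_mul
  rwa [Matrix.transpose_mul, compl_proj_transpose, Matrix.transpose_transpose,
    Matrix.transpose_zero] at this

theorem IsReducedSVD.left_proj_mul {X : Matrix (Fin n) (Fin n) ℝ}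
    {U V : Matrix (Fin n) (Fin r) ℝ} {σ : Fin r → ℝ} (h : IsReducedSVD X U σ V) :
    U * (Uᵀ * X) = X := by
  have := h.compl_left_mul
  rw [Matrix.sub_mul, Matrix.one_mul, sub_eq_zero] at this
  rw [← Matrix.mul_assoc, ← this]

theorem norm_diagonal_inv_le {σ : Fin r → ℝ} {s : ℝ} (hs : 0 < s) (hσ : ∀ k, s ≤ σ k) :
    ‖(Matrix.diagonal fun k => (σ k)⁻¹ : Matrix (Fin r) (Fin r) ℝ)‖ ≤ s⁻¹ := by
  refine norm_diagonal_le (inv_nonneg.2 hs.le) fun k => ?_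
  rw [abs_of_pos (inv_pos.2 (hs.trans_le (hσ k)))]
  exact inv_anti₀ hs (hσ k)

/-- A Wedin-type bound: since N annihilates Y, NU = N(X − Y)VΣ⁻¹. For N = 1 − U'U'ᵀ it measures how
far the column space of X lies outside that of Y. -/
theorem IsReducedSVD.norm_mul_left_le {X Y : Matrix (Fin n) (Fin n) ℝ}
    {U V : Matrix (Fin n) (Fin r) ℝ} {σ : Fin r → ℝ} (h : IsReducedSVD X U σ V) {s : ℝ}
    (hs : 0 < s) (hσ : ∀ k, s ≤ σ k) {N : Matrix (Fin n) (Fin n) ℝ} (hN : ‖N‖ ≤ 1)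
    (hNY : N * Y = 0) : ‖N * U‖ ≤ ‖X - Y‖ / s := by
  have e : N * U = N * (X - Y) * (V * Matrix.diagonal fun k => (σ k)⁻¹) := by
    rw [Matrix.mul_sub, hNY, sub_zero, Matrix.mul_assoc, ← h.left_eq]
  rw [e]
  have h1 := norm_diagonal_inv_le hs hσ
  have h2 := norm_le_one_of_transpose_mul_self h.right_orth
  calc _ ≤ (1 * ‖X - Y‖) * (1 * s⁻¹) := by
        refine (Matrix.l2_opNorm_mul _ _).trans ?_
        gcongr
        · exact (Matrix.l2_opNorm_mul _ _).trans (by gcongr)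
        · exact (Matrix.l2_opNorm_mul _ _).trans (by gcongr)
    _ = _ := by rw [one_mul, one_mul, div_eq_mul_inv]

theorem IsReducedSVD.fn_mul_left_le {X Y : Matrix (Fin n) (Fin n) ℝ}
    {U V : Matrix (Fin n) (Fin r) ℝ} {σ : Fin r → ℝ} (h : IsReducedSVD X U σ V) {s : ℝ}
    (hs : 0 < s) (hσ : ∀ k, s ≤ σ k) {N : Matrix (Fin n) (Fin n) ℝ} (hN : ‖N‖ ≤ 1)
    (hNY : N * Y = 0) : fn (N * U) ≤ fn (X - Y) / s := by
  have e : N * U = N * (X - Y) * (V * Matrix.diagonal fun k => (σ k)⁻¹) := by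
    rw [Matrix.mul_sub, hNY, sub_zero, Matrix.mul_assoc, ← h.left_eq]
  rw [e]
  have h1 := norm_diagonal_inv_le hs hσ
  have h2 := norm_le_one_of_transpose_mul_self h.right_orth
  calc _ ≤ (1 * fn (X - Y)) * (1 * s⁻¹) := by
        refine (fn_mul_le' _ _).trans ?_
        have := fn_nonneg (X - Y)
        gcongr
        · exact (fn_mul_le _ _).trans (by gcongr)
        · exact (Matrix.l2_opNorm_mul _ _).trans (by gcongr)
    _ = _ := by rw [one_mul, one_mul, div_eq_mul_inv]

/-- The component of `X` normal to the tangent space at a nearby matrix `Y` is quadratically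
small. -/
theorem IsReducedSVD.fn_normal_le {X Y : Matrix (Fin n) (Fin n) ℝ}
    {U V : Matrix (Fin n) (Fin r) ℝ} {σ : Fin r → ℝ} (h : IsReducedSVD X U σ V) {s : ℝ}
    (hs : 0 < s) (hσ : ∀ k, s ≤ σ k) {N N' : Matrix (Fin n) (Fin n) ℝ} (hN : ‖N‖ ≤ 1)
    (hN' : ‖N'‖ ≤ 1) (hNY : N * Y = 0) (hYN : Y * N' = 0) :
    fn (N * X * N') ≤ fn (X - Y) ^ 2 / s := by
  -- Inserting UUᵀ in front of X gives two factors, NU and (X − Y)N', each of first order in X − Y;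
  -- hence the quadratic bound.
  have e : N * X * N' = N * U * (Uᵀ * ((X - Y) * N')) := by
    rw [Matrix.sub_mul, hYN, sub_zero, Matrix.mul_assoc N U, ← Matrix.mul_assoc Uᵀ,
      ← Matrix.mul_assoc U, h.left_proj_mul, Matrix.mul_assoc]
  rw [e]
  have h1 := (h.norm_mul_left_le hs hσ hN hNY).trans
    (div_le_div_of_nonneg_right (norm_le_fn _) hs.le)
  have h2 : ‖Uᵀ‖ ≤ 1 := by
    rw [norm_transpose]; exact norm_le_one_of_transpose_mul_self h.left_orth
  have h0 := fn_nonneg (X - Y)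
  calc _ ≤ (fn (X - Y) / s) * (1 * (fn (X - Y) * 1)) := by
        have h3 : fn ((X - Y) * N') ≤ fn (X - Y) * 1 :=
          (fn_mul_le' _ _).trans (by gcongr)
        have h4 : fn (Uᵀ * ((X - Y) * N')) ≤ 1 * (fn (X - Y) * 1) :=
          (fn_mul_le _ _).trans (mul_le_mul h2 h3 (fn_nonneg _) zero_le_one)
        exact (fn_mul_le _ _).trans (mul_le_mul h1 h4 (fn_nonneg _) (by positivity))
    _ = _ := by ring

/-- Each term contains one complementary projection applied to the other basis, so the Wedin-type
bound applies to both. -/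
theorem proj_sub_proj {U U' : Matrix (Fin n) (Fin r) ℝ} :
    U' * U'ᵀ - U * Uᵀ = ((1 - U * Uᵀ) * U') * U'ᵀ - U * ((1 - U' * U'ᵀ) * U)ᵀ := by
  rw [Matrix.transpose_mul, compl_proj_transpose]
  simp only [Matrix.sub_mul, Matrix.mul_sub, Matrix.one_mul, Matrix.mul_one, Matrix.mul_assoc]
  abel

theorem norm_proj_sub_proj_le {X Y : Matrix (Fin n) (Fin n) ℝ}
    {U V U' V' : Matrix (Fin n) (Fin r) ℝ} {σ σ' : Fin r → ℝ} (h : IsReducedSVD X U σ V)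
    (h' : IsReducedSVD Y U' σ' V') {s : ℝ} (hs : 0 < s) (hσ : ∀ k, s ≤ σ k)
    (hσ' : ∀ k, s ≤ σ' k) : ‖U' * U'ᵀ - U * Uᵀ‖ ≤ 2 * (‖X - Y‖ / s) := by
  have h1 := h.norm_mul_left_le hs hσ (norm_compl_proj_le h'.left_orth) h'.compl_left_mul
  have h2 := h'.norm_mul_left_le hs hσ' (norm_compl_proj_le h.left_orth) h.compl_left_mul
  rw [norm_sub_rev] at h2
  have h3 := norm_le_one_of_transpose_mul_self h.left_orth
  have h4 := norm_le_one_of_transpose_mul_self h'.left_orth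
  have h0 : 0 ≤ ‖X - Y‖ / s := by positivity
  rw [proj_sub_proj, two_mul]
  refine (norm_sub_le _ _).trans (add_le_add ?_ ?_)
  · refine (Matrix.l2_opNorm_mul _ _).trans ?_
    rw [norm_transpose]
    calc _ ≤ ‖X - Y‖ / s * 1 := by gcongr
      _ = _ := mul_one _
  · refine (Matrix.l2_opNorm_mul _ _).trans ?_
    rw [norm_transpose]
    calc _ ≤ 1 * (‖X - Y‖ / s) := by gcongr
      _ = _ := one_mul _

/-! Tangent space projections. -/

theorem sub_tangentProj (U V : Matrix (Fin n) (Fin r) ℝ) (Z : Matrix (Fin n) (Fin n) ℝ) :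
    Z - tangentProj U V Z = (1 - U * Uᵀ) * Z * (1 - V * Vᵀ) := by
  unfold tangentProj
  noncomm_ring

theorem tangentProj_eq (U V : Matrix (Fin n) (Fin r) ℝ) (Z : Matrix (Fin n) (Fin n) ℝ) :
    tangentProj U V Z = Z - (1 - U * Uᵀ) * Z * (1 - V * Vᵀ) := by
  rw [← sub_tangentProj]; abel

theorem tangentProj_add (U V : Matrix (Fin n) (Fin r) ℝ) (Z W : Matrix (Fin n) (Fin n) ℝ) :
    tangentProj U V (Z + W) = tangentProj U V Z + tangentProj U V W := by
  unfold tangentProj; noncomm_ring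

theorem tangentProj_sub (U V : Matrix (Fin n) (Fin r) ℝ) (Z W : Matrix (Fin n) (Fin n) ℝ) :
    tangentProj U V (Z - W) = tangentProj U V Z - tangentProj U V W := by
  unfold tangentProj; noncomm_ring

theorem tangentProj_smul (U V : Matrix (Fin n) (Fin r) ℝ) (t : ℝ)
    (Z : Matrix (Fin n) (Fin n) ℝ) : tangentProj U V (t • Z) = t • tangentProj U V Z := by
  simp [tangentProj, smul_add, smul_sub]

@[simp] theorem tangentProj_zero (U V : Matrix (Fin n) (Fin r) ℝ) :
    tangentProj U V (0 : Matrix (Fin n) (Fin n) ℝ) = 0 := by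
  simp [tangentProj]

theorem fi_tangentProj (U V : Matrix (Fin n) (Fin r) ℝ) (Z W : Matrix (Fin n) (Fin n) ℝ) :
    fi (tangentProj U V Z) W = fi Z (tangentProj U V W) := by
  rw [tangentProj_eq, tangentProj_eq, fi_sub_left, fi_sub_right, fi_mul_right, fi_mul_left,
    compl_proj_transpose, compl_proj_transpose, Matrix.mul_assoc]

theorem tangentProj_tangentProj {U V : Matrix (Fin n) (Fin r) ℝ} (hU : Uᵀ * U = 1)
    (hV : Vᵀ * V = 1) (Z : Matrix (Fin n) (Fin n) ℝ) :
    tangentProj U V (tangentProj U V Z) = tangentProj U V Z := by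
  have e : (1 - U * Uᵀ) * ((1 - U * Uᵀ) * Z * (1 - V * Vᵀ)) * (1 - V * Vᵀ) =
      (1 - U * Uᵀ) * Z * (1 - V * Vᵀ) := by
    rw [Matrix.mul_assoc (1 - U * Uᵀ) Z, ← Matrix.mul_assoc (1 - U * Uᵀ) (1 - U * Uᵀ),
      compl_proj_mul_self hU, Matrix.mul_assoc (1 - U * Uᵀ), Matrix.mul_assoc Z,
      compl_proj_mul_self hV]
  rw [tangentProj_eq U V (tangentProj U V Z), tangentProj_eq U V Z,
    Matrix.mul_sub (1 - U * Uᵀ) Z, Matrix.sub_mul _ _ (1 - V * Vᵀ), e]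
  abel

theorem fn_tangentProj_le {U V : Matrix (Fin n) (Fin r) ℝ} (hU : Uᵀ * U = 1)
    (hV : Vᵀ * V = 1) (Z : Matrix (Fin n) (Fin n) ℝ) : fn (tangentProj U V Z) ≤ fn Z := by
  have h : fn (tangentProj U V Z) ^ 2 ≤ fn Z * fn (tangentProj U V Z) := by
    rw [← fi_self, fi_tangentProj, tangentProj_tangentProj hU hV]
    exact fi_le _ _
  by_contra! hc
  nlinarith [fn_nonneg Z]

theorem tangentProj_of_compl {U V : Matrix (Fin n) (Fin r) ℝ} {Z : Matrix (Fin n) (Fin n) ℝ}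
    (h : (1 - U * Uᵀ) * Z = 0) : tangentProj U V Z = Z := by
  rw [tangentProj_eq, h, Matrix.zero_mul, sub_zero]

/-- In Z − P_T Z = (1 − UUᵀ)Z(1 − VVᵀ) the two outer factors are exchanged one at a time; the factor
that is kept is a contraction. -/
theorem fn_tangentProj_sub_le {U V U' V' : Matrix (Fin n) (Fin r) ℝ} (hU' : U'ᵀ * U' = 1)
    (hV : Vᵀ * V = 1) {t : ℝ} (h1 : ‖U' * U'ᵀ - U * Uᵀ‖ ≤ t) (h2 : ‖V' * V'ᵀ - V * Vᵀ‖ ≤ t)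
    (Z : Matrix (Fin n) (Fin n) ℝ) :
    fn (tangentProj U' V' Z - tangentProj U V Z) ≤ 2 * t * fn Z := by
  have e : tangentProj U' V' Z - tangentProj U V Z =
      (U' * U'ᵀ - U * Uᵀ) * (Z * (1 - V * Vᵀ)) +
        (1 - U' * U'ᵀ) * (Z * (V' * V'ᵀ - V * Vᵀ)) := by
    unfold tangentProj; noncomm_ring
  have h3 := norm_compl_proj_le hU'
  have h4 := norm_compl_proj_le hV
  have h0 := fn_nonneg Z
  have ht : 0 ≤ t := (norm_nonneg _).trans h1
  rw [e]
  calc _ ≤ t * (fn Z * 1) + 1 * (fn Z * t) := by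
        refine (fn_add_le _ _).trans (add_le_add ?_ ?_)
        · refine (fn_mul_le _ _).trans ?_
          gcongr
          · exact fn_nonneg _
          · exact (fn_mul_le' _ _).trans (by gcongr)
        · refine (fn_mul_le _ _).trans ?_
          gcongr
          · exact fn_nonneg _
          · exact (fn_mul_le' _ _).trans (by gcongr)
    _ = _ := by ring

/-! The singular value decomposition routine. -/

namespace SVDRoutine

variable (S : SVDRoutine n)

theorem leftFactor_orth (hr : r ≤ n) (Z : Matrix (Fin n) (Fin n) ℝ) :
    (S.leftFactor hr Z)ᵀ * S.leftFactor hr Z = 1 := by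
  ext i j
  have h := congrFun (congrFun (S.left_orth Z) (Fin.castLE hr i)) (Fin.castLE hr j)
  simpa [Matrix.mul_apply, leftFactor, Matrix.one_apply, Fin.ext_iff] using h

theorem rightFactor_orth (hr : r ≤ n) (Z : Matrix (Fin n) (Fin n) ℝ) :
    (S.rightFactor hr Z)ᵀ * S.rightFactor hr Z = 1 := by
  ext i j
  have h := congrFun (congrFun (S.right_orth Z) (Fin.castLE hr i)) (Fin.castLE hr j)
  simpa [Matrix.mul_apply, rightFactor, Matrix.one_apply, Fin.ext_iff] using h

theorem hardThreshold_eq (hr : r ≤ n) (Z : Matrix (Fin n) (Fin n) ℝ) :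
    S.hardThreshold r Z =
      S.leftFactor hr Z * Matrix.diagonal (S.topSV hr Z) * (S.rightFactor hr Z)ᵀ := by
  ext i j
  rw [hardThreshold, Matrix.mul_apply, Matrix.mul_apply]
  simp only [Matrix.mul_diagonal, Matrix.transpose_apply, leftFactor, rightFactor, topSV,
    Matrix.submatrix_apply, id]
  refine (Finset.sum_of_injOn (Fin.castLE hr) (Fin.castLE_injective hr).injOn (by simp)
    (fun k _ hk => ?_) (fun k _ => ?_)).symm
  · have : ¬ (k : ℕ) < r := fun hlt => hk ⟨⟨k, hlt⟩, by simp, by ext; simp⟩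
    simp [this]
  · simp

/-- Orthogonal factors preserve rank, so at most r singular values are nonzero. As they decrease, a
nonzero one at index i would force i + 1 > r of them. -/
theorem sv_eq_zero {Z : Matrix (Fin n) (Fin n) ℝ} {A : Matrix (Fin n) (Fin r) ℝ}
    {B : Matrix (Fin r) (Fin n) ℝ} (hZ : Z = A * B) {i : Fin n} (hi : r ≤ i) : S.sv Z i = 0 := by
  by_contra hne
  have hrank : Z.rank ≤ r := by
    rw [hZ]
    exact (Matrix.rank_mul_le_left A B).trans ((Matrix.rank_le_card_width A).trans (by simp))
  have hD : Matrix.diagonal (S.sv Z) = (S.left Z)ᵀ * Z * S.right Z := by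
    have h := congrArg (fun M => (S.left Z)ᵀ * M * S.right Z) (S.eq Z)
    simp only [Matrix.mul_assoc, S.right_orth, Matrix.mul_one] at h
    rw [← Matrix.mul_assoc (S.left Z)ᵀ (S.left Z), S.left_orth, Matrix.one_mul] at h
    rw [Matrix.mul_assoc, h]
  have h2 : (Matrix.diagonal (S.sv Z)).rank ≤ r := by
    rw [hD]
    exact (Matrix.rank_mul_le_left _ _).trans ((Matrix.rank_mul_le_right _ _).trans hrank)
  rw [Matrix.rank_diagonal] at h2
  have hpos : ∀ j : Fin n, j ≤ i → S.sv Z j ≠ 0 := fun j hj h0 => by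
    have h3 := S.sv_antitone Z hj
    rw [h0] at h3
    exact hne (le_antisymm h3 (S.sv_nonneg Z i))
  have h4 : (Finset.Iic i).card ≤ Fintype.card {j // S.sv Z j ≠ 0} := by
    rw [Fintype.card_subtype]
    exact Finset.card_le_card fun j hj => by simpa using hpos j (Finset.mem_Iic.1 hj)
  rw [Fin.card_Iic] at h4
  omega

theorem hardThreshold_of_factor {Z : Matrix (Fin n) (Fin n) ℝ} {A : Matrix (Fin n) (Fin r) ℝ}
    {B : Matrix (Fin r) (Fin n) ℝ} (hZ : Z = A * B) : S.hardThreshold r Z = Z := by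
  rw [hardThreshold]
  conv_rhs => rw [S.eq Z]
  congr 3
  funext i
  split_ifs with h
  · rfl
  · exact (S.sv_eq_zero hZ (not_lt.1 h)).symm

theorem isReducedSVD_of_factor (hr : r ≤ n) {Z : Matrix (Fin n) (Fin n) ℝ}
    {A : Matrix (Fin n) (Fin r) ℝ} {B : Matrix (Fin r) (Fin n) ℝ} (hZ : Z = A * B)
    (hpos : ∀ k, 0 < S.topSV hr Z k) :
    IsReducedSVD Z (S.leftFactor hr Z) (S.topSV hr Z) (S.rightFactor hr Z) where
  left_orth := S.leftFactor_orth hr Z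
  right_orth := S.rightFactor_orth hr Z
  antitone := fun _ _ h => S.sv_antitone Z h
  pos := hpos
  eq := by rw [← S.hardThreshold_eq hr, S.hardThreshold_of_factor hZ]

theorem left_mul_transpose (Z : Matrix (Fin n) (Fin n) ℝ) : S.left Z * (S.left Z)ᵀ = 1 :=
  mul_eq_one_comm.1 (S.left_orth Z)

theorem right_mul_transpose (Z : Matrix (Fin n) (Fin n) ℝ) : S.right Z * (S.right Z)ᵀ = 1 :=
  mul_eq_one_comm.1 (S.right_orth Z)

/-- Eckart–Young theorem in Frobenius norm. -/
theorem fn_sub_hardThreshold_le (hr : r ≤ n) (W X : Matrix (Fin n) (Fin n) ℝ)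
    {U : Matrix (Fin n) (Fin r) ℝ} (hU : Uᵀ * U = 1) (hX : (1 - U * Uᵀ) * X = 0) :
    fn (W - S.hardThreshold r W) ≤ fn (W - X) := by
  set s := S.sv W with hs
  set P := S.left W with hP
  have hPP : Pᵀ * P = 1 := S.left_orth W
  have hPP' : P * Pᵀ = 1 := S.left_mul_transpose W
  have hQQ : (S.right W)ᵀ * S.right W = 1 := S.right_orth W
  have hW : W = P * Matrix.diagonal s * (S.right W)ᵀ := S.eq W
  have hdiag : ∀ v : Fin n → ℝ, fn (Matrix.diagonal v) ^ 2 = ∑ j, v j ^ 2 := by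
    intro v
    rw [fn_sq]
    refine Finset.sum_congr rfl fun i _ => ?_
    rw [Finset.sum_eq_single i (fun j _ hj => by
      rw [Matrix.diagonal_apply_ne _ hj.symm]; norm_num) (by simp), Matrix.diagonal_apply_eq]
  have e1 : fn (W - S.hardThreshold r W) ^ 2 =
      ∑ j : Fin n, (s j ^ 2 - if (j : ℕ) < r then s j ^ 2 else 0) := by
    have : W - S.hardThreshold r W =
        P * Matrix.diagonal (fun j : Fin n => if (j : ℕ) < r then 0 else s j) *
          (S.right W)ᵀ := by
      conv_lhs => lhs; rw [hW]
      rw [hardThreshold, ← Matrix.sub_mul, ← Matrix.mul_sub, Matrix.diagonal_sub]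
      congr 3
      funext j
      split_ifs <;> simp [hs]
    rw [this, fn_mul_transpose_of_orth hQQ, fn_mul_of_orth hPP, hdiag]
    refine Finset.sum_congr rfl fun j _ => ?_
    split_ifs <;> simp
  -- w j is the squared length of the projection of the j-th left singular vector to the range of U.
  -- The residual of projecting W to that range is Σ s_j²(1 − w_j), with 0 ≤ w_j ≤ 1 and total
  -- weight r, so the best weights are concentrated on the r largest s_j.
  set w : Fin n → ℝ := fun j => ∑ k, (Uᵀ * P) k j ^ 2 with hw
  have hPyth : ∀ Z : Matrix (Fin n) (Fin n) ℝ,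
      fn ((1 - U * Uᵀ) * Z) ^ 2 = fn Z ^ 2 - fn (Uᵀ * Z) ^ 2 := by
    intro Z
    rw [← fi_self, fi_mul_left, compl_proj_transpose, ← Matrix.mul_assoc, compl_proj_mul_self hU,
      Matrix.sub_mul, Matrix.one_mul, fi_sub_right, fi_self, ← fi_self (Uᵀ * Z), fi_mul_left,
      Matrix.transpose_transpose, Matrix.mul_assoc]
  have e2 : ∑ j, (s j ^ 2 - s j ^ 2 * w j) ≤ fn (W - X) ^ 2 := by
    have h1 : fn ((1 - U * Uᵀ) * W) ≤ fn (W - X) := by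
      have : (1 - U * Uᵀ) * W = (1 - U * Uᵀ) * (W - X) := by
        rw [Matrix.mul_sub, hX, sub_zero]
      rw [this]
      refine (fn_mul_le _ _).trans ?_
      calc _ ≤ 1 * fn (W - X) := by
            have := fn_nonneg (W - X)
            gcongr
            exact norm_compl_proj_le hU
        _ = _ := one_mul _
    refine le_trans (le_of_eq ?_) (pow_le_pow_left₀ (fn_nonneg _) h1 2)
    rw [hPyth, Finset.sum_sub_distrib]
    congr 1
    · conv_rhs => rw [hW]
      rw [fn_mul_transpose_of_orth hQQ, fn_mul_of_orth hPP, hdiag]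
    · conv_rhs => rw [hW]
      rw [← Matrix.mul_assoc, fn_mul_transpose_of_orth hQQ, ← Matrix.mul_assoc, fn_sq,
        Finset.sum_comm]
      refine Finset.sum_congr rfl fun j _ => ?_
      rw [hw, Finset.mul_sum]
      refine Finset.sum_congr rfl fun k _ => ?_
      rw [Matrix.mul_diagonal]; ring
  have hwsum : ∑ j, w j = r := by
    have h1 : ∑ j, w j = fn (Uᵀ * P) ^ 2 := by rw [fn_sq, Finset.sum_comm]
    have h2 : Uᵀ * P = Uᵀ * (Pᵀ)ᵀ := by rw [Matrix.transpose_transpose]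
    rw [h1, h2, fn_mul_transpose_of_orth (by rw [Matrix.transpose_transpose, hPP']),
      fn_transpose, ← Matrix.mul_one U, fn_mul_of_orth hU, fn_sq]
    simp [Matrix.one_apply]
  have hw1 : ∀ j, w j ≤ 1 := by
    intro j
    have h1 : w j = fn (Uᵀ * P * Matrix.of fun k (_ : Unit) => if k = j then (1 : ℝ) else 0) ^ 2 := by
      rw [fn_sq, hw]
      refine Finset.sum_congr rfl fun k _ => ?_
      simp [Matrix.mul_apply (M := Uᵀ * P)]
    have h2 : fn (Matrix.of fun (k : Fin n) (_ : Unit) => if k = j then (1 : ℝ) else 0) ^ 2 = 1 := by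
      rw [fn_sq]
      simp
    rw [h1]
    refine (pow_le_pow_left₀ (fn_nonneg _) ((fn_mul_le _ _).trans ?_) 2).trans_eq h2
    have h3 : ‖Uᵀ * P‖ ≤ 1 := by
      refine (Matrix.l2_opNorm_mul _ _).trans ?_
      rw [norm_transpose]
      exact mul_le_one₀ (norm_le_one_of_transpose_mul_self hU) (norm_nonneg _)
        (norm_le_one_of_transpose_mul_self hPP)
    exact mul_le_of_le_one_left (fn_nonneg _) h3
  have hw0 : ∀ j, 0 ≤ w j := fun j => Finset.sum_nonneg fun k _ => sq_nonneg _
  -- τ separates the r largest squares from the rest. The weight difference 1_{j<r} − w_j sums to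
  -- zero, so subtracting τ changes nothing and makes each term of `key` nonnegative. For r = n
  -- there is no rest and τ = 0 serves.
  obtain ⟨τ, hτ1, hτ2⟩ : ∃ τ : ℝ, (∀ j : Fin n, (j : ℕ) < r → τ ≤ s j ^ 2) ∧
      ∀ j : Fin n, r ≤ j → s j ^ 2 ≤ τ := by
    by_cases h : r < n
    · refine ⟨s ⟨r, h⟩ ^ 2, fun j hj => ?_, fun j hj => ?_⟩
      · exact pow_le_pow_left₀ (S.sv_nonneg W _) (S.sv_antitone W (Fin.mk_le_mk.2 hj.le : j ≤ ⟨r, h⟩)) 2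
      · exact pow_le_pow_left₀ (S.sv_nonneg W _) (S.sv_antitone W (show (⟨r, h⟩ : Fin n) ≤ j from hj)) 2
    · exact ⟨0, fun j _ => sq_nonneg _, fun j hj => absurd j.2 (by omega)⟩
  have hind : ∑ j : Fin n, (if (j : ℕ) < r then (1 : ℝ) else 0) = r := by
    rw [Finset.sum_ite]
    simp only [Finset.sum_const, nsmul_eq_mul, mul_one, mul_zero, add_zero]
    norm_cast
    rw [Fin.card_filter_val_lt]
    omega
  have key : 0 ≤ ∑ j : Fin n, (s j ^ 2 - τ) * ((if (j : ℕ) < r then (1 : ℝ) else 0) - w j) := by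
    refine Finset.sum_nonneg fun j _ => ?_
    split_ifs with h
    · exact mul_nonneg (sub_nonneg.2 (hτ1 j h)) (sub_nonneg.2 (hw1 j))
    · have := hτ2 j (not_lt.1 h)
      have := hw0 j
      nlinarith
  have key2 : ∑ j : Fin n, (s j ^ 2 - τ) * ((if (j : ℕ) < r then (1 : ℝ) else 0) - w j) =
      ∑ j : Fin n, (if (j : ℕ) < r then s j ^ 2 else 0) - ∑ j, s j ^ 2 * w j := by
    have : ∀ j : Fin n, (s j ^ 2 - τ) * ((if (j : ℕ) < r then (1 : ℝ) else 0) - w j) =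
        (if (j : ℕ) < r then s j ^ 2 else 0) - s j ^ 2 * w j -
          τ * ((if (j : ℕ) < r then (1 : ℝ) else 0) - w j) := by
      intro j; split_ifs <;> ring
    simp only [this, Finset.sum_sub_distrib, ← Finset.mul_sum, hind, hwsum]
    ring
  refine (sq_le_sq₀ (fn_nonneg _) (fn_nonneg _)).1 ?_
  rw [e1]
  refine le_trans ?_ e2
  rw [Finset.sum_sub_distrib, Finset.sum_sub_distrib]
  linarith

/-- Eckart–Young with X as competitor, and the triangle inequality. This is the factor 2 by which
retraction to rank r inflates every step. -/
theorem fn_hardThreshold_sub_le (hr : r ≤ n) (W X : Matrix (Fin n) (Fin n) ℝ)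
    {U : Matrix (Fin n) (Fin r) ℝ} (hU : Uᵀ * U = 1) (hX : (1 - U * Uᵀ) * X = 0) :
    fn (S.hardThreshold r W - X) ≤ 2 * fn (W - X) := by
  have h := S.fn_sub_hardThreshold_le hr W X hU hX
  have e : S.hardThreshold r W - X = (W - X) - (W - S.hardThreshold r W) := by abel
  rw [e]
  linarith [fn_sub_le (W - X) (W - S.hardThreshold r W)]

/-- Weyl type lower bound for singular values. -/
theorem sub_norm_le_sv {k : ℕ} (Z X : Matrix (Fin n) (Fin n) ℝ) {W : Matrix (Fin n) (Fin k) ℝ}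
    (hW : Wᵀ * W = 1) {s : ℝ}
    (hs : ∀ y : Fin k → ℝ, s * ‖(WithLp.toLp 2 y : EuclideanSpace ℝ (Fin k))‖ ≤
      ‖(WithLp.toLp 2 ((X * W) *ᵥ y) : EuclideanSpace ℝ (Fin n))‖)
    {i : Fin n} (hi : (i : ℕ) < k) : s - ‖X - Z‖ ≤ S.sv Z i := by
  -- Dimension count: the i orthogonality conditions against the leading right singular vectors of Z
  -- have a nonzero solution in the k-dimensional range of W, since i < k. On it Z stretches by at
  -- most its singular value of index i.
  obtain ⟨y, hy0, hy⟩ : ∃ y : Fin k → ℝ, y ≠ 0 ∧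
      ∀ j : Fin n, j < i → ((S.right Z)ᵀ *ᵥ (W *ᵥ y)) j = 0 := by
    let f : (Fin k → ℝ) →ₗ[ℝ] (Fin i → ℝ) :=
      (((S.right Z)ᵀ * W).submatrix (Fin.castLE i.2.le) id).mulVecLin
    have hlt : Module.finrank ℝ (Fin i → ℝ) < Module.finrank ℝ (Fin k → ℝ) := by simpa using hi
    obtain ⟨y, hy, hy0⟩ := Submodule.exists_mem_ne_zero_of_ne_bot
      (LinearMap.ker_ne_bot_of_finrank_lt (f := f) hlt)
    refine ⟨y, hy0, fun j hj => ?_⟩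
    have h := congrFun (LinearMap.mem_ker.1 hy) ⟨j, hj⟩
    rw [Matrix.mulVec_mulVec]
    exact h
  set x := W *ᵥ y with hx
  have hy1 : 0 < ‖(WithLp.toLp 2 y : EuclideanSpace ℝ (Fin k))‖ := by
    rw [norm_pos_iff]
    simpa using hy0
  have horth : ∀ {p q : ℕ} (A : Matrix (Fin p) (Fin q) ℝ), Aᵀ * A = 1 → ∀ v : Fin q → ℝ,
      ‖(WithLp.toLp 2 (A *ᵥ v) : EuclideanSpace ℝ (Fin p))‖ =
        ‖(WithLp.toLp 2 v : EuclideanSpace ℝ (Fin q))‖ := by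
    intro p q A hA v
    have h1 : (A *ᵥ v) ⬝ᵥ (A *ᵥ v) = v ⬝ᵥ v := by
      rw [Matrix.dotProduct_mulVec, ← Matrix.mulVec_transpose, Matrix.mulVec_mulVec, hA,
        Matrix.one_mulVec]
    rw [EuclideanSpace.norm_eq, EuclideanSpace.norm_eq]
    congr 1
    simpa [dotProduct, sq] using h1
  have hZx : ‖(WithLp.toLp 2 (Z *ᵥ x) : EuclideanSpace ℝ (Fin n))‖ ≤
      S.sv Z i * ‖(WithLp.toLp 2 y : EuclideanSpace ℝ (Fin k))‖ := by
    have e : Z *ᵥ x = S.left Z *ᵥ (Matrix.diagonal (S.sv Z) *ᵥ ((S.right Z)ᵀ *ᵥ x)) := by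
      conv_lhs => rw [S.eq Z]
      rw [← Matrix.mulVec_mulVec, ← Matrix.mulVec_mulVec]
    rw [e, horth _ (S.left_orth Z), ← horth W hW y, ← hx,
      ← horth (S.right Z)ᵀ (by rw [Matrix.transpose_transpose]; exact S.right_mul_transpose Z) x]
    refine (sq_le_sq₀ (norm_nonneg _) (mul_nonneg (S.sv_nonneg Z i) (norm_nonneg _))).1 ?_
    rw [mul_pow, EuclideanSpace.norm_sq_eq, EuclideanSpace.norm_sq_eq, Finset.mul_sum]
    refine Finset.sum_le_sum fun j _ => ?_
    simp only [Matrix.mulVec_diagonal, Real.norm_eq_abs, sq_abs, mul_pow]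
    rcases lt_or_ge j i with h | h
    · rw [hy j h]; simp
    · gcongr
      · exact S.sv_nonneg Z j
      · exact S.sv_antitone Z h
  have hXx := hs y
  rw [← Matrix.mulVec_mulVec, ← hx] at hXx
  have hd := Matrix.l2_opNorm_mulVec (X - Z) (WithLp.toLp 2 x : EuclideanSpace ℝ (Fin n))
  rw [hx, horth W hW y, ← hx] at hd
  have htri : ‖(WithLp.toLp 2 (X *ᵥ x) : EuclideanSpace ℝ (Fin n))‖ ≤
      ‖(WithLp.toLp 2 (Z *ᵥ x) : EuclideanSpace ℝ (Fin n))‖ +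
        ‖(WithLp.toLp 2 ((X - Z) *ᵥ x) : EuclideanSpace ℝ (Fin n))‖ := by
    refine le_trans (le_of_eq ?_) (norm_add_le _ _)
    rw [← WithLp.toLp_add, Matrix.sub_mulVec]
    congr 2
    abel
  have hfin : (s - ‖X - Z‖) * ‖(WithLp.toLp 2 y : EuclideanSpace ℝ (Fin k))‖ ≤
      S.sv Z i * ‖(WithLp.toLp 2 y : EuclideanSpace ℝ (Fin k))‖ := by
    rw [sub_mul]
    have hd' : ‖(WithLp.toLp 2 ((X - Z) *ᵥ x) : EuclideanSpace ℝ (Fin n))‖ ≤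
      ‖X - Z‖ * ‖(WithLp.toLp 2 y : EuclideanSpace ℝ (Fin k))‖ := hd
    linarith
  exact le_of_mul_le_mul_right hfin hy1

end SVDRoutine

end Geometry

end

section

open scoped Matrix.Norms.L2Operator

/-! ### Local linear convergence -/

section Local

variable {n r : ℕ}

theorem fi_hadamard (w A B : Matrix (Fin n) (Fin n) ℝ) :
    fi A (Matrix.hadamard w B) = ∑ i, ∑ j, w i j * (A i j * B i j) := by
  simp only [fi, Matrix.hadamard_apply]
  exact Finset.sum_congr rfl fun i _ => Finset.sum_congr rfl fun j _ => by ring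

theorem fi_hadamard_comm (w A B : Matrix (Fin n) (Fin n) ℝ) :
    fi A (Matrix.hadamard w B) = fi B (Matrix.hadamard w A) := by
  rw [fi_hadamard, fi_hadamard]
  exact Finset.sum_congr rfl fun i _ => Finset.sum_congr rfl fun j _ => by ring

theorem fi_hadamard_self_nonneg {w : Matrix (Fin n) (Fin n) ℝ} (hw : ∀ i j, 0 ≤ w i j)
    (A : Matrix (Fin n) (Fin n) ℝ) : 0 ≤ fi A (Matrix.hadamard w A) := by
  rw [fi_hadamard]
  exact Finset.sum_nonneg fun i _ => Finset.sum_nonneg fun j _ =>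
    mul_nonneg (hw i j) (mul_self_nonneg _)

theorem fi_hadamard_self_le {w : Matrix (Fin n) (Fin n) ℝ} {M : ℝ} (hw : ∀ i j, w i j ≤ M)
    (A : Matrix (Fin n) (Fin n) ℝ) : fi A (Matrix.hadamard w A) ≤ M * fn A ^ 2 := by
  rw [fi_hadamard, fn_sq, Finset.mul_sum]
  refine Finset.sum_le_sum fun i _ => ?_
  rw [Finset.mul_sum]
  refine Finset.sum_le_sum fun j _ => ?_
  rw [← sq]
  exact mul_le_mul_of_nonneg_right (hw i j) (sq_nonneg _)

theorem hadamard_add_right (w A B : Matrix (Fin n) (Fin n) ℝ) :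
    Matrix.hadamard w (A + B) = Matrix.hadamard w A + Matrix.hadamard w B :=
  Matrix.hadamard_add _ _ _

theorem hadamard_sub_right (w A B : Matrix (Fin n) (Fin n) ℝ) :
    Matrix.hadamard w (A - B) = Matrix.hadamard w A - Matrix.hadamard w B := by
  ext i j; simp [mul_sub]

theorem hadamard_smul_right (w A : Matrix (Fin n) (Fin n) ℝ) (t : ℝ) :
    Matrix.hadamard w (t • A) = t • Matrix.hadamard w A := Matrix.hadamard_smul _ _ _

/-- Cauchy–Schwarz for the semidefinite form defined by nonnegative weights. It bounds cross terms
by two quadratic forms, so the large weights enter only through a square root. -/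
theorem fi_hadamard_sq_le {w : Matrix (Fin n) (Fin n) ℝ} (hw : ∀ i j, 0 ≤ w i j)
    (A B : Matrix (Fin n) (Fin n) ℝ) :
    fi A (Matrix.hadamard w B) ^ 2 ≤
      fi A (Matrix.hadamard w A) * fi B (Matrix.hadamard w B) := by
  simp only [fi_hadamard, ← Fintype.sum_prod_type']
  refine Finset.sum_sq_le_sum_mul_sum_of_sq_le_mul _ (fun p _ => ?_) (fun p _ => ?_) fun p _ => ?_
  · exact mul_nonneg (hw _ _) (mul_self_nonneg _)
  · exact mul_nonneg (hw _ _) (mul_self_nonneg _)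
  · exact le_of_eq (by ring)

/-- The regularity of the sampling operator with weights `w` at the iterate `Y`, with tangent space
given by `U`, `V`, that makes a step towards `X` contract. -/
structure IsRegularAt (w X Y : Matrix (Fin n) (Fin n) ℝ) (U V : Matrix (Fin n) (Fin r) ℝ)
    (p η : ℝ) : Prop where
  left_orth : Uᵀ * U = 1
  right_orth : Vᵀ * V = 1
  mem : tangentProj U V Y = Y
  rip : ∀ A B, tangentProj U V A = A → tangentProj U V B = B →
    |fi A (Matrix.hadamard w B) - p * fi A B| ≤ η * p * (fn A * fn B)
  normal : fn (X - tangentProj U V X) ≤ η * fn (Y - X)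
  cross : ∀ A, tangentProj U V A = A →
    |fi A (Matrix.hadamard w (X - tangentProj U V X))| ≤ η * p * (fn A * fn (Y - X))

/-- Restricted isometry on a subspace, from quadratic to bilinear form. -/
theorem rip_of_quadratic {w : Matrix (Fin n) (Fin n) ℝ} {U V : Matrix (Fin n) (Fin r) ℝ} {c p : ℝ}
    (h : ∀ A, tangentProj U V A = A →
      |fi A (Matrix.hadamard w A) - p * fn A ^ 2| ≤ c * fn A ^ 2)
    {A B : Matrix (Fin n) (Fin n) ℝ} (hA : tangentProj U V A = A) (hB : tangentProj U V B = B) :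
    |fi A (Matrix.hadamard w B) - p * fi A B| ≤ c * (fn A * fn B) := by
  rcases (fn_nonneg A).eq_or_lt with hA0 | hA0
  · rw [eq_zero_of_fn_eq_zero hA0.symm]
    simp [fi]
  rcases (fn_nonneg B).eq_or_lt with hB0 | hB0
  · rw [eq_zero_of_fn_eq_zero hB0.symm]
    simp [fi]
  set t := fn A with ht
  set u := fn B with hu
  -- Polarization after scaling A and B to equal norm, which gives the product of the norms rather
  -- than the sum of their squares.
  have hp := h (u • A + t • B) (by
    rw [tangentProj_add, tangentProj_smul, tangentProj_smul, hA, hB])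
  have hm := h (u • A - t • B) (by
    rw [tangentProj_sub, tangentProj_smul, tangentProj_smul, hA, hB])
  have hc := fi_hadamard_comm w A B
  have hc' := fi_comm A B
  have hA2 := fi_self A
  have hB2 := fi_self B
  rw [← ht] at hA2
  rw [← hu] at hB2
  simp only [← fi_self, hadamard_add_right, hadamard_sub_right, hadamard_smul_right, fi_add_left,
    fi_add_right, fi_sub_left, fi_sub_right, fi_smul_left, fi_smul_right, ← hc, ← hc', hA2, hB2]
    at hp hm
  rw [abs_le] at hp hm ⊢
  have htu : 0 < t * u := mul_pos hA0 hB0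
  constructor
  · refine le_of_mul_le_mul_left ?_ htu
    nlinarith
  · refine le_of_mul_le_mul_left ?_ htu
    nlinarith

/-- Duality: test with A = P_T Z itself. -/
theorem fn_tangentProj_le_of_forall {U V : Matrix (Fin n) (Fin r) ℝ} (hU : Uᵀ * U = 1)
    (hV : Vᵀ * V = 1) {Z : Matrix (Fin n) (Fin n) ℝ} {c : ℝ} (hc : 0 ≤ c)
    (h : ∀ A, tangentProj U V A = A → fi A Z ≤ c * fn A) : fn (tangentProj U V Z) ≤ c := by
  have h1 := h _ (tangentProj_tangentProj hU hV Z)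
  rw [← tangentProj_tangentProj hU hV Z, fi_tangentProj, tangentProj_tangentProj hU hV Z,
    fi_self] at h1
  by_contra! hlt
  nlinarith

namespace IsRegularAt

variable {w X Y : Matrix (Fin n) (Fin n) ℝ} {U V : Matrix (Fin n) (Fin r) ℝ} {p η : ℝ}

/-- Split X − Y = F + N into its tangential part F and the normal part N of X. The error after a
step of length 1/p consists of the isometry defect on F, of N itself, and of the sampled N seen from
the tangent space; each is at most η times the present error. -/
theorem fn_add_gradient_le (h : IsRegularAt w X Y U V p η) (hp : 0 < p) (hη : 0 ≤ η) :
    fn (Y - X + p⁻¹ • tangentProj U V (Matrix.hadamard w (X - Y))) ≤ 3 * η * fn (Y - X) := by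
  set P := tangentProj U V with hP
  set N := X - P X with hN
  have he := fn_nonneg (Y - X)
  have hPP := tangentProj_tangentProj h.left_orth h.right_orth
  have h2 : fn (P (X - Y)) ≤ fn (Y - X) :=
    (fn_tangentProj_le h.left_orth h.right_orth _).trans_eq (fn_sub_comm _ _)
  have hsplit : X - Y = P (X - Y) + N := by
    rw [hN, hP, tangentProj_sub, h.mem]; abel
  have hF := hPP (X - Y)
  rw [← hP] at hF
  generalize P (X - Y) = F at h2 hsplit hF
  have e : Y - X + p⁻¹ • P (Matrix.hadamard w (X - Y)) =
      P (p⁻¹ • Matrix.hadamard w F - F) - N + P (p⁻¹ • Matrix.hadamard w N) := by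
    have e1 : Y - X = -F - N := by
      rw [← neg_sub, hsplit]; abel
    rw [e1, hsplit, hadamard_add_right, hP, tangentProj_add, tangentProj_sub, ← hP, hF, hP,
      tangentProj_smul, tangentProj_smul, smul_add]
    abel
  rw [e]
  have b1 : fn (P (p⁻¹ • Matrix.hadamard w F - F)) ≤ η * fn (Y - X) := by
    refine fn_tangentProj_le_of_forall h.left_orth h.right_orth (by positivity) fun A hA => ?_
    have h1 := h.rip A F hA hF
    rw [fi_sub_right, fi_smul_right]
    have h3 := (le_abs_self _).trans h1
    have h4 : p⁻¹ * fi A (Matrix.hadamard w F) - fi A F =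
        p⁻¹ * (fi A (Matrix.hadamard w F) - p * fi A F) := by
      field_simp
    rw [h4]
    calc _ ≤ p⁻¹ * (η * p * (fn A * fn (Y - X))) := by
          gcongr
          refine h3.trans ?_
          have := fn_nonneg A
          gcongr
      _ = _ := by field_simp
  have b2 : fn N ≤ η * fn (Y - X) := h.normal
  have b3 : fn (P (p⁻¹ • Matrix.hadamard w N)) ≤ η * fn (Y - X) := by
    refine fn_tangentProj_le_of_forall h.left_orth h.right_orth (by positivity) fun A hA => ?_
    have h3 := (le_abs_self _).trans (h.cross A hA)
    rw [fi_smul_right]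
    calc _ ≤ p⁻¹ * (η * p * (fn A * fn (Y - X))) := by gcongr
      _ = _ := by field_simp
  linarith [fn_add_le (P (p⁻¹ • Matrix.hadamard w F - F) - N) (P (p⁻¹ • Matrix.hadamard w N)),
    fn_sub_le (P (p⁻¹ • Matrix.hadamard w F - F)) N]

theorem fn_gradient_le (h : IsRegularAt w X Y U V p η) (hp : 0 < p) (hη : 0 ≤ η) :
    fn (tangentProj U V (Matrix.hadamard w (X - Y))) ≤ p * ((1 + 3 * η) * fn (Y - X)) := by
  have h1 := h.fn_add_gradient_le hp hη
  set g := tangentProj U V (Matrix.hadamard w (X - Y))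
  have h2 : g = p • ((Y - X + p⁻¹ • g) - (Y - X)) := by
    rw [add_sub_cancel_left, smul_smul, mul_inv_cancel₀ hp.ne', one_smul]
  rw [h2, fn_smul, abs_of_pos hp]
  gcongr
  linarith [fn_sub_le (Y - X + p⁻¹ • g) (Y - X)]

theorem quadratic_lower (h : IsRegularAt w X Y U V p η) {A : Matrix (Fin n) (Fin n) ℝ}
    (hA : tangentProj U V A = A) :
    p * (1 - η) * fn A ^ 2 ≤ fi A (Matrix.hadamard w A) := by
  have := (abs_le.1 (h.rip A A hA hA)).1
  rw [fi_self] at this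
  nlinarith

theorem quadratic_upper (h : IsRegularAt w X Y U V p η) {A : Matrix (Fin n) (Fin n) ℝ}
    (hA : tangentProj U V A = A) :
    fi A (Matrix.hadamard w A) ≤ p * (1 + η) * fn A ^ 2 := by
  have := (abs_le.1 (h.rip A A hA hA)).2
  rw [fi_self] at this
  nlinarith

/-- One step along a direction `D = g + β q` that is conjugate to `q`, with exact line search. -/
theorem fn_step_le (h : IsRegularAt w X Y U V p η) (hp : 0 < p) (hη : 0 ≤ η) (hη1 : η ≤ 1 / 10)
    {q : Matrix (Fin n) (Fin n) ℝ} (hq : tangentProj U V q = q) {β : ℝ}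
    {g D : Matrix (Fin n) (Fin n) ℝ} (hg : g = tangentProj U V (Matrix.hadamard w (X - Y)))
    (hD : D = g + β • q) (hconj : β * fi D (Matrix.hadamard w q) = 0) :
    fn (Y + (fi g D / fi D (Matrix.hadamard w D)) • D - X) ≤
        5 * η * fn (Y - X) + p⁻¹ * (|β| * fn q) ∧
      fn D ≤ (1 + 6 * η) * (p * fn (Y - X)) := by
  have hgT : tangentProj U V g = g := by
    rw [hg, tangentProj_tangentProj h.left_orth h.right_orth]
  have hDT : tangentProj U V D = D := by
    rw [hD, tangentProj_add, tangentProj_smul, hgT, hq]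
  have he := fn_nonneg (Y - X)
  have hgb : fn g ≤ p * ((1 + 3 * η) * fn (Y - X)) := by
    rw [hg]; exact h.fn_gradient_le hp hη
  have h1 : fn (Y - X + p⁻¹ • g) ≤ 3 * η * fn (Y - X) := by
    rw [hg]; exact h.fn_add_gradient_le hp hη
  have hg0 := fn_nonneg g
  have hD0 := fn_nonneg D
  have hlow := h.quadratic_lower hDT
  constructor
  · set α := fi g D / fi D (Matrix.hadamard w D) with hα
    have e : Y + α • D - X = (Y - X + p⁻¹ • g) + (α - p⁻¹) • D + (p⁻¹ * β) • q := by
      rw [sub_smul]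
      nth_rewrite 3 [hD]
      rw [smul_add, smul_smul]
      abel
    -- By conjugacy ⟨D, w∘D⟩ = ⟨g, w∘D⟩, so α compares ⟨g, D⟩ with ⟨g, w∘D⟩, whose ratio is close to
    -- 1/p by the isometry. For D = 0 the value of α is irrelevant.
    have h2 : |α - p⁻¹| * fn D ≤ 2 * η * fn (Y - X) := by
      rcases hD0.eq_or_lt with hz | hpos
      · rw [← hz, mul_zero]; positivity
      have hQpos : 0 < fi D (Matrix.hadamard w D) :=
        lt_of_lt_of_le (by have : 0 < 1 - η := by linarith
                           positivity) hlow
      have hDg : fi D (Matrix.hadamard w D) = fi g (Matrix.hadamard w D) := by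
        nth_rewrite 1 [hD]
        rw [fi_add_left, fi_smul_left, fi_hadamard_comm w q, hconj, add_zero]
      have h3 := h.rip g D hgT hDT
      rw [← hDg] at h3
      have h4 : α - p⁻¹ = -(fi D (Matrix.hadamard w D) - p * fi g D) /
          (p * fi D (Matrix.hadamard w D)) := by
        rw [hα]; field_simp; ring
      rw [h4, abs_div, abs_neg, abs_of_pos (mul_pos hp hQpos), div_mul_eq_mul_div,
        div_le_iff₀ (mul_pos hp hQpos)]
      have h5 : (1 + 3 * η) ≤ 2 * (1 - η) := by linarith
      calc _ ≤ η * p * (fn g * fn D) * fn D := by gcongr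
        _ = η * p * fn D ^ 2 * fn g := by ring
        _ ≤ η * p * fn D ^ 2 * (p * (2 * (1 - η) * fn (Y - X))) := by
            gcongr
            exact hgb.trans (by gcongr)
        _ = 2 * η * fn (Y - X) * (p * (p * (1 - η) * fn D ^ 2)) := by ring
        _ ≤ _ := by gcongr
    rw [e]
    refine (fn_add_le _ _).trans (add_le_add ((fn_add_le _ _).trans ?_) (le_of_eq ?_))
    · rw [fn_smul]; linarith
    · rw [fn_smul, abs_mul, abs_of_pos (inv_pos.2 hp), mul_assoc]
  -- Pythagoras in the sampling form: g = D − βq with D conjugate to q, so the energy of g is that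
  -- of D plus β² times that of q. Without this the norm of the direction could build up along the
  -- iteration.
  · have h2 : fi D (Matrix.hadamard w D) ≤ fi g (Matrix.hadamard w g) := by
      by_cases hβ : β = 0
      · rw [hD, hβ, zero_smul, add_zero]
      have hz : fi D (Matrix.hadamard w q) = 0 := by
        rcases mul_eq_zero.1 hconj with h' | h'
        · exact absurd h' hβ
        · exact h'
      have e : g = D - β • q := by rw [hD]; abel
      have hq0 : 0 ≤ fi q (Matrix.hadamard w q) :=
        le_trans (by have : 0 ≤ 1 - η := by linarith
                     have := fn_nonneg q
                     positivity) (h.quadratic_lower hq)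
      rw [e]
      simp only [hadamard_sub_right, hadamard_smul_right, fi_sub_left, fi_sub_right,
        fi_smul_left, fi_smul_right, fi_hadamard_comm w q D, hz]
      nlinarith [mul_nonneg (sq_nonneg β) hq0]
    have h3 : (1 - η) * fn D ^ 2 ≤ (1 + η) * fn g ^ 2 := by
      have := (hlow.trans h2).trans (h.quadratic_upper hgT)
      rw [mul_assoc, mul_assoc] at this
      exact le_of_mul_le_mul_left this hp
    have h4 : fn D ≤ (1 + 2 * η) * fn g := by
      by_contra! hc
      have h5 : ((1 + 2 * η) * fn g) ^ 2 < fn D ^ 2 :=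
        pow_lt_pow_left₀ hc (by positivity) two_ne_zero
      have h6 : (1 + η) * fn g ^ 2 ≤ (1 - η) * ((1 + 2 * η) * fn g) ^ 2 := by
        have : (1 + η) ≤ (1 - η) * (1 + 2 * η) ^ 2 := by nlinarith [mul_nonneg hη hη]
        calc _ ≤ (1 - η) * (1 + 2 * η) ^ 2 * fn g ^ 2 := by gcongr
          _ = _ := by ring
      nlinarith
    calc fn D ≤ (1 + 2 * η) * (p * ((1 + 3 * η) * fn (Y - X))) := h4.trans (by gcongr)
      _ = (1 + 2 * η) * (1 + 3 * η) * (p * fn (Y - X)) := by ring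
      _ ≤ _ := by
        gcongr
        nlinarith

end IsRegularAt

theorem IsReducedSVD.mulVec_lower {X : Matrix (Fin n) (Fin n) ℝ}
    {U V : Matrix (Fin n) (Fin r) ℝ} {σ : Fin r → ℝ} (h : IsReducedSVD X U σ V) {s : ℝ}
    (hs : 0 < s) (hσ : ∀ k, s ≤ σ k) (y : Fin r → ℝ) :
    s * ‖(WithLp.toLp 2 y : EuclideanSpace ℝ (Fin r))‖ ≤
      ‖(WithLp.toLp 2 ((X * V) *ᵥ y) : EuclideanSpace ℝ (Fin n))‖ := by
  have e : y = (Matrix.diagonal (fun k => (σ k)⁻¹) * Uᵀ) *ᵥ ((X * V) *ᵥ y) := by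
    have e1 : Matrix.diagonal (fun k => (σ k)⁻¹) * Uᵀ * (X * V) = 1 := by
      conv_lhs => rw [h.eq]
      rw [Matrix.mul_assoc _ Vᵀ, h.right_orth, Matrix.mul_one, Matrix.mul_assoc,
        ← Matrix.mul_assoc Uᵀ, h.left_orth, Matrix.one_mul, Matrix.diagonal_mul_diagonal,
        ← Matrix.diagonal_one]
      congr 1
      funext k
      exact inv_mul_cancel₀ (h.pos k).ne'
    rw [Matrix.mulVec_mulVec, e1, Matrix.one_mulVec]
  have h1 : ‖Matrix.diagonal (fun k => (σ k)⁻¹) * Uᵀ‖ ≤ s⁻¹ := by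
    refine (Matrix.l2_opNorm_mul _ _).trans ?_
    rw [norm_transpose]
    calc _ ≤ s⁻¹ * 1 := by
          gcongr
          · exact norm_diagonal_inv_le hs hσ
          · exact norm_le_one_of_transpose_mul_self h.left_orth
      _ = _ := mul_one _
  have h2 := Matrix.l2_opNorm_mulVec (Matrix.diagonal (fun k => (σ k)⁻¹) * Uᵀ)
    (WithLp.toLp 2 ((X * V) *ᵥ y) : EuclideanSpace ℝ (Fin n))
  have h3 : ‖(WithLp.toLp 2 y : EuclideanSpace ℝ (Fin r))‖ ≤
      ‖Matrix.diagonal (fun k => (σ k)⁻¹) * Uᵀ‖ *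
        ‖(WithLp.toLp 2 ((X * V) *ᵥ y) : EuclideanSpace ℝ (Fin n))‖ := by
    refine le_trans (le_of_eq ?_) h2
    conv_lhs => rw [e]
    rfl
  have h4 := h3.trans (mul_le_mul_of_nonneg_right h1 (norm_nonneg _))
  rwa [inv_mul_eq_div, le_div_iff₀ hs, mul_comm] at h4

theorem SVDRoutine.topSV_lower (S : SVDRoutine n) (hr : r ≤ n) {X Y : Matrix (Fin n) (Fin n) ℝ}
    {U V : Matrix (Fin n) (Fin r) ℝ} {σ : Fin r → ℝ} (h : IsReducedSVD X U σ V) {s : ℝ}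
    (hs : 0 < s) (hσ : ∀ k, s ≤ σ k) (k : Fin r) : s - ‖X - Y‖ ≤ S.topSV hr Y k :=
  S.sub_norm_le_sv Y X h.right_orth (h.mulVec_lower hs hσ) k.2

/-- The restricted isometry property passes to a small perturbation of an element of the tangent
space. -/
theorem rip_perturb {w : Matrix (Fin n) (Fin n) ℝ} {U V : Matrix (Fin n) (Fin r) ℝ}
    (hU : Uᵀ * U = 1) (hV : Vᵀ * V = 1) {p η : ℝ} (hn1 : (1 : ℝ) ≤ n) (hp : 0 < p) (hη : 0 < η)
    (hη1 : η ≤ 1 / 10) (hw0 : ∀ i j, 0 ≤ w i j) (hw : ∀ i j, w i j ≤ p * (n : ℝ) ^ 2)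
    (hrip : ∀ A, tangentProj U V A = A →
      |fi A (Matrix.hadamard w A) - p * fn A ^ 2| ≤ η * p * fn A ^ 2)
    (A : Matrix (Fin n) (Fin n) ℝ) (hDn : n * fn (A - tangentProj U V A) ≤ η * fn A) :
    |fi A (Matrix.hadamard w A) - p * fn A ^ 2| ≤ 6 * η * p * fn A ^ 2 := by
  have hn0 : (0 : ℝ) < n := by linarith
  set A₀ := tangentProj U V A with hA₀
  set D := A - A₀ with hD
  have hA₀T : tangentProj U V A₀ = A₀ := tangentProj_tangentProj hU hV A
  have horth : fi A₀ D = 0 := by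
    rw [hD, fi_sub_right, hA₀, fi_tangentProj, fi_tangentProj,
      tangentProj_tangentProj hU hV, sub_self]
  have hAD : A = A₀ + D := by rw [hD]; abel
  have hpyth : fn A ^ 2 = fn A₀ ^ 2 + fn D ^ 2 := by
    rw [← fi_self, hAD, fi_add_left, fi_add_right, fi_add_right, fi_comm D A₀, horth, fi_self,
      fi_self]
    ring
  have hexp : fi A (Matrix.hadamard w A) = fi A₀ (Matrix.hadamard w A₀) +
      2 * fi A₀ (Matrix.hadamard w D) + fi D (Matrix.hadamard w D) := by
    rw [hAD, hadamard_add_right, fi_add_left, fi_add_right, fi_add_right,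
      fi_hadamard_comm w D A₀]
    ring
  have q0 := hrip A₀ hA₀T
  have qD0 := fi_hadamard_self_nonneg hw0 D
  -- Here the weights enter only through the crude bound pn², so the normal part D of A counts as
  -- n·‖D‖. This is why the neighbourhood of regularity shrinks like 1/n.
  have qD : fi D (Matrix.hadamard w D) ≤ p * (η ^ 2 * fn A ^ 2) := by
    refine (fi_hadamard_self_le hw D).trans ?_
    have := pow_le_pow_left₀ (mul_nonneg hn0.le (fn_nonneg D)) hDn 2
    calc _ = p * (n * fn D) ^ 2 := by ring
      _ ≤ p * (η * fn A) ^ 2 := by gcongr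
      _ = _ := by ring
  have hA2 := sq_nonneg (fn A)
  have q0' : fi A₀ (Matrix.hadamard w A₀) ≤ 2 * p * fn A ^ 2 := by
    have h1 := (abs_le.1 q0).2
    have h2 : fn A₀ ^ 2 ≤ fn A ^ 2 := by nlinarith [sq_nonneg (fn D)]
    have : η * p * fn A₀ ^ 2 ≤ 1 * p * fn A₀ ^ 2 := by gcongr; linarith
    nlinarith
  have hcross : |fi A₀ (Matrix.hadamard w D)| ≤ 3 / 2 * η * p * fn A ^ 2 := by
    refine abs_le_of_sq_le_sq ?_ (by positivity)
    refine (fi_hadamard_sq_le hw0 A₀ D).trans ?_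
    calc _ ≤ (2 * p * fn A ^ 2) * (p * (η ^ 2 * fn A ^ 2)) := by
          gcongr
      _ ≤ (3 / 2) ^ 2 * (p ^ 2 * η ^ 2 * (fn A ^ 2) ^ 2) := by
          have : 0 ≤ p ^ 2 * η ^ 2 * (fn A ^ 2) ^ 2 := by positivity
          nlinarith
      _ = _ := by ring
  have hD2 : fn D ^ 2 ≤ η ^ 2 * fn A ^ 2 := by
    have h1 : fn D ≤ η * fn A :=
      (le_mul_of_one_le_left (fn_nonneg D) hn1).trans hDn
    calc _ ≤ (η * fn A) ^ 2 := pow_le_pow_left₀ (fn_nonneg D) h1 2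
      _ = _ := by ring
  have hη2 : η ^ 2 ≤ η / 10 := by
    rw [sq, div_eq_mul_one_div]
    exact mul_le_mul_of_nonneg_left hη1 hη.le
  have hq1 : η * p * fn A₀ ^ 2 ≤ η * p * fn A ^ 2 := by
    gcongr ?_ * ?_
    linarith [sq_nonneg (fn D)]
  have hq2 : p * (η ^ 2 * fn A ^ 2) ≤ η * p * fn A ^ 2 := by
    calc _ ≤ p * (η / 10 * fn A ^ 2) := by gcongr
      _ = η * p * fn A ^ 2 / 10 := by ring
      _ ≤ _ := by
        have : 0 ≤ η * p * fn A ^ 2 := by positivity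
        linarith
  have hq3 : p * fn D ^ 2 ≤ η * p * fn A ^ 2 :=
    (mul_le_mul_of_nonneg_left hD2 hp.le).trans hq2
  have hq4 : 0 ≤ p * fn D ^ 2 := by positivity
  have hq5 : 0 ≤ η * p * fn A ^ 2 := by positivity
  rw [abs_le] at q0 hcross ⊢
  rw [hexp]
  have hp2 : p * fn A ^ 2 = p * fn A₀ ^ 2 + p * fn D ^ 2 := by rw [hpyth]; ring
  constructor <;> linarith [q0.1, q0.2, hcross.1, hcross.2]

/-- Near `X`, the regularity conditions follow from the restricted isometry property on the tangent
space at `X`. -/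
theorem isRegularAt_of_near (S : SVDRoutine n) (hr : r ≤ n) {w X Y : Matrix (Fin n) (Fin n) ℝ}
    {U V : Matrix (Fin n) (Fin r) ℝ} {σ : Fin r → ℝ} (h : IsReducedSVD X U σ V) {s p η : ℝ}
    (hs : 0 < s) (hσ : ∀ k, s ≤ σ k) (hn : 0 < n) (hp : 0 < p) (hη : 0 < η) (hη1 : η ≤ 1 / 10)
    (hw0 : ∀ i j, 0 ≤ w i j) (hw : ∀ i j, w i j ≤ p * (n : ℝ) ^ 2)
    (hrip : ∀ A, tangentProj U V A = A →
      |fi A (Matrix.hadamard w A) - p * fn A ^ 2| ≤ η * p * fn A ^ 2)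
    {A : Matrix (Fin n) (Fin r) ℝ} {B : Matrix (Fin r) (Fin n) ℝ} (hY : Y = A * B)
    (hnear : fn (Y - X) ≤ η * s / (8 * n)) :
    IsRegularAt w X Y (S.leftFactor hr Y) (S.rightFactor hr Y) p (6 * η) := by
  set U' := S.leftFactor hr Y
  set V' := S.rightFactor hr Y
  set e := fn (Y - X) with he
  have he0 : 0 ≤ e := fn_nonneg _
  have hn1 : (1 : ℝ) ≤ n := by exact_mod_cast hn
  have hn0 : (0 : ℝ) < n := by linarith
  have hne : n * (8 * e / s) ≤ η := by
    rw [le_div_iff₀ (by positivity)] at hnear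
    rw [mul_div_assoc', div_le_iff₀ hs]
    linarith
  have hes : 8 * e / s ≤ η := by
    have h0 : 0 ≤ 8 * e / s := by positivity
    nlinarith
  have hes2 : e ≤ s / 2 := by
    rw [div_le_iff₀ hs] at hes
    nlinarith
  have hnorm : ‖X - Y‖ ≤ e := (norm_le_fn _).trans_eq (fn_sub_comm _ _)
  have htop : ∀ k, s / 2 ≤ S.topSV hr Y k := fun k => by
    have := S.topSV_lower hr (Y := Y) h hs hσ k
    linarith
  have h' : IsReducedSVD Y U' (S.topSV hr Y) V' :=
    S.isReducedSVD_of_factor hr hY fun k => lt_of_lt_of_le (by linarith) (htop k)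
  have hs2 : 0 < s / 2 := by linarith
  have hσ2 : ∀ k, s / 2 ≤ σ k := fun k => by linarith [hσ k]
  -- Both decompositions have singular values at least s/2, so the projections differ by 2e/(s/2) =
  -- 4e/s. The tangent projections then differ by 8e/s, which explains the radius ηs/(8n).
  have hdU : ‖U' * U'ᵀ - U * Uᵀ‖ ≤ 4 * e / s := by
    refine (norm_proj_sub_proj_le h h' hs2 hσ2 htop).trans ?_
    rw [show 4 * e / s = 2 * (e / (s / 2)) by field_simp; ring]
    gcongr
  have hdV : ‖V' * V'ᵀ - V * Vᵀ‖ ≤ 4 * e / s := by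
    refine (norm_proj_sub_proj_le h.transpose h'.transpose hs2 hσ2 htop).trans ?_
    rw [show 4 * e / s = 2 * (e / (s / 2)) by field_simp; ring,
      ← Matrix.transpose_sub, norm_transpose]
    gcongr
  have hdT : ∀ Z, fn (tangentProj U' V' Z - tangentProj U V Z) ≤ 8 * e / s * fn Z := fun Z => by
    have := fn_tangentProj_sub_le h'.left_orth h.right_orth hdU hdV Z
    rwa [show 2 * (4 * e / s) = 8 * e / s by ring] at this
  have hquad : ∀ A, tangentProj U' V' A = A →
      |fi A (Matrix.hadamard w A) - p * fn A ^ 2| ≤ 6 * η * p * fn A ^ 2 := by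
    intro A hA
    have hDle : fn (A - tangentProj U V A) ≤ 8 * e / s * fn A := by
      have := hdT A
      rwa [hA] at this
    have hDn : n * fn (A - tangentProj U V A) ≤ η * fn A := by
      have hfA := fn_nonneg A
      calc _ ≤ n * (8 * e / s * fn A) := by gcongr
        _ = n * (8 * e / s) * fn A := by ring
        _ ≤ _ := by gcongr
    exact rip_perturb h.left_orth h.right_orth hn1 hp hη hη1 hw0 hw hrip A hDn
  have hN : fn (X - tangentProj U' V' X) ≤ e ^ 2 / s := by
    rw [sub_tangentProj, he, fn_sub_comm]
    exact h.fn_normal_le hs hσ (norm_compl_proj_le h'.left_orth)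
      (norm_compl_proj_le h'.right_orth) h'.compl_left_mul h'.mul_compl_right
  -- The normal part of X is quadratic in e; one factor e/s absorbs the n lost to the weights.
  have hnN : n * fn (X - tangentProj U' V' X) ≤ η * e := by
    have : n * (e ^ 2 / s) ≤ η * e := by
      calc n * (e ^ 2 / s) ≤ 8 * (n * (e ^ 2 / s)) := by
            have : 0 ≤ n * (e ^ 2 / s) := by positivity
            linarith
        _ = n * (8 * e / s) * e := by ring
        _ ≤ _ := by gcongr
    exact (mul_le_mul_of_nonneg_left hN hn0.le).trans this
  refine ⟨h'.left_orth, h'.right_orth, tangentProj_of_compl h'.compl_left_mul,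
    fun A B hA hB => rip_of_quadratic hquad hA hB, ?_, fun A hA => ?_⟩
  · have h0 := fn_nonneg (X - tangentProj U' V' X)
    nlinarith [mul_nonneg hη.le he0]
  -- Cauchy–Schwarz in the sampling form: the energy of A is at most 2p‖A‖² by the isometry, that of
  -- the normal part at most p(ηe)².
  · refine abs_le_of_sq_le_sq ?_ (by have := fn_nonneg A; positivity)
    refine (fi_hadamard_sq_le hw0 A _).trans ?_
    have h1 : fi A (Matrix.hadamard w A) ≤ 2 * p * fn A ^ 2 := by
      have h2 := (abs_le.1 (hquad A hA)).2
      have h3 : 6 * η * p * fn A ^ 2 ≤ 1 * p * fn A ^ 2 := by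
        gcongr; linarith
      linarith
    have h2 : fi (X - tangentProj U' V' X) (Matrix.hadamard w (X - tangentProj U' V' X)) ≤
        p * (η * e) ^ 2 := by
      refine (fi_hadamard_self_le hw _).trans ?_
      have := pow_le_pow_left₀ (mul_nonneg hn0.le (fn_nonneg _)) hnN 2
      calc _ = p * (n * fn (X - tangentProj U' V' X)) ^ 2 := by ring
        _ ≤ _ := by gcongr
    calc _ ≤ (2 * p * fn A ^ 2) * (p * (η * e) ^ 2) := by
          gcongr
          exact fi_hadamard_self_nonneg hw0 _
      _ ≤ 6 ^ 2 * (p ^ 2 * η ^ 2 * (fn A ^ 2 * e ^ 2)) := by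
          have : 0 ≤ p ^ 2 * η ^ 2 * (fn A ^ 2 * e ^ 2) := by positivity
          nlinarith
      _ = _ := by ring

end Local

end

/-! ### Linear convergence of RGrad and restarted RCG from regularity near X. -/

section Iterations

variable {n r m : ℕ}

theorem convergesLinearly_of_le {Y : ℕ → Matrix (Fin n) (Fin n) ℝ} {X : Matrix (Fin n) (Fin n) ℝ}
    {ν : ℝ} (h0 : 0 ≤ ν) (h1 : ν < 1) (h : ∀ l, fn (Y l - X) ≤ ν ^ l * fn (Y 0 - X)) :
    ConvergesLinearly Y X ν := by
  refine ⟨h0, h1, h, ?_⟩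
  refine tendsto_pi_nhds.2 fun i => tendsto_pi_nhds.2 fun j => ?_
  rw [tendsto_iff_dist_tendsto_zero]
  have hlim : Tendsto (fun l => ν ^ l * fn (Y 0 - X)) atTop (𝓝 0) := by
    simpa using (tendsto_pow_atTop_nhds_zero_of_lt_one h0 h1).mul_const (fn (Y 0 - X))
  refine squeeze_zero (fun l => dist_nonneg) (fun l => ?_) hlim
  rw [Real.dist_eq]
  exact (abs_apply_le_fn (Y l - X) i j).trans (h l)

theorem SVDRoutine.hardThreshold_factor (S : SVDRoutine n) (hr : r ≤ n)
    (Z : Matrix (Fin n) (Fin n) ℝ) : ∃ (A : Matrix (Fin n) (Fin r) ℝ)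
      (B : Matrix (Fin r) (Fin n) ℝ), S.hardThreshold r Z = A * B :=
  ⟨_, _, S.hardThreshold_eq hr Z⟩

theorem RGradAdmissible.rate_lt {ε₀ : ℝ} (h : RGradAdmissible ε₀) : ε₀ < 1 / 22 := by
  obtain ⟨h0, h4, h1⟩ := h
  rw [rgradRate, div_lt_one (by linarith)] at h1
  linarith

theorem RGradAdmissible.le_rate {ε₀ : ℝ} (h : RGradAdmissible ε₀) : ε₀ ≤ rgradRate ε₀ := by
  obtain ⟨h0, h4, -⟩ := h
  rw [rgradRate, le_div_iff₀ (by linarith)]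
  nlinarith

/-- The first summand of τ₁ already dominates ν_g because 10(1 − 4ε₀) ≤ 18, and everything else in
τ₁ + τ₂ is nonnegative. So admissibility for RCG includes that for RGrad. -/
theorem RCGAdmissible.bounds {κ₁ κ₂ ε₀ : ℝ} (h : RCGAdmissible κ₁ κ₂ ε₀) (h₁ : 0 ≤ κ₁)
    (h₂ : 0 ≤ κ₂) : RGradAdmissible ε₀ ∧ 8 * ε₀ ≤ rcgTau₁ κ₁ κ₂ ε₀ ∧
      rcgTau₂ κ₁ κ₂ ε₀ = 2 * (κ₂ * ((κ₁ + 4 * ε₀) / (1 - 4 * ε₀))) ∧ κ₁ < 1 := by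
  obtain ⟨h0, h4, h5, h6⟩ := h
  have hb : 0 < 1 - 4 * ε₀ := by linarith
  have hD : 0 < (1 - 4 * ε₀) - κ₁ * (1 + 4 * ε₀) := by linarith
  have hκε : 0 ≤ κ₁ * ε₀ := by positivity
  have hlast : 0 ≤ (4 * κ₂ * ε₀ + κ₁ * κ₂) / (1 - 4 * ε₀) := by positivity
  have hτ₂ : 0 ≤ rcgTau₂ κ₁ κ₂ ε₀ := by rw [rcgTau₂]; positivity
  have hfirst : 18 * ε₀ / (1 - 4 * ε₀) ≤
      (18 * ε₀ - 10 * κ₁ * ε₀ * (1 + 4 * ε₀)) / ((1 - 4 * ε₀) - κ₁ * (1 + 4 * ε₀)) := by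
    rw [div_le_div_iff₀ hb hD]
    nlinarith [mul_nonneg hκε h0.le, mul_nonneg (mul_nonneg hκε h0.le) h0.le]
  have h18 : 18 * ε₀ ≤ 18 * ε₀ / (1 - 4 * ε₀) := by
    rw [le_div_iff₀ hb]
    nlinarith
  refine ⟨⟨h0, h4, ?_⟩, ?_, ?_, ?_⟩
  · rw [rgradRate]
    rw [rcgTau₁] at h6
    linarith
  · rw [rcgTau₁]
    linarith
  · rw [rcgTau₂]
    ring
  · nlinarith

/-- ν_cg is the larger root of x² = τ₁x + τ₂, and τ₁ + τ₂ < 1 puts it below 1. Its positivity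
permits division by it in the convergence proof. -/
theorem rcgRate_spec {κ₁ κ₂ ε₀ : ℝ} (h : RCGAdmissible κ₁ κ₂ ε₀) (h₁ : 0 ≤ κ₁) (h₂ : 0 ≤ κ₂) :
    0 < rcgRate κ₁ κ₂ ε₀ ∧ rcgRate κ₁ κ₂ ε₀ < 1 ∧ rcgRate κ₁ κ₂ ε₀ ^ 2 =
      rcgTau₁ κ₁ κ₂ ε₀ * rcgRate κ₁ κ₂ ε₀ + rcgTau₂ κ₁ κ₂ ε₀ := by
  have h0 := h.1
  have h6 := h.2.2.2
  obtain ⟨-, hτ₁, -, -⟩ := h.bounds h₁ h₂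
  have hb : 0 < 1 - 4 * ε₀ := by linarith [h.2.1]
  have hτ₂ : 0 ≤ rcgTau₂ κ₁ κ₂ ε₀ := by rw [rcgTau₂]; positivity
  set a := rcgTau₁ κ₁ κ₂ ε₀
  set b := rcgTau₂ κ₁ κ₂ ε₀
  have hs := Real.sq_sqrt (show 0 ≤ a ^ 2 + 4 * b by positivity)
  have hs0 := Real.sqrt_nonneg (a ^ 2 + 4 * b)
  have hs2 : Real.sqrt (a ^ 2 + 4 * b) < 2 - a := by
    rw [Real.sqrt_lt' (by linarith)]
    nlinarith
  refine ⟨?_, ?_, ?_⟩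
  · rw [rcgRate]; linarith
  · rw [rcgRate]; linarith
  · rw [rcgRate]
    change ((a + Real.sqrt (a ^ 2 + 4 * b)) / 2) ^ 2 =
      a * ((a + Real.sqrt (a ^ 2 + 4 * b)) / 2) + b
    nlinarith

variable (S : SVDRoutine n) (hr : r ≤ n) {X : Matrix (Fin n) (Fin n) ℝ}
  {ω : Fin m → Fin n × Fin n} {U V : Matrix (Fin n) (Fin r) ℝ} {p ρ ε₀ : ℝ}

/-- Weights of the sampling operator. -/
def sampleWeight (ω : Fin m → Fin n × Fin n) (s : Finset (Fin m)) : Matrix (Fin n) (Fin n) ℝ :=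
  ∑ k ∈ s, Matrix.single (ω k).1 (ω k).2 (1 : ℝ)

theorem samplingOp_eq (ω : Fin m → Fin n × Fin n) (s : Finset (Fin m))
    (Z : Matrix (Fin n) (Fin n) ℝ) : samplingOp ω s Z = Matrix.hadamard (sampleWeight ω s) Z := rfl

/-- RGrad is the step estimate with q = 0 and β = 0: a factor 5·ε₀/10, doubled by thresholding,
gives ε₀ ≤ ν_g. Contraction keeps all iterates within ρ, where regularity is available. -/
theorem rgrad_convergesLinearly (hp : 0 < p) (hε : RGradAdmissible ε₀) (hU : Uᵀ * U = 1)
    (hX : (1 - U * Uᵀ) * X = 0)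
    (hreg : ∀ Y, (∃ (A : Matrix (Fin n) (Fin r) ℝ) (B : Matrix (Fin r) (Fin n) ℝ), Y = A * B) →
      fn (Y - X) ≤ ρ → IsRegularAt (sampleWeight ω Finset.univ) X Y (S.leftFactor hr Y)
        (S.rightFactor hr Y) p (ε₀ / 10))
    {X₀ : Matrix (Fin n) (Fin n) ℝ} (hX₀ : ∃ (A : Matrix (Fin n) (Fin r) ℝ)
      (B : Matrix (Fin r) (Fin n) ℝ), X₀ = A * B) (hρ : fn (X₀ - X) ≤ ρ) :
    ConvergesLinearly (rgradIter S hr X ω X₀) X (rgradRate ε₀) := by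
  have hε0 := hε.1
  have hε22 := hε.rate_lt
  have hν0 : 0 ≤ rgradRate ε₀ := hε0.le.trans hε.le_rate
  have h : ∀ l, (∃ (A : Matrix (Fin n) (Fin r) ℝ) (B : Matrix (Fin r) (Fin n) ℝ),
      rgradIter S hr X ω X₀ l = A * B) ∧
      fn (rgradIter S hr X ω X₀ l - X) ≤ rgradRate ε₀ ^ l * fn (X₀ - X) := by
    intro l
    induction l with
    | zero => exact ⟨hX₀, by simp [rgradIter]⟩
    | succ l ih =>
      obtain ⟨hfac, hle⟩ := ih
      refine ⟨S.hardThreshold_factor hr _, ?_⟩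
      change fn (rgradStep S hr X ω (rgradIter S hr X ω X₀ l) - X) ≤ _
      set Y := rgradIter S hr X ω X₀ l
      have hYρ : fn (Y - X) ≤ ρ := by
        refine hle.trans (le_trans ?_ hρ)
        exact mul_le_of_le_one_left (fn_nonneg _) (pow_le_one₀ hν0 hε.2.2.le)
      have hR := hreg Y hfac hYρ
      have hstep := (hR.fn_step_le hp (by positivity) (by linarith) (q := 0) (tangentProj_zero _ _)
        (β := 0) rfl (by simp; rfl) (by simp)).1
      simp only [fn_zero, mul_zero, add_zero, fi_self] at hstep
      rw [rgradStep]
      refine (S.fn_hardThreshold_sub_le hr _ X hU hX).trans ?_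
      have he := fn_nonneg (Y - X)
      calc _ ≤ 2 * (5 * (ε₀ / 10) * fn (Y - X)) := by
            gcongr
            exact hstep
        _ = ε₀ * fn (Y - X) := by ring
        _ ≤ rgradRate ε₀ * (rgradRate ε₀ ^ l * fn (X₀ - X)) := by
            gcongr
            exact hε.le_rate
        _ = _ := by ring
  exact convergesLinearly_of_le hν0 hε.2.2 fun l => (h l).2

/-- Conjugacy in the form β⟨D, w∘q⟩ = 0 covers restarted steps, where β = 0, together with the
others. The bound on β combines the two restart conditions with the isometry: the first limits ⟨g,
q⟩, the second limits ‖g‖ by κ₂‖q‖. -/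
theorem rcgStep_spec {κ₁ κ₂ η : ℝ} (hp : 0 < p) (h₁ : 0 ≤ κ₁) (h₂ : 0 ≤ κ₂) (hη : 0 ≤ η)
    (hη1 : η < 1) {Y : Matrix (Fin n) (Fin n) ℝ}
    (hR : IsRegularAt (sampleWeight ω Finset.univ) X Y (S.leftFactor hr Y) (S.rightFactor hr Y) p η)
    (P' : Matrix (Fin n) (Fin n) ℝ) :
    ∃ (β : ℝ) (D g q : Matrix (Fin n) (Fin n) ℝ),
      g = tangentProjAt S hr Y (Matrix.hadamard (sampleWeight ω Finset.univ) (X - Y)) ∧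
      q = tangentProjAt S hr Y P' ∧ D = g + β • q ∧
      β * fi D (Matrix.hadamard (sampleWeight ω Finset.univ) q) = 0 ∧
      |β| * fn q ≤ κ₂ * ((κ₁ + η) / (1 - η)) * fn q ∧
      rcgStep S hr κ₁ κ₂ X ω (Y, P') = (S.hardThreshold r (Y + (fi g D /
        fi D (Matrix.hadamard (sampleWeight ω Finset.univ) D)) • D), D) := by
  classical
  set w := sampleWeight ω Finset.univ
  set g := tangentProjAt S hr Y (Matrix.hadamard w (X - Y)) with hg
  set q := tangentProjAt S hr Y P' with hq
  set β : ℝ := if |fi g q| / (fn g * fn q) ≤ κ₁ ∧ fn g ≤ κ₂ * fn q then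
      -(fi g (Matrix.hadamard w q) / fi q (Matrix.hadamard w q)) else 0 with hβ
  have hqT : tangentProj (S.leftFactor hr Y) (S.rightFactor hr Y) q = q :=
    tangentProj_tangentProj hR.left_orth hR.right_orth _
  have hgT : tangentProj (S.leftFactor hr Y) (S.rightFactor hr Y) g = g :=
    tangentProj_tangentProj hR.left_orth hR.right_orth _
  have hDT : tangentProjAt S hr Y (g + β • q) = g + β • q := by
    rw [tangentProjAt, tangentProj_add, tangentProj_smul, hgT, hqT]
  have h1η : 0 < 1 - η := by linarith
  have hqlow := hR.quadratic_lower hqT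
  refine ⟨β, g + β • q, g, q, rfl, rfl, rfl, ?_, ?_, ?_⟩
  · by_cases hc : |fi g q| / (fn g * fn q) ≤ κ₁ ∧ fn g ≤ κ₂ * fn q
    · rw [hβ, if_pos hc]
      -- A vanishing denominator makes the quotient, and hence β, zero.
      by_cases hz : fi q (Matrix.hadamard w q) = 0
      · simp [hz]
      · rw [fi_add_left, fi_smul_left]
        field_simp
        ring
    · rw [hβ, if_neg hc, zero_mul]
  · by_cases hc : |fi g q| / (fn g * fn q) ≤ κ₁ ∧ fn g ≤ κ₂ * fn q
    · rcases (fn_nonneg q).eq_or_lt with hz | hpos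
      · rw [← hz, mul_zero, mul_zero]
      have hQpos : 0 < fi q (Matrix.hadamard w q) := lt_of_lt_of_le (by positivity) hqlow
      rw [hβ, if_pos hc, abs_neg, abs_div, abs_of_pos hQpos]
      -- When ‖g‖‖q‖ = 0 the tested quotient is 0/0 = 0 and carries no information, but then the
      -- inner product vanishes as well.
      have hinner : |fi g q| ≤ κ₁ * (fn g * fn q) := by
        rcases (mul_nonneg (fn_nonneg g) hpos.le).eq_or_lt with h0 | h0
        · have := abs_fi_le g q
          rw [← h0] at this ⊢
          simpa using this
        · exact (div_le_iff₀ h0).1 hc.1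
      have hnum : |fi g (Matrix.hadamard w q)| ≤ p * ((κ₁ + η) * (fn g * fn q)) := by
        have h1 := hR.rip g q hgT hqT
        have e : fi g (Matrix.hadamard w q) =
          (fi g (Matrix.hadamard w q) - p * fi g q) + p * fi g q := by ring
        rw [e]
        refine (abs_add_le _ _).trans ?_
        rw [abs_mul, abs_of_pos hp]
        nlinarith [mul_le_mul_of_nonneg_left hinner hp.le]
      gcongr
      rw [div_le_iff₀ hQpos]
      calc _ ≤ p * ((κ₁ + η) * (κ₂ * fn q * fn q)) := by
            refine hnum.trans ?_
            gcongr
            exact hc.2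
        _ = κ₂ * ((κ₁ + η) / (1 - η)) * (p * (1 - η) * fn q ^ 2) := by field_simp
        _ ≤ _ := by gcongr
    · rw [hβ, if_neg hc, abs_zero, zero_mul]
      have := fn_nonneg q
      positivity
  · change (S.hardThreshold r (Y + (fi g (tangentProjAt S hr Y (g + β • q)) /
      fi (tangentProjAt S hr Y (g + β • q)) (Matrix.hadamard w
        (tangentProjAt S hr Y (g + β • q)))) • (g + β • q)), g + β • q) = _
    rw [hDT]

/-- The induction carries the error bound ν^l E together with a bound on ν‖P_{l−1}‖; the extra
factor ν avoids the exponent l − 1, which is meaningless at l = 0. The gradient part contributes ε₀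
≤ τ₁ and the conjugate part at most τ₂, and ν² = τ₁ν + τ₂ closes the recursion. -/
theorem rcg_convergesLinearly (hp : 0 < p) {κ₁ κ₂ : ℝ} (h₁ : 0 ≤ κ₁) (h₂ : 0 ≤ κ₂)
    (hε : RCGAdmissible κ₁ κ₂ ε₀) (hU : Uᵀ * U = 1) (hX : (1 - U * Uᵀ) * X = 0)
    (hreg : ∀ Y, (∃ (A : Matrix (Fin n) (Fin r) ℝ) (B : Matrix (Fin r) (Fin n) ℝ), Y = A * B) →
      fn (Y - X) ≤ ρ → IsRegularAt (sampleWeight ω Finset.univ) X Y (S.leftFactor hr Y)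
        (S.rightFactor hr Y) p (ε₀ / 10))
    {X₀ : Matrix (Fin n) (Fin n) ℝ} (hX₀ : ∃ (A : Matrix (Fin n) (Fin r) ℝ)
      (B : Matrix (Fin r) (Fin n) ℝ), X₀ = A * B) (hρ : fn (X₀ - X) ≤ ρ) :
    ConvergesLinearly (rcgIter S hr κ₁ κ₂ X ω X₀) X (rcgRate κ₁ κ₂ ε₀) := by
  obtain ⟨hg, hτ₁, hτ₂, hκ₁⟩ := hε.bounds h₁ h₂
  obtain ⟨hν0, hν1, hν2⟩ := rcgRate_spec hε h₁ h₂
  have hε0 := hε.1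
  have hε22 := hg.rate_lt
  have hb : 0 < 1 - 4 * ε₀ := by linarith
  set ν := rcgRate κ₁ κ₂ ε₀
  set E := fn (X₀ - X)
  have hE : 0 ≤ E := fn_nonneg _
  have h : ∀ l, (∃ (A : Matrix (Fin n) (Fin r) ℝ) (B : Matrix (Fin r) (Fin n) ℝ),
      (rcgState S hr κ₁ κ₂ X ω X₀ l).1 = A * B) ∧
      fn ((rcgState S hr κ₁ κ₂ X ω X₀ l).1 - X) ≤ ν ^ l * E ∧
      ν * fn (rcgState S hr κ₁ κ₂ X ω X₀ l).2 ≤ (1 + 6 * (ε₀ / 10)) * (p * (ν ^ l * E)) := by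
    intro l
    induction l with
    | zero =>
      refine ⟨hX₀, by simp [rcgState, E], ?_⟩
      simp only [rcgState, fn_zero, mul_zero, pow_zero, one_mul]
      positivity
    | succ l ih =>
      obtain ⟨hfac, hle, hdir⟩ := ih
      change (∃ (A : Matrix (Fin n) (Fin r) ℝ) (B : Matrix (Fin r) (Fin n) ℝ),
        (rcgStep S hr κ₁ κ₂ X ω (rcgState S hr κ₁ κ₂ X ω X₀ l)).1 = A * B) ∧
        fn ((rcgStep S hr κ₁ κ₂ X ω (rcgState S hr κ₁ κ₂ X ω X₀ l)).1 - X) ≤ _ ∧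
        ν * fn (rcgStep S hr κ₁ κ₂ X ω (rcgState S hr κ₁ κ₂ X ω X₀ l)).2 ≤ _
      generalize rcgState S hr κ₁ κ₂ X ω X₀ l = st at hfac hle hdir ⊢
      obtain ⟨Y, P'⟩ := st
      dsimp only at hfac hle hdir
      have hYρ : fn (Y - X) ≤ ρ := by
        refine hle.trans (le_trans ?_ hρ)
        exact mul_le_of_le_one_left hE (pow_le_one₀ hν0.le hν1.le)
      have hR := hreg Y hfac hYρ
      obtain ⟨β, D, g, q, hg, hq, hD, hconj, hβ, hst⟩ :=
        rcgStep_spec S hr (κ₁ := κ₁) (κ₂ := κ₂) hp h₁ h₂ (by positivity) (by linarith) hR P'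
      have hqT : tangentProj (S.leftFactor hr Y) (S.rightFactor hr Y) q = q := by
        rw [hq]; exact tangentProj_tangentProj hR.left_orth hR.right_orth _
      have hqle : fn q ≤ fn P' := by
        rw [hq]; exact fn_tangentProj_le hR.left_orth hR.right_orth _
      obtain ⟨hs1, hs2⟩ := hR.fn_step_le hp (by positivity) (by linarith) hqT hg hD hconj
      rw [hst]
      dsimp only
      refine ⟨S.hardThreshold_factor hr _, ?_, ?_⟩
      · refine (S.fn_hardThreshold_sub_le hr _ X hU hX).trans ?_
        have hνe : 0 ≤ ν ^ l * E := by positivity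
        set c := κ₂ * ((κ₁ + ε₀ / 10) / (1 - ε₀ / 10)) with hc
        have hc0 : 0 ≤ c := by
          have : 0 < 1 - ε₀ / 10 := by linarith
          positivity
        -- At η = ε₀/10 the constants are far better than those in τ₂: the slack between ε₀/10 and
        -- 4ε₀ pays for the factor 1 + 6η from the direction bound.
        have hcτ : 2 * (c * (1 + 6 * (ε₀ / 10))) ≤ rcgTau₂ κ₁ κ₂ ε₀ := by
          rw [hτ₂, hc, mul_assoc κ₂]
          gcongr
          have : 0 < 1 - ε₀ / 10 := by linarith
          rw [div_mul_eq_mul_div, div_le_div_iff₀ this hb, mul_assoc]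
          gcongr
          · linarith
          · nlinarith
        have hβq : ν * (p⁻¹ * (|β| * fn q)) ≤ c * (1 + 6 * (ε₀ / 10)) * (ν ^ l * E) := by
          have hβ' : |β| * fn q ≤ c * fn P' := hβ.trans (mul_le_mul_of_nonneg_left hqle hc0)
          calc ν * (p⁻¹ * (|β| * fn q)) ≤ ν * (p⁻¹ * (c * fn P')) := by gcongr
            _ = p⁻¹ * c * (ν * fn P') := by ring
            _ ≤ p⁻¹ * c * ((1 + 6 * (ε₀ / 10)) * (p * (ν ^ l * E))) := by gcongr
            _ = _ := by field_simp
        refine le_of_mul_le_mul_left ?_ hν0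
        calc _ ≤ ν * (2 * (5 * (ε₀ / 10) * (ν ^ l * E) + p⁻¹ * (|β| * fn q))) := by
              gcongr
              exact hs1.trans (by gcongr)
          _ = ε₀ * ν * (ν ^ l * E) + 2 * (ν * (p⁻¹ * (|β| * fn q))) := by ring
          _ ≤ rcgTau₁ κ₁ κ₂ ε₀ * ν * (ν ^ l * E) +
              2 * (c * (1 + 6 * (ε₀ / 10)) * (ν ^ l * E)) := by
              gcongr
              linarith
          _ = (rcgTau₁ κ₁ κ₂ ε₀ * ν + 2 * (c * (1 + 6 * (ε₀ / 10)))) * (ν ^ l * E) := by ring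
          _ ≤ ν ^ 2 * (ν ^ l * E) := by
              rw [hν2]
              gcongr
          _ = _ := by ring
      · calc ν * fn D ≤ ν * ((1 + 6 * (ε₀ / 10)) * (p * (ν ^ l * E))) := by
              gcongr
              exact hs2.trans (by gcongr)
          _ = _ := by ring
  refine convergesLinearly_of_le hν0.le hν1 fun l => (h l).2.1

end Iterations

section

open scoped Matrix.Norms.L2Operator

/-! ### Concentration for sums of sampled matrices -/

section Concentration

theorem uniformOn_univ_singleton {ι : Type*} [Fintype ι] [MeasurableSpace ι]
    [MeasurableSingletonClass ι] (i : ι) :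
    (uniformOn Set.univ : Measure ι) {i} = (Fintype.card ι : ENNReal)⁻¹ := by
  rw [uniformOn_univ]
  simp

/-- Each sequence has mass n^(−2m), so a failure probability is a normalized cardinality. It
suffices that the event contains all sequences outside B. -/
theorem sampleLaw_real_ge {n m : ℕ} (hn : 0 < n) (B : Finset (Fin m → Fin n × Fin n))
    {A : Set (Fin m → Fin n × Fin n)} (hA : ∀ ω, ω ∉ B → ω ∈ A) :
    1 - B.card / ((n : ℝ) ^ 2) ^ m ≤ (sampleLaw n m).real A := by
  have : Nonempty (Fin n) := ⟨⟨0, hn⟩⟩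
  have hprob : IsProbabilityMeasure (uniformOn Set.univ : Measure (Fin n × Fin n)) :=
    isProbabilityMeasure_uniformOn Set.finite_univ Set.univ_nonempty
  have hlaw : IsProbabilityMeasure (sampleLaw n m) := by
    unfold sampleLaw; infer_instance
  have hsing : ∀ ω : Fin m → Fin n × Fin n, (sampleLaw n m).real {ω} = (((n : ℝ) ^ 2) ^ m)⁻¹ := by
    intro ω
    rw [measureReal_def, sampleLaw, Measure.pi_singleton]
    simp only [uniformOn_univ_singleton, Finset.prod_const, Finset.card_univ, Fintype.card_fin,
      Fintype.card_prod]
    simp [sq, mul_inv_rev, ← inv_pow]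
  have hB : (sampleLaw n m).real (B : Set (Fin m → Fin n × Fin n)) =
      B.card / ((n : ℝ) ^ 2) ^ m := by
    rw [← sum_measureReal_singleton B]
    simp [hsing, div_eq_mul_inv]
  have hcompl := probReal_compl_eq_one_sub (μ := sampleLaw n m)
    (s := (B : Set (Fin m → Fin n × Fin n))) B.measurableSet
  rw [← hB, ← hcompl]
  exact measureReal_mono fun ω hω => hA ω (by simpa using hω)

variable {a b ι κ : Type*} [Fintype a] [Fintype b] [DecidableEq a] [DecidableEq b] [Fintype ι]
  [Fintype κ] [DecidableEq κ]

theorem sum_centered_sq_le {f : ι → a → ℝ} {c : a → ℝ} (h : ∑ i, f i = Fintype.card ι • c) :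
    ∑ i, (f i - c) ⬝ᵥ (f i - c) ≤ ∑ i, f i ⬝ᵥ f i := by
  have h1 : ∑ i, f i ⬝ᵥ c = Fintype.card ι * (c ⬝ᵥ c) := by
    rw [← sum_dotProduct, h, smul_dotProduct, nsmul_eq_mul]
  have h2 : ∀ i, (f i - c) ⬝ᵥ (f i - c) = f i ⬝ᵥ f i - 2 * (f i ⬝ᵥ c) + c ⬝ᵥ c := by
    intro i
    rw [sub_dotProduct, dotProduct_sub, dotProduct_sub, dotProduct_comm c]
    ring
  simp only [h2, Finset.sum_add_distrib, Finset.sum_sub_distrib, ← Finset.mul_sum, h1]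
  have hc : 0 ≤ c ⬝ᵥ c := Finset.sum_nonneg fun i _ => mul_self_nonneg _
  have hN : (0 : ℝ) ≤ Fintype.card ι := Nat.cast_nonneg _
  simp only [Finset.sum_const, Finset.card_univ, nsmul_eq_mul]
  nlinarith [mul_nonneg hN hc]

theorem norm_toLp_sq (x : a → ℝ) :
    ‖(WithLp.toLp 2 x : EuclideanSpace ℝ a)‖ ^ 2 = x ⬝ᵥ x := by
  rw [EuclideanSpace.norm_sq_eq]
  simp [dotProduct, sq]

theorem dotProduct_mulVec_self_le (A : Matrix a b ℝ) (x : b → ℝ) :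
    (A *ᵥ x) ⬝ᵥ (A *ᵥ x) ≤ ‖A‖ ^ 2 * (x ⬝ᵥ x) := by
  have h := Matrix.l2_opNorm_mulVec A (WithLp.toLp 2 x : EuclideanSpace ℝ b)
  have h2 := pow_le_pow_left₀ (norm_nonneg _) h 2
  rw [mul_pow, norm_toLp_sq x] at h2
  exact (norm_toLp_sq (A *ᵥ x)).symm.trans_le h2

theorem dotProduct_sq_le (x y : a → ℝ) : (x ⬝ᵥ y) ^ 2 ≤ (x ⬝ᵥ x) * (y ⬝ᵥ y) := by
  simpa [dotProduct, sq] using Finset.sum_mul_sq_le_sq_mul_sq Finset.univ x y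

theorem two_mul_dotProduct_mulVec_le (A : Matrix a b ℝ) {R : ℝ} (hR : ‖A‖ ≤ R) (x : a → ℝ)
    (y : b → ℝ) : 2 * (x ⬝ᵥ (A *ᵥ y)) ≤ R * (x ⬝ᵥ x + y ⬝ᵥ y) := by
  have hR0 : 0 ≤ R := (norm_nonneg _).trans hR
  have hx : 0 ≤ x ⬝ᵥ x := Finset.sum_nonneg fun i _ => mul_self_nonneg _
  have hy : 0 ≤ y ⬝ᵥ y := Finset.sum_nonneg fun i _ => mul_self_nonneg _
  refine (le_abs_self _).trans (abs_le_of_sq_le_sq ?_ (by positivity))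
  have h1 := dotProduct_sq_le x (A *ᵥ y)
  have h2 : (A *ᵥ y) ⬝ᵥ (A *ᵥ y) ≤ R ^ 2 * (y ⬝ᵥ y) :=
    (dotProduct_mulVec_self_le A y).trans (by gcongr)
  calc (2 * (x ⬝ᵥ (A *ᵥ y))) ^ 2 = 4 * (x ⬝ᵥ (A *ᵥ y)) ^ 2 := by ring
    _ ≤ 4 * ((x ⬝ᵥ x) * (R ^ 2 * (y ⬝ᵥ y))) := by
        gcongr
        exact h1.trans (by gcongr)
    _ = R ^ 2 * (4 * (x ⬝ᵥ x) * (y ⬝ᵥ y)) := by ring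
    _ ≤ R ^ 2 * (x ⬝ᵥ x + y ⬝ᵥ y) ^ 2 := by
        gcongr
        nlinarith [sq_nonneg (x ⬝ᵥ x - y ⬝ᵥ y)]
    _ = _ := by ring

/-- Rectangular matrix Bernstein inequality, by Hermitian dilation. -/
theorem card_norm_sum_gt_le [Nonempty ι] {Y : ι → Matrix a b ℝ} {C : Matrix a b ℝ}
    (hC : ∑ i, Y i = Fintype.card ι • C) {R v θ : ℝ} (hR : ∀ i, ‖Y i - C‖ ≤ R)
    (hv₁ : ∀ x, ∑ i, (Y i *ᵥ x) ⬝ᵥ (Y i *ᵥ x) ≤ Fintype.card ι * (v * (x ⬝ᵥ x)))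
    (hv₂ : ∀ x, ∑ i, ((Y i)ᵀ *ᵥ x) ⬝ᵥ ((Y i)ᵀ *ᵥ x) ≤ Fintype.card ι * (v * (x ⬝ᵥ x)))
    (hθ : 0 < θ) (hθR : θ * R ≤ 1) (s : Finset κ) {t : ℝ} (ht : 0 ≤ t) (B : Finset (κ → ι))
    (hB : ∀ ω ∈ B, t < ‖∑ k ∈ s, (Y (ω k) - C)‖) :
    (B.card : ℝ) ≤ (Fintype.card ι : ℝ) ^ Fintype.card κ *
        ((Fintype.card a + Fintype.card b) * Real.exp (-(θ * t) + θ ^ 2 * v * s.card)) := by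
  set M : ι → Matrix (a ⊕ b) (a ⊕ b) ℝ := fun i =>
    Matrix.fromBlocks 0 (Y i - C) (Y i - C)ᵀ 0 with hM
  have hmul : ∀ (D : Matrix a b ℝ) (z : a ⊕ b → ℝ), Matrix.fromBlocks 0 D Dᵀ 0 *ᵥ z =
      Sum.elim (D *ᵥ (z ∘ Sum.inr)) (Dᵀ *ᵥ (z ∘ Sum.inl)) := by
    intro D z
    rw [Matrix.fromBlocks_mulVec]
    simp
  have hdot : ∀ z z' : a ⊕ b → ℝ, z ⬝ᵥ z' =
      (z ∘ Sum.inl) ⬝ᵥ (z' ∘ Sum.inl) + (z ∘ Sum.inr) ⬝ᵥ (z' ∘ Sum.inr) := by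
    intro z z'
    simp [dotProduct]
  have hquad : ∀ (D : Matrix a b ℝ) (z : a ⊕ b → ℝ), z ⬝ᵥ (Matrix.fromBlocks 0 D Dᵀ 0 *ᵥ z) =
      2 * ((z ∘ Sum.inl) ⬝ᵥ (D *ᵥ (z ∘ Sum.inr))) := by
    intro D z
    rw [hmul, hdot, Sum.elim_comp_inl, Sum.elim_comp_inr, Matrix.mulVec_transpose,
      dotProduct_comm (z ∘ Sum.inr), ← Matrix.dotProduct_mulVec]
    ring
  have hsumM : ∀ s : Finset κ, ∀ ω : κ → ι, ∑ k ∈ s, M (ω k) =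
      Matrix.fromBlocks 0 (∑ k ∈ s, (Y (ω k) - C)) (∑ k ∈ s, (Y (ω k) - C))ᵀ 0 := by
    intro s ω
    ext i j
    rcases i with i | i <;> rcases j with j | j <;> simp [hM, Matrix.sum_apply]
  have hcard : (Fintype.card (a ⊕ b) : ℝ) = Fintype.card a + Fintype.card b := by
    rw [Fintype.card_sum]; push_cast; ring
  rw [← hcard]
  refine card_filter_lt_le (M := M) (fun i => ?_) ?_ (R := R) (v := v) (fun i z => ?_)
    (fun z => ?_) hθ hθR s t B fun ω hω => ?_
  · simp [hM, Matrix.fromBlocks_transpose]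
  · have h0 : ∑ i, (Y i - C) = 0 := by
      rw [Finset.sum_sub_distrib, hC]; simp
    ext i j
    have h1 : ∀ p q, ∑ k, (Y k p q - C p q) = 0 := fun p q => by
      have := congrFun (congrFun h0 p) q
      simpa [Matrix.sum_apply] using this
    rcases i with i | i <;> rcases j with j | j <;>
      simp only [hM, Matrix.sum_apply, Matrix.fromBlocks_apply₁₁, Matrix.fromBlocks_apply₁₂,
        Matrix.fromBlocks_apply₂₁, Matrix.fromBlocks_apply₂₂, Matrix.transpose_apply,
        Matrix.sub_apply, Matrix.zero_apply, Finset.sum_const_zero, h1]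
  · rw [hM, hquad, hdot]
    exact two_mul_dotProduct_mulVec_le _ (hR i) _ _
  · have hNv := hv₁ (z ∘ Sum.inr)
    have hNv' := hv₂ (z ∘ Sum.inl)
    have e : ∀ i, (M i *ᵥ z) ⬝ᵥ (M i *ᵥ z) =
        (((Y i)ᵀ *ᵥ (z ∘ Sum.inl)) - Cᵀ *ᵥ (z ∘ Sum.inl)) ⬝ᵥ
          (((Y i)ᵀ *ᵥ (z ∘ Sum.inl)) - Cᵀ *ᵥ (z ∘ Sum.inl)) +
        ((Y i *ᵥ (z ∘ Sum.inr)) - C *ᵥ (z ∘ Sum.inr)) ⬝ᵥ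
          ((Y i *ᵥ (z ∘ Sum.inr)) - C *ᵥ (z ∘ Sum.inr)) := by
      intro i
      rw [hM, hmul, hdot, Sum.elim_comp_inl, Sum.elim_comp_inr, Matrix.transpose_sub,
        Matrix.sub_mulVec, Matrix.sub_mulVec, add_comm]
    simp only [e, Finset.sum_add_distrib]
    have h1 := sum_centered_sq_le (f := fun i => Y i *ᵥ (z ∘ Sum.inr))
      (c := C *ᵥ (z ∘ Sum.inr)) (by
        rw [← Matrix.sum_mulVec, hC, ← Nat.cast_smul_eq_nsmul ℝ, ← Nat.cast_smul_eq_nsmul ℝ,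
          Matrix.smul_mulVec])
    have h2 := sum_centered_sq_le (f := fun i => (Y i)ᵀ *ᵥ (z ∘ Sum.inl))
      (c := Cᵀ *ᵥ (z ∘ Sum.inl)) (by
        rw [← Matrix.sum_mulVec, ← Matrix.transpose_sum, hC, ← Nat.cast_smul_eq_nsmul ℝ,
          ← Nat.cast_smul_eq_nsmul ℝ, Matrix.transpose_smul, Matrix.smul_mulVec])
    rw [hdot z z]
    nlinarith
  · set D := ∑ k ∈ s, (Y (ω k) - C) with hD
    obtain ⟨x, hx⟩ : ∃ x : EuclideanSpace ℝ b, t * ‖x‖ <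
        ‖(WithLp.toLp 2 (D *ᵥ x.ofLp) : EuclideanSpace ℝ a)‖ := by
      by_contra! h
      exact (hB ω hω).not_ge (norm_le_of_mulVec_le ht h)
    set y := D *ᵥ x.ofLp with hy
    set α := ‖x‖ with hα
    set γ := ‖(WithLp.toLp 2 y : EuclideanSpace ℝ a)‖ with hγ
    have hγ0 : 0 < γ := lt_of_le_of_lt (by positivity) hx
    have hα0 : 0 < α := by
      rw [hα, norm_pos_iff]
      rintro rfl
      simp [hγ, hy] at hγ0
    have hxx : x.ofLp ⬝ᵥ x.ofLp = α ^ 2 := (norm_toLp_sq x.ofLp).symm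
    have hyy : y ⬝ᵥ y = γ ^ 2 := (norm_toLp_sq y).symm
    -- The two blocks are scaled to the same norm αγ; the quadratic form of the dilation is then
    -- 2αγ³ against a squared norm 2α²γ², and tα < γ is the assumption on x.
    refine ⟨Sum.elim (α • y) (γ • x.ofLp), ?_⟩
    rw [hsumM, ← hD, hquad, hdot, Sum.elim_comp_inl, Sum.elim_comp_inr, Matrix.mulVec_smul, ← hy]
    simp only [smul_dotProduct, dotProduct_smul, smul_eq_mul, hxx, hyy]
    have : 0 < α * γ ^ 2 := by positivity
    nlinarith [mul_lt_mul_of_pos_left hx this]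

/-- Bernstein inequality for sums of rank one matrices `y yᵀ`. -/
theorem card_sum_sq_gt_le [Nonempty ι] {d : Type*} [Fintype d] [DecidableEq d] {y : ι → d → ℝ}
    {K η : ℝ} (hK : ∀ i, y i ⬝ᵥ y i ≤ K) (hG : ∀ x, ∑ i, (y i ⬝ᵥ x) ^ 2 ≤ x ⬝ᵥ x)
    (hNK : 1 ≤ Fintype.card ι * K) (hη : 0 < η) (hη1 : η ≤ 1) (s : Finset κ)
    (B : Finset (κ → ι))
    (hB : ∀ ω ∈ B, ∃ x, η * s.card * (x ⬝ᵥ x) <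
      |∑ k ∈ s, (Fintype.card ι * (y (ω k) ⬝ᵥ x) ^ 2 - ∑ i, (y i ⬝ᵥ x) ^ 2)|) :
    (B.card : ℝ) ≤ (Fintype.card ι : ℝ) ^ Fintype.card κ *
        (2 * (Fintype.card d * Real.exp (-(η ^ 2 * s.card / (4 * (Fintype.card ι * K)))))) := by
  set N : ℝ := (Fintype.card ι : ℝ) with hN
  have hNpos : 0 < N := by rw [hN]; exact_mod_cast Fintype.card_pos
  have hNK0 : 0 < N * K := by linarith
  set Γ : Matrix d d ℝ := ∑ i, Matrix.vecMulVec (y i) (y i) with hΓ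
  have hvm : ∀ (u x : d → ℝ), Matrix.vecMulVec u u *ᵥ x = (u ⬝ᵥ x) • u := by
    intro u x
    rw [Matrix.vecMulVec_mulVec]
    simp
  have hΓq : ∀ x, x ⬝ᵥ (Γ *ᵥ x) = ∑ i, (y i ⬝ᵥ x) ^ 2 := by
    intro x
    rw [hΓ, Matrix.sum_mulVec, dotProduct_sum]
    refine Finset.sum_congr rfl fun i _ => ?_
    rw [hvm, dotProduct_smul, smul_eq_mul, dotProduct_comm x, sq]
  have hΓs : Γᵀ = Γ := by
    rw [hΓ, Matrix.transpose_sum]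
    simp [Matrix.transpose_vecMulVec]
  set M : ι → Matrix d d ℝ := fun i => N • Matrix.vecMulVec (y i) (y i) - Γ with hM
  have hMs : ∀ i, (M i)ᵀ = M i := fun i => by
    simp [hM, hΓs, Matrix.transpose_vecMulVec]
  have hMsum : ∑ i, M i = 0 := by
    rw [hM, Finset.sum_sub_distrib, ← Finset.smul_sum, ← hΓ, Finset.sum_const, Finset.card_univ,
      ← Nat.cast_smul_eq_nsmul ℝ, sub_self]
  have hMq : ∀ i x, x ⬝ᵥ (M i *ᵥ x) = N * (y i ⬝ᵥ x) ^ 2 - ∑ i, (y i ⬝ᵥ x) ^ 2 := by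
    intro i x
    rw [hM, Matrix.sub_mulVec, dotProduct_sub, hΓq, Matrix.smul_mulVec, hvm, dotProduct_smul,
      dotProduct_smul, dotProduct_comm x]
    simp only [smul_eq_mul]
    ring
  have hxx : ∀ x : d → ℝ, 0 ≤ x ⬝ᵥ x := fun x => Finset.sum_nonneg fun i _ => mul_self_nonneg _
  have hup : ∀ i x, x ⬝ᵥ (M i *ᵥ x) ≤ N * K * (x ⬝ᵥ x) := by
    intro i x
    rw [hMq]
    have h1 := dotProduct_sq_le (y i) x
    have h2 : (y i ⬝ᵥ x) ^ 2 ≤ K * (x ⬝ᵥ x) :=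
      h1.trans (mul_le_mul_of_nonneg_right (hK i) (hxx x))
    have h3 : 0 ≤ ∑ i, (y i ⬝ᵥ x) ^ 2 := Finset.sum_nonneg fun i _ => sq_nonneg _
    nlinarith
  -- The lower tail is bounded by the mean Γ ≤ 1, and 1 ≤ NK lets both tails share the same
  -- constant.
  have hdown : ∀ i x, x ⬝ᵥ ((-M i) *ᵥ x) ≤ N * K * (x ⬝ᵥ x) := by
    intro i x
    rw [Matrix.neg_mulVec, dotProduct_neg, hMq]
    have h1 := hG x
    have h2 := mul_nonneg hNpos.le (sq_nonneg (y i ⬝ᵥ x))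
    nlinarith [hxx x]
  have hvar : ∀ x, ∑ i, (M i *ᵥ x) ⬝ᵥ (M i *ᵥ x) ≤ N * (N * K * (x ⬝ᵥ x)) := by
    intro x
    have h1 := sum_centered_sq_le (f := fun i => N • ((y i ⬝ᵥ x) • y i)) (c := Γ *ᵥ x) (by
      rw [← Finset.smul_sum, hΓ, Matrix.sum_mulVec, ← Nat.cast_smul_eq_nsmul ℝ]
      simp [hvm, hN])
    have e : ∀ i, M i *ᵥ x = N • ((y i ⬝ᵥ x) • y i) - Γ *ᵥ x := fun i => by
      rw [hM, Matrix.sub_mulVec, Matrix.smul_mulVec, hvm]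
    simp only [e]
    refine h1.trans ?_
    calc _ ≤ ∑ i, N * (N * K * (y i ⬝ᵥ x) ^ 2) := by
          refine Finset.sum_le_sum fun i _ => ?_
          simp only [smul_dotProduct, dotProduct_smul, smul_eq_mul]
          have h2 := mul_le_mul_of_nonneg_left (hK i)
            (mul_nonneg (sq_nonneg N) (sq_nonneg (y i ⬝ᵥ x)))
          linarith
      _ = N * (N * K * ∑ i, (y i ⬝ᵥ x) ^ 2) := by
          rw [← Finset.mul_sum, ← Finset.mul_sum]
      _ ≤ _ := by
          gcongr
          exact hG x
  -- The minimizer of −θη + θ²NK; η ≤ 1 makes it an admissible Laplace parameter.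
  set θ := η / (2 * (N * K)) with hθ
  have hθ0 : 0 < θ := by positivity
  have hθR : θ * (N * K) ≤ 1 := by
    rw [hθ]
    have : η / (2 * (N * K)) * (N * K) = η / 2 := by
      have := hNK0.ne'
      generalize N * K = a at this
      field_simp
    linarith
  have hexp : -(θ * (η * s.card)) + θ ^ 2 * (N * K) * s.card =
      -(η ^ 2 * s.card / (4 * (N * K))) := by
    rw [hθ]
    have := hNK0.ne'
    generalize N * K = a at this
    field_simp
    ring
  classical
  set B₁ := B.filter fun ω => ∃ x, η * s.card * (x ⬝ᵥ x) < x ⬝ᵥ ((∑ k ∈ s, M (ω k)) *ᵥ x)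
  set B₂ := B.filter fun ω => ∃ x, η * s.card * (x ⬝ᵥ x) < x ⬝ᵥ ((∑ k ∈ s, -M (ω k)) *ᵥ x)
  have h1 := card_filter_lt_le hMs hMsum hup hvar hθ0 hθR s (η * s.card) B₁
    fun ω hω => (Finset.mem_filter.1 hω).2
  have h2 := card_filter_lt_le (M := fun i => -M i) (fun i => by rw [Matrix.transpose_neg, hMs])
    (by rw [Finset.sum_neg_distrib, hMsum, neg_zero]) hdown
    (fun x => by simpa [Matrix.neg_mulVec] using hvar x) hθ0 hθR s (η * s.card) B₂
    fun ω hω => (Finset.mem_filter.1 hω).2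
  rw [hexp] at h1 h2
  have hsub : B ⊆ B₁ ∪ B₂ := by
    intro ω hω
    obtain ⟨x, hx⟩ := hB ω hω
    have e : ∑ k ∈ s, (N * (y (ω k) ⬝ᵥ x) ^ 2 - ∑ i, (y i ⬝ᵥ x) ^ 2) =
        x ⬝ᵥ ((∑ k ∈ s, M (ω k)) *ᵥ x) := by
      rw [Matrix.sum_mulVec, dotProduct_sum]
      exact Finset.sum_congr rfl fun k _ => (hMq _ _).symm
    rw [e] at hx
    rcases lt_abs.1 hx with h | h
    · exact Finset.mem_union_left _ (Finset.mem_filter.2 ⟨hω, x, h⟩)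
    · refine Finset.mem_union_right _ (Finset.mem_filter.2 ⟨hω, x, ?_⟩)
      rwa [Finset.sum_neg_distrib, Matrix.neg_mulVec, dotProduct_neg]
  have hc : (B.card : ℝ) ≤ B₁.card + B₂.card := by
    exact_mod_cast (Finset.card_le_card hsub).trans (Finset.card_union_le _ _)
  linarith

end Concentration

end

section

open scoped Matrix.Norms.L2Operator

/-! ### Concentration of the sampling operator -/

section Sampling

variable {n r m : ℕ}

theorem hadamard_single_one (i j : Fin n) (Z : Matrix (Fin n) (Fin n) ℝ) :
    Matrix.hadamard (Matrix.single i j (1 : ℝ)) Z = Z i j • Matrix.single i j (1 : ℝ) := by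
  ext a b
  simp only [Matrix.hadamard_apply, Matrix.single_apply, Matrix.smul_apply, smul_eq_mul]
  split_ifs with h
  · rw [h.1, h.2]; ring
  · ring

theorem samplingOp_eq_sum (ω : Fin m → Fin n × Fin n) (s : Finset (Fin m))
    (Z : Matrix (Fin n) (Fin n) ℝ) : samplingOp ω s Z =
      ∑ k ∈ s, Z (ω k).1 (ω k).2 • Matrix.single (ω k).1 (ω k).2 (1 : ℝ) := by
  simp only [← hadamard_single_one]
  ext i j
  simp [samplingOp, Matrix.hadamard_apply, Matrix.sum_apply, Finset.sum_mul]

theorem sampleWeight_nonneg (ω : Fin m → Fin n × Fin n) (s : Finset (Fin m)) (i j : Fin n) :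
    0 ≤ sampleWeight ω s i j := by
  rw [sampleWeight, Matrix.sum_apply]
  refine Finset.sum_nonneg fun k _ => ?_
  rw [Matrix.single_apply]
  split_ifs <;> norm_num

theorem sampleWeight_le (ω : Fin m → Fin n × Fin n) (s : Finset (Fin m)) (i j : Fin n) :
    sampleWeight ω s i j ≤ s.card := by
  rw [sampleWeight, Matrix.sum_apply, ← nsmul_one, ← Finset.sum_const]
  refine Finset.sum_le_sum fun k _ => ?_
  rw [Matrix.single_apply]
  split_ifs <;> norm_num

theorem fi_single (i j : Fin n) (Z : Matrix (Fin n) (Fin n) ℝ) :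
    fi (Matrix.single i j 1) Z = Z i j := by
  rw [fi, Finset.sum_eq_single i (fun a _ ha => Finset.sum_eq_zero fun b _ => by
    rw [Matrix.single_apply_of_row_ne ha.symm, zero_mul]) (by simp),
    Finset.sum_eq_single j (fun b _ hb => by
      rw [Matrix.single_apply_of_col_ne _ _ hb.symm, zero_mul]) (by simp)]
  simp

theorem sum_single_eq (Z : Matrix (Fin n) (Fin n) ℝ) :
    ∑ p : Fin n × Fin n, Z p.1 p.2 • Matrix.single p.1 p.2 (1 : ℝ) = Z := by
  conv_rhs => rw [Matrix.matrix_eq_sum_single Z]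
  rw [Fintype.sum_prod_type]
  simp

theorem fi_samplingOp_self (ω : Fin m → Fin n × Fin n) (s : Finset (Fin m))
    (A : Matrix (Fin n) (Fin n) ℝ) :
    fi A (Matrix.hadamard (sampleWeight ω s) A) = ∑ k ∈ s, A (ω k).1 (ω k).2 ^ 2 := by
  rw [← samplingOp_eq, samplingOp_eq_sum, fi_comm]
  have : ∀ t : Finset (Fin m), fi (∑ k ∈ t, A (ω k).1 (ω k).2 •
      Matrix.single (ω k).1 (ω k).2 (1 : ℝ)) A = ∑ k ∈ t, A (ω k).1 (ω k).2 ^ 2 := by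
    intro t
    induction t using Finset.induction_on with
    | empty => simp [fi]
    | insert a t ha ih =>
      rw [Finset.sum_insert ha, Finset.sum_insert ha, fi_add_left, ih, fi_smul_left, fi_single, sq]
  exact this s

/-- UUᵀ is symmetric and idempotent, so ‖UUᵀe_i‖² is its i-th diagonal entry, the squared norm of
the i-th row of U. -/
theorem IsIncoherent.row_sq_le {U V : Matrix (Fin n) (Fin r) ℝ} {μ₀ : ℝ}
    (h : IsIncoherent U V μ₀) (hμ : 0 < μ₀) (hU : Uᵀ * U = 1) (hV : Vᵀ * V = 1) :
    (∀ i, ∑ k, U i k ^ 2 ≤ μ₀ * r / n) ∧ ∀ j, ∑ k, V j k ^ 2 ≤ μ₀ * r / n := by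
  have key : ∀ {W : Matrix (Fin n) (Fin r) ℝ}, Wᵀ * W = 1 → ∀ i,
      vecNorm ((W * Wᵀ) *ᵥ Pi.single i 1) ≤ Real.sqrt (μ₀ * r / n) →
      ∑ k, W i k ^ 2 ≤ μ₀ * r / n := by
    intro W hW i hi
    have h1 : vecNorm ((W * Wᵀ) *ᵥ Pi.single i 1) = Real.sqrt (∑ k, W i k ^ 2) := by
      rw [vecNorm]
      congr 1
      have h2 : (W * Wᵀ) * (W * Wᵀ)ᵀ = W * Wᵀ := by
        rw [Matrix.transpose_mul, Matrix.transpose_transpose, Matrix.mul_assoc,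
          ← Matrix.mul_assoc Wᵀ, hW, Matrix.one_mul]
      have h3 := congrFun (congrFun h2 i) i
      rw [Matrix.mul_apply, Matrix.mul_apply] at h3
      simp only [Matrix.transpose_apply, ← sq] at h3
      rw [← h3]
      refine Finset.sum_congr rfl fun j _ => ?_
      have h4 : (W * Wᵀ) j i = (W * Wᵀ) i j := by
        rw [Matrix.mul_apply, Matrix.mul_apply]
        exact Finset.sum_congr rfl fun k _ => by simp [mul_comm]
      simp [h4]
    rw [h1] at hi
    exact (Real.sqrt_le_sqrt_iff (by positivity)).1 hi
  exact ⟨fun i => key hU i (h.1 i), fun j => key hV j (h.2 j)⟩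

/-- The squared rows sum to r, so their average is r/n and no smaller uniform bound is possible. -/
theorem one_le_of_row_sq_le {U : Matrix (Fin n) (Fin r) ℝ} {μ₀ : ℝ} (hr : 1 ≤ r) (hn : 0 < n)
    (hU : Uᵀ * U = 1) (h : ∀ i, ∑ k, U i k ^ 2 ≤ μ₀ * r / n) : 1 ≤ μ₀ := by
  have h1 : fn U ^ 2 = r := by
    rw [← Matrix.mul_one U, fn_mul_of_orth hU, fn_sq]
    simp [Matrix.one_apply]
  rw [fn_sq] at h1
  have h2 := Finset.sum_le_sum fun i (_ : i ∈ Finset.univ) => h i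
  have hn' : (0 : ℝ) < n := by exact_mod_cast hn
  have hr' : (0 : ℝ) < r := by exact_mod_cast hr
  rw [h1] at h2
  simp only [Finset.sum_const, Finset.card_univ, Fintype.card_fin, nsmul_eq_mul] at h2
  rw [mul_div_cancel₀ _ hn'.ne'] at h2
  nlinarith

/-- P_T is an orthogonal projection, so this is the (i, j) entry of P_T(e_i e_jᵀ), which equals a +
b − ab for the diagonal entries a of UUᵀ and b of VVᵀ. -/
theorem fn_tangentProj_single_sq_le {U V : Matrix (Fin n) (Fin r) ℝ} (hU : Uᵀ * U = 1)
    (hV : Vᵀ * V = 1) {c : ℝ} (hUc : ∀ i, ∑ k, U i k ^ 2 ≤ c) (hVc : ∀ j, ∑ k, V j k ^ 2 ≤ c)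
    (i j : Fin n) : fn (tangentProj U V (Matrix.single i j 1)) ^ 2 ≤ 2 * c := by
  have h1 : fn (tangentProj U V (Matrix.single i j 1)) ^ 2 =
      (U * Uᵀ) i i + (V * Vᵀ) j j - (U * Uᵀ) i i * (V * Vᵀ) j j := by
    rw [← fi_self, fi_tangentProj, tangentProj_tangentProj hU hV, fi_single, tangentProj]
    simp only [Matrix.sub_apply, Matrix.add_apply]
    congr 1
    · congr 1
      · simp
      · simp
    · rw [Matrix.mul_assoc (U * Uᵀ), Matrix.mul_apply, Finset.sum_eq_single i
        (fun a _ ha => by rw [Matrix.single_mul_apply_of_ne _ _ _ _ _ ha, mul_zero]) (by simp)]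
      simp
  have h2 : (U * Uᵀ) i i = ∑ k, U i k ^ 2 := by
    rw [Matrix.mul_apply]; exact Finset.sum_congr rfl fun k _ => by simp [sq]
  have h3 : (V * Vᵀ) j j = ∑ k, V j k ^ 2 := by
    rw [Matrix.mul_apply]; exact Finset.sum_congr rfl fun k _ => by simp [sq]
  have h4 : 0 ≤ ∑ k, U i k ^ 2 := Finset.sum_nonneg fun _ _ => sq_nonneg _
  have h5 : 0 ≤ ∑ k, V j k ^ 2 := Finset.sum_nonneg fun _ _ => sq_nonneg _
  rw [h1, h2, h3]
  nlinarith [hUc i, hVc j, mul_nonneg h4 h5]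

/-- The sampling operator is a near isometry on the tangent space, except on few samples. -/
theorem card_not_rip_le {U V : Matrix (Fin n) (Fin r) ℝ} (hU : Uᵀ * U = 1) (hV : Vᵀ * V = 1)
    (hn : 0 < n) (hr : 1 ≤ r) {μ₀ η : ℝ} (hUc : ∀ i, ∑ k, U i k ^ 2 ≤ μ₀ * r / n)
    (hVc : ∀ j, ∑ k, V j k ^ 2 ≤ μ₀ * r / n) (hη : 0 < η) (hη1 : η ≤ 1)
    (B : Finset (Fin m → Fin n × Fin n))
    (hB : ∀ ω ∈ B, ∃ A, tangentProj U V A = A ∧ η * (m / (n : ℝ) ^ 2) * fn A ^ 2 <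
      |fi A (Matrix.hadamard (sampleWeight ω Finset.univ) A) - m / (n : ℝ) ^ 2 * fn A ^ 2|) :
    (B.card : ℝ) ≤ ((n : ℝ) ^ 2) ^ m *
      (2 * (n ^ 2 * Real.exp (-(η ^ 2 * m / (8 * (μ₀ * r * n)))))) := by
  have : Nonempty (Fin n) := ⟨⟨0, hn⟩⟩
  have hn' : (1 : ℝ) ≤ n := by exact_mod_cast hn
  have hn0 : (0 : ℝ) < n := by linarith
  have hr' : (1 : ℝ) ≤ r := by exact_mod_cast hr
  have hμ := one_le_of_row_sq_le hr hn hU hUc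
  have hcard : (Fintype.card (Fin n × Fin n) : ℝ) = (n : ℝ) ^ 2 := by simp [sq]
  -- For A in T the sampled entry is ⟨P_T(e_i e_jᵀ), A⟩, so the isometry defect is a sum of rank one
  -- forms. Here N = n² and K = 2μ₀r/n, hence NK = 2μ₀rn in the exponent.
  set y : Fin n × Fin n → Fin n × Fin n → ℝ := fun p q =>
    tangentProj U V (Matrix.single p.1 p.2 1) q.1 q.2 with hy
  have hdot : ∀ p (Z : Matrix (Fin n) (Fin n) ℝ), y p ⬝ᵥ (fun q => Z q.1 q.2) =
      tangentProj U V Z p.1 p.2 := by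
    intro p Z
    rw [← fi_single p.1 p.2 (tangentProj U V Z), ← fi_tangentProj, dotProduct,
      Fintype.sum_prod_type]
    rfl
  have hx : ∀ x : Fin n × Fin n → ℝ, ∃ Z : Matrix (Fin n) (Fin n) ℝ, x = fun q => Z q.1 q.2 :=
    fun x => ⟨Matrix.of fun i j => x (i, j), rfl⟩
  have hself : ∀ Z : Matrix (Fin n) (Fin n) ℝ,
      (fun q : Fin n × Fin n => Z q.1 q.2) ⬝ᵥ (fun q => Z q.1 q.2) = fn Z ^ 2 := by
    intro Z
    rw [fn_sq, dotProduct, Fintype.sum_prod_type]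
    simp [sq]
  have hG : ∀ Z : Matrix (Fin n) (Fin n) ℝ,
      ∑ p, (y p ⬝ᵥ (fun q => Z q.1 q.2)) ^ 2 = fn (tangentProj U V Z) ^ 2 := by
    intro Z
    simp only [hdot]
    rw [fn_sq, Fintype.sum_prod_type]
  have h := card_sum_sq_gt_le (y := y) (K := 2 * (μ₀ * r / n)) (η := η)
    (fun p => by
      rw [hself]
      exact fn_tangentProj_single_sq_le hU hV hUc hVc _ _)
    (fun x => by
      obtain ⟨Z, rfl⟩ := hx x
      rw [hG, hself]
      exact pow_le_pow_left₀ (fn_nonneg _) (fn_tangentProj_le hU hV Z) 2)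
    (by
      rw [hcard]
      have : (n : ℝ) ^ 2 * (2 * (μ₀ * r / n)) = 2 * (μ₀ * (r * n)) := by field_simp
      rw [this]
      have h1 : (1 : ℝ) ≤ r * n := one_le_mul_of_one_le_of_one_le hr' hn'
      nlinarith)
    hη hη1 Finset.univ B (fun ω hω => by
      obtain ⟨A, hA, hlt⟩ := hB ω hω
      refine ⟨fun q => A q.1 q.2, ?_⟩
      have e : ∑ k, ((Fintype.card (Fin n × Fin n) : ℝ) *
          (y (ω k) ⬝ᵥ fun q => A q.1 q.2) ^ 2 - ∑ i, (y i ⬝ᵥ fun q => A q.1 q.2) ^ 2) =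
          (n : ℝ) ^ 2 * (fi A (Matrix.hadamard (sampleWeight ω Finset.univ) A) -
            m / (n : ℝ) ^ 2 * fn A ^ 2) := by
        rw [fi_samplingOp_self, hG, hcard, hA, Finset.sum_sub_distrib, ← Finset.mul_sum]
        simp only [hdot, hA]
        simp only [Finset.sum_const, Finset.card_univ, Fintype.card_fin, nsmul_eq_mul]
        field_simp
      rw [e, hself, abs_mul, abs_of_pos (by positivity : (0 : ℝ) < (n : ℝ) ^ 2)]
      have h2 := mul_lt_mul_of_pos_left hlt (by positivity : (0 : ℝ) < (n : ℝ) ^ 2)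
      refine lt_of_eq_of_lt ?_ h2
      simp only [Finset.card_univ, Fintype.card_fin]
      field_simp)
  rw [hcard] at h
  refine h.trans_eq ?_
  simp only [Finset.card_univ, Fintype.card_fin]
  congr 5
  field_simp
  ring

/-- Spectral norm error of the rescaled sampled matrix. -/
theorem card_norm_sampling_sub_gt_le (hn : 0 < n) {X : Matrix (Fin n) (Fin n) ℝ} {τ : ℝ}
    (hτ : 0 < τ) (hX : ∀ i j, |X i j| ≤ τ / n) (s : Finset (Fin m)) (hs : 0 < s.card) {t : ℝ}
    (ht : 0 < t) (htτ : t ≤ τ) (B : Finset (Fin m → Fin n × Fin n))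
    (hB : ∀ ω ∈ B, t < ‖((n : ℝ) ^ 2 / s.card) • samplingOp ω s X - X‖) :
    (B.card : ℝ) ≤ ((n : ℝ) ^ 2) ^ m *
      (2 * (n * Real.exp (-(t ^ 2 * s.card / (4 * (n * τ ^ 2)))))) := by
  have : Nonempty (Fin n) := ⟨⟨0, hn⟩⟩
  have hn' : (1 : ℝ) ≤ n := by exact_mod_cast hn
  have hn0 : (0 : ℝ) < n := by linarith
  have hs0 : (0 : ℝ) < s.card := by exact_mod_cast hs
  have hcard : (Fintype.card (Fin n × Fin n) : ℝ) = (n : ℝ) ^ 2 := by simp [sq]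
  have hXsq : ∀ i j, X i j ^ 2 ≤ (τ / n) ^ 2 := fun i j => by
    rw [← sq_abs]; exact pow_le_pow_left₀ (abs_nonneg _) (hX i j) 2
  have hfn : fn X ≤ τ := by
    rw [fn]
    refine Real.sqrt_le_iff.2 ⟨hτ.le, ?_⟩
    calc _ ≤ ∑ _i : Fin n, ∑ _j : Fin n, (τ / n) ^ 2 :=
          Finset.sum_le_sum fun i _ => Finset.sum_le_sum fun j _ => hXsq i j
      _ = τ ^ 2 := by simp; field_simp
  have hXn : ‖X‖ ≤ τ := (norm_le_fn X).trans hfn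
  set Y : Fin n × Fin n → Matrix (Fin n) (Fin n) ℝ := fun p =>
    (n : ℝ) ^ 2 • (X p.1 p.2 • Matrix.single p.1 p.2 (1 : ℝ)) with hY
  have hsingle : ∀ p : Fin n × Fin n, fn (Matrix.single p.1 p.2 (1 : ℝ)) = 1 := by
    intro p
    have h := fi_self (Matrix.single p.1 p.2 (1 : ℝ))
    rw [fi_single] at h
    have h0 := fn_nonneg (Matrix.single p.1 p.2 (1 : ℝ))
    simp only [Matrix.single_apply_same] at h
    nlinarith
  have hxx : ∀ x : Fin n → ℝ, 0 ≤ x ⬝ᵥ x := fun x =>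
    Finset.sum_nonneg fun i _ => mul_self_nonneg _
  have hvar : ∀ (f : Fin n → ℝ) , ∑ p : Fin n × Fin n, ((n : ℝ) ^ 2 * (X p.1 p.2 * f p.2)) ^ 2 ≤
      (n : ℝ) ^ 2 * (n * τ ^ 2 * (f ⬝ᵥ f)) := by
    intro f
    calc _ ≤ ∑ p : Fin n × Fin n, (n : ℝ) ^ 2 * (τ ^ 2 * (f p.2 * f p.2)) := by
          refine Finset.sum_le_sum fun p _ => ?_
          have h1 := mul_le_mul_of_nonneg_right (hXsq p.1 p.2)
            (mul_nonneg (by positivity : (0 : ℝ) ≤ (n : ℝ) ^ 4) (sq_nonneg (f p.2)))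
          have h2 : (τ / n) ^ 2 * ((n : ℝ) ^ 4 * f p.2 ^ 2) =
              (n : ℝ) ^ 2 * (τ ^ 2 * (f p.2 * f p.2)) := by field_simp
          rw [h2] at h1
          refine le_trans (le_of_eq ?_) h1
          ring
      _ = _ := by
          rw [Fintype.sum_prod_type]
          simp only [← Finset.mul_sum, dotProduct, Finset.sum_const, Finset.card_univ,
            Fintype.card_fin, nsmul_eq_mul]
          ring
  have hvar' : ∀ (f : Fin n → ℝ) , ∑ p : Fin n × Fin n, ((n : ℝ) ^ 2 * (X p.1 p.2 * f p.1)) ^ 2 ≤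
      (n : ℝ) ^ 2 * (n * τ ^ 2 * (f ⬝ᵥ f)) := by
    intro f
    calc _ ≤ ∑ p : Fin n × Fin n, (n : ℝ) ^ 2 * (τ ^ 2 * (f p.1 * f p.1)) := by
          refine Finset.sum_le_sum fun p _ => ?_
          have h1 := mul_le_mul_of_nonneg_right (hXsq p.1 p.2)
            (mul_nonneg (by positivity : (0 : ℝ) ≤ (n : ℝ) ^ 4) (sq_nonneg (f p.1)))
          have h2 : (τ / n) ^ 2 * ((n : ℝ) ^ 4 * f p.1 ^ 2) =
              (n : ℝ) ^ 2 * (τ ^ 2 * (f p.1 * f p.1)) := by field_simp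
          rw [h2] at h1
          refine le_trans (le_of_eq ?_) h1
          ring
      _ = _ := by
          rw [Fintype.sum_prod_type]
          simp only [dotProduct, Finset.sum_const, Finset.card_univ, Fintype.card_fin,
            nsmul_eq_mul, ← Finset.mul_sum]
          ring
  have hmv : ∀ (p : Fin n × Fin n) (x : Fin n → ℝ), Y p *ᵥ x =
      Pi.single p.1 ((n : ℝ) ^ 2 * (X p.1 p.2 * x p.2)) := by
    intro p x
    rw [hY, Matrix.smul_mulVec, Matrix.smul_mulVec, Matrix.single_mulVec]
    ext i
    by_cases h : i = p.1
    · subst h; simp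
    · simp [h]
  have hmvt : ∀ (p : Fin n × Fin n) (x : Fin n → ℝ), (Y p)ᵀ *ᵥ x =
      Pi.single p.2 ((n : ℝ) ^ 2 * (X p.1 p.2 * x p.1)) := by
    intro p x
    rw [hY, Matrix.transpose_smul, Matrix.transpose_smul, Matrix.transpose_single,
      Matrix.smul_mulVec, Matrix.smul_mulVec, Matrix.single_mulVec]
    ext i
    by_cases h : i = p.2
    · subst h; simp
    · simp [h]
  -- The minimizer for variance nτ². With R = 2nτ one gets θR = t/τ, which is why t ≤ τ is required.
  set θ := t / (2 * (n * τ ^ 2)) with hθ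
  have hθ0 : 0 < θ := by positivity
  have h := card_norm_sum_gt_le (Y := Y) (C := X) (R := 2 * (n * τ)) (v := n * τ ^ 2)
    (t := t * s.card) (θ := θ)
    (by
      rw [hY, ← Finset.smul_sum, sum_single_eq, ← Nat.cast_smul_eq_nsmul ℝ, hcard])
    (fun p => by
      refine (norm_sub_le _ _).trans ?_
      have h1 : ‖Y p‖ ≤ n * τ := by
        refine (norm_le_fn _).trans ?_
        rw [hY, fn_smul, fn_smul, hsingle, mul_one, abs_of_pos (by positivity)]
        calc _ ≤ (n : ℝ) ^ 2 * (τ / n) := by gcongr; exact hX _ _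
          _ = _ := by field_simp
      have h2 : τ ≤ n * τ := le_mul_of_one_le_left hτ.le hn'
      linarith)
    (fun x => by
      rw [hcard]
      refine le_trans (le_of_eq ?_) (hvar x)
      refine Finset.sum_congr rfl fun p _ => ?_
      rw [hmv, single_dotProduct, Pi.single_eq_same]; ring)
    (fun x => by
      rw [hcard]
      refine le_trans (le_of_eq ?_) (hvar' x)
      refine Finset.sum_congr rfl fun p _ => ?_
      rw [hmvt, single_dotProduct, Pi.single_eq_same]; ring)
    hθ0
    (by
      rw [hθ, div_mul_eq_mul_div, div_le_one (by positivity)]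
      have h1 : n * τ * t ≤ n * τ * τ := by gcongr
      nlinarith)
    s (by positivity) B (fun ω hω => by
      have h1 := mul_lt_mul_of_pos_left (hB ω hω) hs0
      have e : ∑ k ∈ s, (Y (ω k) - X) =
          (s.card : ℝ) • (((n : ℝ) ^ 2 / s.card) • samplingOp ω s X - X) := by
        rw [Finset.sum_sub_distrib, Finset.sum_const, hY, ← Finset.smul_sum, ← samplingOp_eq_sum,
          smul_sub, smul_smul, mul_div_cancel₀ _ hs0.ne', Nat.cast_smul_eq_nsmul]
      rw [e, norm_smul, Real.norm_of_nonneg hs0.le, mul_comm t]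
      exact h1)
  rw [hcard] at h
  refine h.trans_eq ?_
  simp only [Fintype.card_fin]
  have hexp : -(θ * (t * s.card)) + θ ^ 2 * (n * τ ^ 2) * s.card =
      -(t ^ 2 * s.card / (4 * (n * τ ^ 2))) := by
    rw [hθ]; field_simp; ring
  rw [hexp]
  ring

/-- Concentration of the projected sampling operator at a fixed matrix `E`. -/
theorem card_fn_tangentProj_sampling_gt_le {U V : Matrix (Fin n) (Fin r) ℝ} (hU : Uᵀ * U = 1)
    (hV : Vᵀ * V = 1) (hn : 0 < n) (hr : 1 ≤ r) {μ δ : ℝ}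
    (hUc : ∀ i, ∑ k, U i k ^ 2 ≤ μ * r / n) (hVc : ∀ j, ∑ k, V j k ^ 2 ≤ μ * r / n)
    {E : Matrix (Fin n) (Fin n) ℝ} (hE0 : 0 < fn E)
    (hE : ∀ i j, E i j ^ 2 ≤ 25 * (μ * r / n) * fn E ^ 2) (hδ : 0 < δ) (hδ1 : δ ≤ 1)
    (s : Finset (Fin m)) (hs : 0 < s.card) (B : Finset (Fin m → Fin n × Fin n))
    (hB : ∀ ω ∈ B, δ * fn E < fn (((n : ℝ) ^ 2 / s.card) • tangentProj U V (samplingOp ω s E) -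
      tangentProj U V E)) :
    (B.card : ℝ) ≤ ((n : ℝ) ^ 2) ^ m *
      ((n ^ 2 + 1) * Real.exp (-(δ ^ 2 * s.card / (18 * (μ * r * n))))) := by
  have : Nonempty (Fin n) := ⟨⟨0, hn⟩⟩
  have hn' : (1 : ℝ) ≤ n := by exact_mod_cast hn
  have hn0 : (0 : ℝ) < n := by linarith
  have hr' : (1 : ℝ) ≤ r := by exact_mod_cast hr
  have hs0 : (0 : ℝ) < s.card := by exact_mod_cast hs
  have hμ := one_le_of_row_sq_le hr hn hU hUc
  have hμ0 : 0 < μ := by linarith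
  have hr0 : (0 : ℝ) < r := by linarith
  have hcard : (Fintype.card (Fin n × Fin n) : ℝ) = (n : ℝ) ^ 2 := by simp [sq]
  set c : ℝ := μ * r / n with hc
  have hc0 : 0 < c := by positivity
  have hnc : (n : ℝ) ^ 2 * c = μ * r * n := by rw [hc]; field_simp
  have hd1 : 1 ≤ μ * r * n :=
    one_le_mul_of_one_le_of_one_le (one_le_mul_of_one_le_of_one_le hμ hr') hn'
  have hPe : ∀ p : Fin n × Fin n,
      fn (tangentProj U V (Matrix.single p.1 p.2 1)) ^ 2 ≤ 2 * c := fun p =>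
    fn_tangentProj_single_sq_le hU hV hUc hVc _ _
  -- Written as an n² × 1 column, a matrix has its Frobenius norm as operator norm, so the
  -- rectangular Bernstein inequality acts as a vector one; its dimension factor is n² + 1.
  let col : Matrix (Fin n) (Fin n) ℝ → Matrix (Fin n × Fin n) Unit ℝ := fun Z =>
    Matrix.of fun q _ => Z q.1 q.2
  have hcol_sum : ∀ (ι' : Type) (t : Finset ι') (f : ι' → Matrix (Fin n) (Fin n) ℝ),
      ∑ k ∈ t, col (f k) = col (∑ k ∈ t, f k) := by
    intro ι' t f
    ext q u
    simp [col, Matrix.sum_apply]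
  have hcol_sub : ∀ Z W, col Z - col W = col (Z - W) := fun Z W => rfl
  have hcol_fn : ∀ Z, fn (col Z) = fn Z := by
    intro Z
    rw [fn, fn, Fintype.sum_prod_type]
    simp [col]
  have hcol_le : ∀ Z, fn Z ≤ ‖col Z‖ := by
    intro Z
    have h := dotProduct_mulVec_self_le (col Z) (fun _ => 1)
    have h1 : (col Z *ᵥ fun _ => 1) ⬝ᵥ (col Z *ᵥ fun _ => 1) = fn Z ^ 2 := by
      rw [fn_sq, dotProduct, Fintype.sum_prod_type]
      simp [col, Matrix.mulVec, dotProduct, sq]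
    rw [h1] at h
    refine (sq_le_sq₀ (fn_nonneg _) (norm_nonneg _)).1 (h.trans_eq ?_)
    simp [dotProduct]
  set F : Fin n × Fin n → Matrix (Fin n) (Fin n) ℝ := fun p =>
    (n : ℝ) ^ 2 • tangentProj U V (E p.1 p.2 • Matrix.single p.1 p.2 (1 : ℝ)) with hF
  have hTsum : ∀ (ι' : Type) (t : Finset ι') (f : ι' → Matrix (Fin n) (Fin n) ℝ),
      ∑ k ∈ t, tangentProj U V (f k) = tangentProj U V (∑ k ∈ t, f k) := by
    intro ι' t f
    simp only [tangentProj, Finset.sum_sub_distrib, Finset.sum_add_distrib, Matrix.mul_sum,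
      Matrix.sum_mul]
  have hFsq : ∀ p, fn (F p) ^ 2 ≤ (n : ℝ) ^ 2 * (2 * (μ * r * n)) * E p.1 p.2 ^ 2 := by
    intro p
    rw [hF, fn_smul, tangentProj_smul, fn_smul, mul_pow, mul_pow, sq_abs, sq_abs, ← hnc]
    have h1 := mul_le_mul_of_nonneg_left (hPe p)
      (by positivity : 0 ≤ ((n : ℝ) ^ 2) ^ 2 * E p.1 p.2 ^ 2)
    refine le_trans (le_of_eq ?_) (h1.trans_eq ?_) <;> ring
  have hEsum : ∑ p : Fin n × Fin n, E p.1 p.2 ^ 2 = fn E ^ 2 := by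
    rw [fn_sq, Fintype.sum_prod_type]
  have hFsum : ∑ p, fn (F p) ^ 2 ≤ (n : ℝ) ^ 2 * (2 * (μ * r * n) * fn E ^ 2) := by
    rw [← hEsum]
    refine (Finset.sum_le_sum fun p _ => hFsq p).trans_eq ?_
    rw [← Finset.mul_sum, mul_assoc]
  have hFn : ∀ p, fn (F p) ≤ 8 * (μ * r * n) * fn E := by
    intro p
    refine (sq_le_sq₀ (fn_nonneg _) (by positivity)).1 ((hFsq p).trans ?_)
    have h1 := mul_le_mul_of_nonneg_left (hE p.1 p.2)
      (by positivity : 0 ≤ (n : ℝ) ^ 2 * (2 * (μ * r * n)))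
    refine h1.trans ?_
    have h2 : (n : ℝ) ^ 2 * (2 * (μ * r * n)) * (25 * c * fn E ^ 2) =
        50 * (μ * r * n) ^ 2 * fn E ^ 2 := by
      rw [← hnc]; ring
    rw [h2]
    have h3 : 0 ≤ (μ * r * n) ^ 2 * fn E ^ 2 := by positivity
    linarith
  -- Chosen so that θR = δ exactly. The exponent becomes −(1/9 − 2/81) = −7/81 times δ²|s|/(μrn),
  -- and 7/81 ≥ 1/18.
  set θ := δ / (9 * (μ * r * n) * fn E) with hθ
  have hθ0 : 0 < θ := by positivity
  have h := card_norm_sum_gt_le (Y := fun p => col (F p)) (C := col (tangentProj U V E))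
    (R := 9 * (μ * r * n) * fn E) (v := 2 * (μ * r * n) * fn E ^ 2)
    (t := δ * s.card * fn E) (θ := θ)
    (by
      rw [hcol_sum, hF, ← Finset.smul_sum, hTsum, sum_single_eq, ← Nat.cast_smul_eq_nsmul ℝ, hcard]
      rfl)
    (fun p => by
      refine (norm_sub_le _ _).trans ?_
      have h1 := (norm_le_fn (col (F p))).trans ((hcol_fn _).trans_le (hFn p))
      have h2 := (norm_le_fn (col (tangentProj U V E))).trans
        ((hcol_fn _).trans_le (fn_tangentProj_le hU hV E))
      have h3 := mul_le_mul_of_nonneg_right hd1 hE0.le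
      linarith)
    (fun x => by
      rw [hcard]
      have h1 : 0 ≤ x ⬝ᵥ x := Finset.sum_nonneg fun i _ => mul_self_nonneg _
      have h2 : ∀ p, (col (F p) *ᵥ x) ⬝ᵥ (col (F p) *ᵥ x) ≤ fn (F p) ^ 2 * (x ⬝ᵥ x) := fun p =>
        (dotProduct_mulVec_self_le _ _).trans (mul_le_mul_of_nonneg_right
          (pow_le_pow_left₀ (norm_nonneg _) ((norm_le_fn _).trans_eq (hcol_fn _)) 2) h1)
      refine (Finset.sum_le_sum fun p _ => h2 p).trans ?_
      rw [← Finset.sum_mul, ← mul_assoc]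
      exact mul_le_mul_of_nonneg_right hFsum h1)
    (fun x => by
      rw [hcard]
      have h1 : 0 ≤ x ⬝ᵥ x := Finset.sum_nonneg fun i _ => mul_self_nonneg _
      have h2 : ∀ p, ((col (F p))ᵀ *ᵥ x) ⬝ᵥ ((col (F p))ᵀ *ᵥ x) ≤ fn (F p) ^ 2 * (x ⬝ᵥ x) :=
        fun p => (dotProduct_mulVec_self_le _ _).trans (mul_le_mul_of_nonneg_right
          (pow_le_pow_left₀ (norm_nonneg _)
            ((norm_transpose _).trans_le ((norm_le_fn _).trans_eq (hcol_fn _))) 2) h1)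
      refine (Finset.sum_le_sum fun p _ => h2 p).trans ?_
      rw [← Finset.sum_mul, ← mul_assoc]
      exact mul_le_mul_of_nonneg_right hFsum h1)
    hθ0
    (by
      rw [hθ, div_mul_cancel₀ _ (by positivity)]
      exact hδ1)
    s (by positivity) B (fun ω hω => by
      have h1 := mul_lt_mul_of_pos_left (hB ω hω) hs0
      have e : ∑ k ∈ s, (col (F (ω k)) - col (tangentProj U V E)) =
          col ((s.card : ℝ) • (((n : ℝ) ^ 2 / s.card) • tangentProj U V (samplingOp ω s E) -
            tangentProj U V E)) := by
        simp only [hcol_sub]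
        rw [hcol_sum, Finset.sum_sub_distrib, Finset.sum_const, hF, ← Finset.smul_sum, hTsum,
          ← samplingOp_eq_sum, smul_sub, smul_smul, mul_div_cancel₀ _ hs0.ne',
          Nat.cast_smul_eq_nsmul]
      rw [e]
      refine lt_of_lt_of_le ?_ (hcol_le _)
      rw [fn_smul, abs_of_pos hs0]
      linarith)
  rw [hcard] at h
  refine h.trans ?_
  simp only [Fintype.card_fin, Fintype.card_unit]
  push_cast
  gcongr
  have hexp : -(θ * (δ * s.card * fn E)) + θ ^ 2 * (2 * (μ * r * n) * fn E ^ 2) * s.card =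
      -(7 / 81 * (δ ^ 2 * s.card / (μ * r * n))) := by
    rw [hθ]; field_simp; ring
  have hpos : 0 ≤ δ ^ 2 * s.card / (μ * r * n) := by positivity
  rw [hexp]
  have : δ ^ 2 * s.card / (18 * (μ * r * n)) = 1 / 18 * (δ ^ 2 * s.card / (μ * r * n)) := by
    field_simp
  rw [this]
  linarith

end Sampling

end

section

open scoped Matrix.Norms.L2Operator

/-! ### The initialization: deterministic estimates -/

section Init

variable {n r : ℕ}

namespace SVDRoutine

variable (S : SVDRoutine n)

theorem mul_rightFactor (hr : r ≤ n) (Z : Matrix (Fin n) (Fin n) ℝ) :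
    Z * S.rightFactor hr Z = S.leftFactor hr Z * Matrix.diagonal (S.topSV hr Z) := by
  have h1 : (S.right Z)ᵀ * S.rightFactor hr Z =
      (1 : Matrix (Fin n) (Fin n) ℝ).submatrix id (Fin.castLE hr) := by
    rw [← S.right_orth Z]
    rfl
  have h2 : Z * S.rightFactor hr Z =
      S.left Z * Matrix.diagonal (S.sv Z) * (S.right Z)ᵀ * S.rightFactor hr Z := by rw [← S.eq Z]
  rw [h2, Matrix.mul_assoc, h1]
  ext i k
  rw [Matrix.mul_diagonal, Matrix.mul_apply, Finset.sum_eq_single (Fin.castLE hr k)]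
  · rw [Matrix.mul_diagonal, Matrix.submatrix_apply, id, Matrix.one_apply_eq, mul_one]
    rfl
  · intro b _ hb
    simp [hb]
  · simp

/-- The Weyl bound with the roles exchanged: W is bounded below on its leading i + 1 right singular
vectors, while the singular value of X at index i is zero. -/
theorem sv_le_norm_sub {W X : Matrix (Fin n) (Fin n) ℝ} {A : Matrix (Fin n) (Fin r) ℝ}
    {B : Matrix (Fin r) (Fin n) ℝ} (hX : X = A * B) {i : Fin n} (hi : r ≤ i) :
    S.sv W i ≤ ‖W - X‖ := by
  have hi' : (i : ℕ) + 1 ≤ n := i.2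
  have h := S.sub_norm_le_sv X W (S.rightFactor_orth hi' W) (s := S.sv W i) (fun y => by
    rw [mul_rightFactor, ← Matrix.mulVec_mulVec]
    set z := Matrix.diagonal (S.topSV hi' W) *ᵥ y with hz
    refine (sq_le_sq₀ (mul_nonneg (S.sv_nonneg W i) (norm_nonneg _)) (norm_nonneg _)).1 ?_
    have h1 : (S.leftFactor hi' W *ᵥ z) ⬝ᵥ (S.leftFactor hi' W *ᵥ z) = z ⬝ᵥ z := by
      rw [Matrix.dotProduct_mulVec, Matrix.vecMul_mulVec, ← Matrix.mulVec_transpose,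
        Matrix.transpose_mul, Matrix.transpose_transpose, S.leftFactor_orth, Matrix.one_mulVec]
    rw [mul_pow, norm_toLp_sq, norm_toLp_sq, h1, dotProduct, dotProduct, Finset.mul_sum]
    refine Finset.sum_le_sum fun k _ => ?_
    rw [hz, Matrix.mulVec_diagonal]
    have h2 : S.sv W i ≤ S.topSV hi' W k :=
      S.sv_antitone W (Fin.le_def.2 (Nat.lt_succ_iff.1 k.2))
    have h3 := mul_le_mul_of_nonneg_right (pow_le_pow_left₀ (S.sv_nonneg W i) h2 2)
      (mul_self_nonneg (y k))
    refine h3.trans_eq (by ring)) (Nat.lt_succ_self _)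
  rw [S.sv_eq_zero hX hi] at h
  linarith

theorem norm_left_le (Z : Matrix (Fin n) (Fin n) ℝ) : ‖S.left Z‖ ≤ 1 :=
  norm_le_one_of_transpose_mul_self (S.left_orth Z)

theorem norm_hardThreshold_sub_le (W : Matrix (Fin n) (Fin n) ℝ) {X : Matrix (Fin n) (Fin n) ℝ}
    {A : Matrix (Fin n) (Fin r) ℝ} {B : Matrix (Fin r) (Fin n) ℝ} (hX : X = A * B) :
    ‖S.hardThreshold r W - X‖ ≤ 2 * ‖W - X‖ := by
  have h1 : ‖S.hardThreshold r W - W‖ ≤ ‖W - X‖ := by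
    have e : S.hardThreshold r W - W = S.left W *
        Matrix.diagonal (fun i : Fin n => if (i : ℕ) < r then 0 else -S.sv W i) *
          (S.right W)ᵀ := by
      have e0 : S.hardThreshold r W - W = S.hardThreshold r W -
          S.left W * Matrix.diagonal (S.sv W) * (S.right W)ᵀ := by rw [← S.eq W]
      rw [e0, hardThreshold, ← Matrix.sub_mul, ← Matrix.mul_sub, Matrix.diagonal_sub]
      congr 3
      funext i
      split_ifs <;> simp
    rw [e]
    have h2 : ‖(Matrix.diagonal fun i : Fin n => if (i : ℕ) < r then 0 else -S.sv W i :
        Matrix (Fin n) (Fin n) ℝ)‖ ≤ ‖W - X‖ := by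
      refine norm_diagonal_le (norm_nonneg _) fun i => ?_
      split_ifs with hi
      · simp
      · rw [abs_neg, abs_of_nonneg (S.sv_nonneg W i)]
        exact S.sv_le_norm_sub hX (not_lt.1 hi)
    have h3 : ‖(S.right W)ᵀ‖ ≤ 1 :=
      (norm_transpose _).trans_le (norm_le_one_of_transpose_mul_self (S.right_orth W))
    calc _ ≤ ‖S.left W‖ * ‖(Matrix.diagonal fun i : Fin n => if (i : ℕ) < r then 0 else -S.sv W i :
        Matrix (Fin n) (Fin n) ℝ)‖ * ‖(S.right W)ᵀ‖ :=
          (norm_mul_le _ _).trans (mul_le_mul_of_nonneg_right (norm_mul_le _ _) (norm_nonneg _))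
      _ ≤ 1 * ‖W - X‖ * 1 := by
          gcongr
          exact S.norm_left_le W
      _ = _ := by ring
  calc _ = ‖(S.hardThreshold r W - W) + (W - X)‖ := by rw [sub_add_sub_cancel]
    _ ≤ _ := (norm_add_le _ _).trans (by linarith)

theorem fn_orth {k : ℕ} {U : Matrix (Fin n) (Fin k) ℝ} (hU : Uᵀ * U = 1) : fn U = Real.sqrt k := by
  have h1 : fn U ^ 2 = k := by
    rw [← Matrix.mul_one U, fn_mul_of_orth hU, fn_sq]
    simp [Matrix.one_apply]
  rw [← h1, Real.sqrt_sq (fn_nonneg _)]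

/-- The difference D of two matrices of rank at most r splits into a part with columns in the range
of U' and a part with rows in the range of V. Each costs √r‖D‖, and ‖D‖ ≤ 2‖W − X‖. -/
theorem fn_hardThreshold_sub_le_norm (hr : r ≤ n) (W : Matrix (Fin n) (Fin n) ℝ)
    {X : Matrix (Fin n) (Fin n) ℝ} {U V : Matrix (Fin n) (Fin r) ℝ} {σ : Fin r → ℝ}
    (h : IsReducedSVD X U σ V) :
    fn (S.hardThreshold r W - X) ≤ 4 * Real.sqrt r * ‖W - X‖ := by
  set D := S.hardThreshold r W - X with hD
  set U' := S.leftFactor hr W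
  have hU' := S.leftFactor_orth hr W
  have hH : (1 - U' * U'ᵀ) * S.hardThreshold r W = 0 := by
    rw [S.hardThreshold_eq hr, Matrix.mul_assoc, compl_proj_mul hU']
  have hXV : X = X * V * Vᵀ := by
    have := h.mul_compl_right
    rw [Matrix.mul_sub, Matrix.mul_one, sub_eq_zero, ← Matrix.mul_assoc] at this
    exact this
  have e : D = U' * (U'ᵀ * D) + (1 - U' * U'ᵀ) * (D * V) * Vᵀ := by
    have e1 : (1 - U' * U'ᵀ) * (D * V) * Vᵀ = (1 - U' * U'ᵀ) * D := by
      rw [hD, Matrix.sub_mul (S.hardThreshold r W), Matrix.mul_sub, ← Matrix.mul_assoc, hH,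
        Matrix.zero_mul, Matrix.mul_sub, hH, zero_sub, zero_sub, Matrix.neg_mul, Matrix.mul_assoc,
        ← hXV]
    rw [e1, ← Matrix.mul_assoc, ← Matrix.add_mul]
    simp
  have hn := S.norm_hardThreshold_sub_le W (X := X) (A := U * Matrix.diagonal σ) (B := Vᵀ) h.eq
  have h1 : fn (U' * (U'ᵀ * D)) ≤ Real.sqrt r * ‖D‖ := by
    rw [fn_mul_of_orth hU']
    refine (fn_mul_le' _ _).trans_eq ?_
    rw [fn_transpose, fn_orth hU']
  have h2 : fn ((1 - U' * U'ᵀ) * (D * V) * Vᵀ) ≤ ‖D‖ * Real.sqrt r := by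
    rw [fn_mul_transpose_of_orth h.right_orth]
    refine (fn_mul_le _ _).trans ?_
    refine (mul_le_of_le_one_left (fn_nonneg _) (norm_compl_proj_le hU')).trans ?_
    exact (fn_mul_le _ _).trans_eq (by rw [fn_orth h.right_orth])
  rw [e]
  have h3 := mul_le_mul_of_nonneg_left hn (Real.sqrt_nonneg r)
  refine (fn_add_le _ _).trans ?_
  linarith

end SVDRoutine

theorem trimRows_eq {c : ℝ} (A : Matrix (Fin n) (Fin r) ℝ) : trimRows c A =
    Matrix.diagonal (fun i => min (vecNorm (A i)) c / vecNorm (A i)) * A := by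
  ext i k
  rw [Matrix.diagonal_mul, trimRows, Matrix.of_apply]
  ring

theorem vecNorm_nonneg {k : ℕ} (v : Fin k → ℝ) : 0 ≤ vecNorm v := Real.sqrt_nonneg _

theorem vecNorm_sq {k : ℕ} (v : Fin k → ℝ) : vecNorm v ^ 2 = ∑ i, v i ^ 2 :=
  Real.sq_sqrt (Finset.sum_nonneg fun _ _ => sq_nonneg _)

theorem norm_trimRows_le {c : ℝ} (hc : 0 ≤ c) {A : Matrix (Fin n) (Fin r) ℝ} (hA : ‖A‖ ≤ 1) :
    ‖trimRows c A‖ ≤ 1 := by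
  rw [trimRows_eq]
  refine (Matrix.l2_opNorm_mul _ _).trans (mul_le_one₀ (norm_diagonal_le zero_le_one fun i => ?_)
    (norm_nonneg _) hA)
  have h0 := vecNorm_nonneg (A i)
  rw [abs_of_nonneg (div_nonneg (le_min h0 hc) h0)]
  exact div_le_one_of_le₀ (min_le_left _ _) h0

theorem trimRows_row_sq_le {c : ℝ} (hc : 0 ≤ c) (A : Matrix (Fin n) (Fin r) ℝ) (i : Fin n) :
    ∑ k, trimRows c A i k ^ 2 ≤ c ^ 2 := by
  have h0 := vecNorm_nonneg (A i)
  have h1 : ∑ k, trimRows c A i k ^ 2 =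
      (min (vecNorm (A i)) c / vecNorm (A i)) ^ 2 * vecNorm (A i) ^ 2 := by
    rw [vecNorm_sq, Finset.mul_sum, trimRows_eq]
    exact Finset.sum_congr rfl fun k _ => by rw [Matrix.diagonal_mul, mul_pow]
  rw [h1, ← mul_pow]
  refine pow_le_pow_left₀ (mul_nonneg (div_nonneg (le_min h0 hc) h0) h0) ?_ 2
  by_cases hz : vecNorm (A i) = 0
  · rw [hz, mul_zero]; exact hc
  · rw [div_mul_cancel₀ _ hz]; exact min_le_right _ _

/-- Trimming projects every row to a ball. -/
theorem fn_trimRows_sub_le {c : ℝ} (hc : 0 ≤ c) (A B : Matrix (Fin n) (Fin r) ℝ)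
    (hB : ∀ i, ∑ k, B i k ^ 2 ≤ c ^ 2) : fn (trimRows c A - A) ≤ fn (B - A) := by
  refine Real.sqrt_le_sqrt (Finset.sum_le_sum fun i _ => ?_)
  have h0 := vecNorm_nonneg (A i)
  set a := vecNorm (A i) with ha
  have h1 : ∑ k, (trimRows c A - A) i k ^ 2 = ((min a c / a - 1) * a) ^ 2 := by
    rw [mul_pow, ha, vecNorm_sq, Finset.mul_sum]
    refine Finset.sum_congr rfl fun k _ => ?_
    -- A row is moved radially, so only its length matters. A zero row gets multiplier 0/0 = 0 and
    -- stays put.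
    rw [trimRows_eq, Matrix.sub_apply, Matrix.diagonal_mul]
    ring
  rw [h1]
  by_cases hz : a ≤ c
  · rw [min_eq_left hz]
    by_cases hz' : a = 0
    · rw [hz']
      simp only [mul_zero, ne_eq, OfNat.ofNat_ne_zero, not_false_eq_true, zero_pow]
      exact Finset.sum_nonneg fun k _ => sq_nonneg _
    · rw [div_self hz', sub_self, zero_mul]
      simp only [ne_eq, OfNat.ofNat_ne_zero, not_false_eq_true, zero_pow]
      exact Finset.sum_nonneg fun k _ => sq_nonneg _
  · have hz1 := not_le.1 hz
    have hz2 : a ≠ 0 := by linarith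
    rw [min_eq_right hz1.le, sub_mul, div_mul_cancel₀ _ hz2, one_mul]
    have hb : vecNorm (B i) ≤ c := Real.sqrt_le_iff.2 ⟨hc, hB i⟩
    have htri : a ≤ vecNorm ((B - A) i) + vecNorm (B i) := by
      rw [ha, vecNorm_eq_norm, vecNorm_eq_norm, vecNorm_eq_norm]
      have := norm_sub_le (WithLp.toLp 2 (B i) : EuclideanSpace ℝ (Fin r))
        (WithLp.toLp 2 ((B - A) i))
      rw [← WithLp.toLp_sub] at this
      have e : B i - (B - A) i = A i := by ext k; simp
      rw [e] at this
      linarith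
    rw [← vecNorm_sq ((B - A) i)]
    have h3 : 0 ≤ vecNorm ((B - A) i) := vecNorm_nonneg _
    nlinarith

theorem row_mul_sq_le (A : Matrix (Fin n) (Fin r) ℝ) (M : Matrix (Fin r) (Fin r) ℝ) (i : Fin n) :
    ∑ k, (A * M) i k ^ 2 ≤ ‖M‖ ^ 2 * ∑ k, A i k ^ 2 := by
  have h := dotProduct_mulVec_self_le Mᵀ (A i)
  rw [norm_transpose] at h
  simp only [dotProduct, ← sq] at h
  refine le_trans (le_of_eq ?_) h
  refine Finset.sum_congr rfl fun k _ => ?_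
  rw [Matrix.mul_apply, Matrix.mulVec_transpose]
  rfl

theorem abs_mul_apply_le {k : ℕ} (A : Matrix (Fin n) (Fin r) ℝ) (B : Matrix (Fin r) (Fin k) ℝ)
    (i : Fin n) (j : Fin k) : |(A * B) i j| ≤ Real.sqrt (∑ l, A i l ^ 2) * fn B := by
  have h1 : (A * B) i j ^ 2 ≤ (∑ l, A i l ^ 2) * fn B ^ 2 := by
    rw [Matrix.mul_apply]
    refine (Finset.sum_mul_sq_le_sq_mul_sq _ _ _).trans ?_
    refine mul_le_mul_of_nonneg_left ?_ (Finset.sum_nonneg fun _ _ => sq_nonneg _)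
    rw [fn_sq]
    exact Finset.sum_le_sum fun l _ =>
      Finset.single_le_sum (f := fun j => B l j ^ 2) (fun _ _ => sq_nonneg _) (Finset.mem_univ j)
  rw [← Real.sqrt_sq_eq_abs]
  refine (Real.sqrt_le_sqrt h1).trans_eq ?_
  rw [Real.sqrt_mul (Finset.sum_nonneg fun _ _ => sq_nonneg _), Real.sqrt_sq (fn_nonneg _)]

/-- An orthonormal basis of the range of a matrix close to an orthonormal one inherits the row
bounds. -/
theorem row_sq_le_of_factor {U' A W : Matrix (Fin n) (Fin r) ℝ} {M : Matrix (Fin r) (Fin r) ℝ}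
    {c : ℝ} (hU' : U'ᵀ * U' = 1) (hW : Wᵀ * W = 1) (hM : U' = A * M) (hA : fn (A - W) ≤ 1 / 9)
    (hc : ∀ i, ∑ k, A i k ^ 2 ≤ c) (i : Fin n) : ∑ k, U' i k ^ 2 ≤ 2 * c := by
  -- M is expressed through itself with the small factor A − W, so its norm satisfies ‖M‖ ≤ 1 +
  -- ‖M‖/9; then ‖M‖² ≤ (9/8)² ≤ 2.
  have e : M = Wᵀ * U' - Wᵀ * ((A - W) * M) := by
    rw [Matrix.sub_mul, ← hM, Matrix.mul_sub, ← Matrix.mul_assoc, hW, Matrix.one_mul]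
    simp
  have hWn : ‖Wᵀ‖ ≤ 1 := (norm_transpose _).trans_le (norm_le_one_of_transpose_mul_self hW)
  have hM1 : ‖M‖ ≤ 1 + 1 / 9 * ‖M‖ := by
    conv_lhs => rw [e]
    refine (norm_sub_le _ _).trans (add_le_add ?_ ?_)
    · exact (Matrix.l2_opNorm_mul _ _).trans
        (mul_le_one₀ hWn (norm_nonneg _) (norm_le_one_of_transpose_mul_self hU'))
    · refine (Matrix.l2_opNorm_mul _ _).trans ((mul_le_of_le_one_left (norm_nonneg _) hWn).trans ?_)
      refine (Matrix.l2_opNorm_mul _ _).trans (mul_le_mul_of_nonneg_right ?_ (norm_nonneg _))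
      exact (norm_le_fn _).trans hA
  have hM2 : ‖M‖ ≤ 9 / 8 := by linarith
  rw [hM]
  refine (row_mul_sq_le A M i).trans ?_
  have h3 : ‖M‖ ^ 2 ≤ 2 := by nlinarith [norm_nonneg M]
  calc ‖M‖ ^ 2 * ∑ k, A i k ^ 2 ≤ 2 * ∑ k, A i k ^ 2 :=
        mul_le_mul_of_nonneg_right h3 (Finset.sum_nonneg fun _ _ => sq_nonneg _)
    _ ≤ _ := by linarith [hc i]

/-- The tangential part of E = X − Y is tested against P_T(e_i e_jᵀ), of norm at most √(2c). The
normal part is (UUᵀ − U'U'ᵀ)E(1 − V'V'ᵀ), whose entries are controlled by rows of U and U'. Together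
4√c‖E‖, so 25 is generous. -/
theorem sq_sub_apply_le {X Y : Matrix (Fin n) (Fin n) ℝ} {U U' V' : Matrix (Fin n) (Fin r) ℝ}
    {c : ℝ} (hc0 : 0 ≤ c) (hU : Uᵀ * U = 1) (hX : (1 - U * Uᵀ) * X = 0)
    (hU' : U'ᵀ * U' = 1) (hV' : V'ᵀ * V' = 1) (hY : (1 - U' * U'ᵀ) * Y = 0)
    (hYV : Y * (1 - V' * V'ᵀ) = 0) (hUc : ∀ i, ∑ k, U i k ^ 2 ≤ c)
    (hUc' : ∀ i, ∑ k, U' i k ^ 2 ≤ c) (hVc' : ∀ j, ∑ k, V' j k ^ 2 ≤ c) (i j : Fin n) :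
    (X - Y) i j ^ 2 ≤ 25 * c * fn (X - Y) ^ 2 := by
  set E := X - Y with hE
  set N := 1 - V' * V'ᵀ with hN
  have hEN : fn (E * N) ≤ fn E :=
    (fn_mul_le' _ _).trans (mul_le_of_le_one_right (fn_nonneg _) (norm_compl_proj_le hV'))
  have e : E - tangentProj U' V' E = U * (Uᵀ * (E * N)) - U' * (U'ᵀ * (E * N)) := by
    have e1 : E * N = X * N := by rw [hE, Matrix.sub_mul, hYV, sub_zero]
    have e2 : X - U * (Uᵀ * X) = 0 := by
      rw [← Matrix.mul_assoc, ← hX, Matrix.sub_mul, Matrix.one_mul]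
    have e3 : (1 - U' * U'ᵀ) * E = (1 - U' * U'ᵀ) * X := by
      rw [hE, Matrix.mul_sub (1 - U' * U'ᵀ) X Y, hY, sub_zero]
    rw [sub_tangentProj, e3, ← hN, e1, Matrix.sub_mul, Matrix.one_mul, Matrix.sub_mul,
      Matrix.mul_assoc U', Matrix.mul_assoc U', Matrix.mul_assoc U'ᵀ]
    congr 1
    rw [← Matrix.mul_assoc Uᵀ, ← Matrix.mul_assoc, ← sub_eq_zero.1 e2]
  have hsq := Real.sqrt_nonneg c
  have hb : ∀ W : Matrix (Fin n) (Fin r) ℝ, Wᵀ * W = 1 → (∀ i, ∑ k, W i k ^ 2 ≤ c) →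
      |(W * (Wᵀ * (E * N))) i j| ≤ Real.sqrt c * fn E := by
    intro W hW hWc
    refine (abs_mul_apply_le _ _ _ _).trans ?_
    refine mul_le_mul (Real.sqrt_le_sqrt (hWc i)) ?_ (fn_nonneg _) hsq
    refine ((fn_mul_le _ _).trans (mul_le_of_le_one_left (fn_nonneg _) ?_)).trans hEN
    exact (norm_transpose _).trans_le (norm_le_one_of_transpose_mul_self hW)
  have h1 : |tangentProj U' V' E i j| ≤ 2 * Real.sqrt c * fn E := by
    rw [← fi_single i j (tangentProj U' V' E), ← fi_tangentProj]
    refine (abs_fi_le _ _).trans (mul_le_mul_of_nonneg_right ?_ (fn_nonneg _))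
    refine (sq_le_sq₀ (fn_nonneg _) (by positivity)).1 ?_
    refine (fn_tangentProj_single_sq_le hU' hV' hUc' hVc' i j).trans ?_
    rw [mul_pow, Real.sq_sqrt hc0]
    linarith
  have h2 : |E i j| ≤ 4 * Real.sqrt c * fn E := by
    have e3 : E i j = tangentProj U' V' E i j +
        ((U * (Uᵀ * (E * N))) i j - (U' * (U'ᵀ * (E * N))) i j) := by
      have := congrFun (congrFun e i) j
      rw [Matrix.sub_apply, Matrix.sub_apply] at this
      linarith
    rw [e3]
    refine (abs_add_le _ _).trans ?_
    have h3 := abs_sub ((U * (Uᵀ * (E * N))) i j) ((U' * (U'ᵀ * (E * N))) i j)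
    have h4 := hb U hU hUc
    have h5 := hb U' hU' hUc'
    linarith
  rw [← sq_abs]
  refine (pow_le_pow_left₀ (abs_nonneg _) h2 2).trans ?_
  rw [mul_pow, mul_pow, Real.sq_sqrt hc0]
  have : 0 ≤ c * fn E ^ 2 := mul_nonneg hc0 (sq_nonneg _)
  linarith

theorem topSV_le_norm (S : SVDRoutine n) (hr : r ≤ n) (Z : Matrix (Fin n) (Fin n) ℝ) (k : Fin r) :
    S.topSV hr Z k ≤ ‖Z‖ := by
  have h := S.sv_le_norm_sub (W := Z) (X := 0) (r := 0)
    (A := (0 : Matrix (Fin n) (Fin 0) ℝ)) (B := 0) (by simp) (i := Fin.castLE hr k)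
    (Nat.zero_le _)
  rwa [sub_zero] at h

theorem IsReducedSVD.norm_le {X : Matrix (Fin n) (Fin n) ℝ} {U V : Matrix (Fin n) (Fin r) ℝ}
    {σ : Fin r → ℝ} (h : IsReducedSVD X U σ V) {t : ℝ} (ht : 0 ≤ t) (hσ : ∀ k, σ k ≤ t) :
    ‖X‖ ≤ t := by
  rw [h.eq]
  have h1 : ‖(Matrix.diagonal σ : Matrix (Fin r) (Fin r) ℝ)‖ ≤ t :=
    norm_diagonal_le ht fun k => by rw [abs_of_pos (h.pos k)]; exact hσ k
  have h2 : ‖Vᵀ‖ ≤ 1 :=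
    (norm_transpose _).trans_le (norm_le_one_of_transpose_mul_self h.right_orth)
  calc _ ≤ ‖U‖ * ‖(Matrix.diagonal σ : Matrix (Fin r) (Fin r) ℝ)‖ * ‖Vᵀ‖ :=
        (Matrix.l2_opNorm_mul _ _).trans
          (mul_le_mul_of_nonneg_right (Matrix.l2_opNorm_mul _ _) (norm_nonneg _))
    _ ≤ 1 * t * 1 := by
        gcongr
        exact norm_le_one_of_transpose_mul_self h.left_orth
    _ = t := by ring

/-- Trimming a matrix close to `X`. -/
theorem trim_spec (S : SVDRoutine n) (hr : r ≤ n) {X Z : Matrix (Fin n) (Fin n) ℝ}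
    {U V : Matrix (Fin n) (Fin r) ℝ} {σ : Fin r → ℝ} (h : IsReducedSVD X U σ V) {s κ μ₀ : ℝ}
    (hs : 0 < s) (hσ : ∀ k, s ≤ σ k) (hκ : 1 ≤ κ) (hσκ : ∀ k, σ k ≤ κ * s) (hμ : 0 ≤ μ₀)
    (hUc : ∀ i, ∑ k, U i k ^ 2 ≤ μ₀ * r / n) (hVc : ∀ j, ∑ k, V j k ^ 2 ≤ μ₀ * r / n)
    {A : Matrix (Fin n) (Fin r) ℝ} {B : Matrix (Fin r) (Fin n) ℝ} (hZ : Z = A * B)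
    (hnear : fn (Z - X) ≤ s / (128 * κ ^ 2)) :
    (∃ (A : Matrix (Fin n) (Fin r) ℝ) (B : Matrix (Fin r) (Fin n) ℝ), trim S hr μ₀ Z = A * B) ∧
    fn (X - trim S hr μ₀ Z) ≤ 4 * κ * fn (Z - X) ∧
    (∀ i, ∑ k, S.leftFactor hr (trim S hr μ₀ Z) i k ^ 2 ≤ 2 * μ₀ * r / n) ∧
    (∀ i, ∑ k, S.rightFactor hr (trim S hr μ₀ Z) i k ^ 2 ≤ 2 * μ₀ * r / n) ∧
    (∀ i j, (X - trim S hr μ₀ Z) i j ^ 2 ≤ 25 * (2 * μ₀ * r / n) * fn (X - trim S hr μ₀ Z) ^ 2) ∧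
    (trim S hr μ₀ Z - S.leftFactor hr (trim S hr μ₀ Z) * (S.leftFactor hr (trim S hr μ₀ Z))ᵀ *
      trim S hr μ₀ Z = 0) ∧
    (trim S hr μ₀ Z * (1 - S.rightFactor hr (trim S hr μ₀ Z) *
      (S.rightFactor hr (trim S hr μ₀ Z))ᵀ) = 0) := by
  set Zh := trim S hr μ₀ Z with hZh
  set c := Real.sqrt (μ₀ * r / n) with hc
  have hc0 : 0 ≤ c := Real.sqrt_nonneg _
  have hc2 : c ^ 2 = μ₀ * r / n := Real.sq_sqrt (by positivity)
  set Uz := S.leftFactor hr Z with hUz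
  set Vz := S.rightFactor hr Z with hVz
  set A' := trimRows c Uz with hA'
  set B' := trimRows c Vz with hB'
  set Λ : Matrix (Fin r) (Fin r) ℝ := Matrix.diagonal (S.topSV hr Z) with hΛ
  have hUzo := S.leftFactor_orth hr Z
  have hVzo := S.rightFactor_orth hr Z
  have e0 := fn_nonneg (Z - X)
  set e := fn (Z - X) with he
  have hκ2 : (1 : ℝ) ≤ κ ^ 2 := one_le_pow₀ hκ
  have hes : 128 * κ ^ 2 * e ≤ s := by
    rw [le_div_iff₀ (by positivity)] at hnear
    linarith
  have hκe : 128 * (κ * e) ≤ s := by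
    have : κ * e ≤ κ ^ 2 * e := mul_le_mul_of_nonneg_right (by nlinarith) e0
    linarith
  have hes1 : 128 * e ≤ s := by
    have : e ≤ κ * e := le_mul_of_one_le_left e0 hκ
    linarith
  have hXZ : ‖X - Z‖ ≤ e := (norm_le_fn _).trans_eq (fn_sub_comm _ _)
  have hsv : ∀ k, 127 / 128 * s ≤ S.topSV hr Z k := fun k => by
    have := S.topSV_lower hr h hs hσ (Y := Z) k
    linarith
  have hs' : 0 < 127 / 128 * s := by positivity
  have hZsvd := S.isReducedSVD_of_factor hr hZ fun k => hs'.trans_le (hsv k)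
  have hXn : ‖X‖ ≤ κ * s := h.norm_le (by positivity) hσκ
  have hZn : ‖Z‖ ≤ κ * s + e := by
    have h1 : ‖Z‖ ≤ ‖X‖ + ‖X - Z‖ := by
      have := norm_sub_le X (X - Z)
      rwa [sub_sub_cancel] at this
    linarith
  have hΛn : ‖Λ‖ ≤ κ * s + e := norm_diagonal_le (by positivity) fun k => by
    rw [abs_of_pos (hs'.trans_le (hsv k))]
    exact (topSV_le_norm S hr Z k).trans hZn
  have hUdist : fn (A' - Uz) ≤ e / (127 / 128 * s) := by
    -- UUᵀU_Z is incoherent since ‖UᵀU_Z‖ ≤ 1, and it is close to U_Z by the Wedin-type bound.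
    -- Trimming, a rowwise nearest point map, is at least as close.
    refine (fn_trimRows_sub_le hc0 Uz (U * (Uᵀ * Uz)) fun i => ?_).trans ?_
    · refine (row_mul_sq_le _ _ _).trans ?_
      rw [hc2]
      refine (mul_le_of_le_one_left (Finset.sum_nonneg fun _ _ => sq_nonneg _) ?_).trans (hUc i)
      refine pow_le_one₀ (norm_nonneg _) ?_
      exact (Matrix.l2_opNorm_mul _ _).trans (mul_le_one₀ ((norm_transpose _).trans_le
        (norm_le_one_of_transpose_mul_self h.left_orth)) (norm_nonneg _)
        (norm_le_one_of_transpose_mul_self hUzo))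
    · have h1 := hZsvd.fn_mul_left_le hs' hsv (Y := X) (norm_compl_proj_le h.left_orth)
        h.compl_left_mul
      rw [Matrix.sub_mul, Matrix.one_mul, Matrix.mul_assoc, fn_sub_comm] at h1
      exact h1
  have hVdist : fn (B' - Vz) ≤ e / (127 / 128 * s) := by
    refine (fn_trimRows_sub_le hc0 Vz (V * (Vᵀ * Vz)) fun i => ?_).trans ?_
    · refine (row_mul_sq_le _ _ _).trans ?_
      rw [hc2]
      refine (mul_le_of_le_one_left (Finset.sum_nonneg fun _ _ => sq_nonneg _) ?_).trans (hVc i)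
      refine pow_le_one₀ (norm_nonneg _) ?_
      exact (Matrix.l2_opNorm_mul _ _).trans (mul_le_one₀ ((norm_transpose _).trans_le
        (norm_le_one_of_transpose_mul_self h.right_orth)) (norm_nonneg _)
        (norm_le_one_of_transpose_mul_self hVzo))
    · have h1 := hZsvd.transpose.fn_mul_left_le hs' hsv (Y := Xᵀ)
        (norm_compl_proj_le h.right_orth) h.transpose.compl_left_mul
      rw [Matrix.sub_mul, Matrix.one_mul, Matrix.mul_assoc, fn_sub_comm, ← Matrix.transpose_sub,
        fn_transpose] at h1
      exact h1
  have hd : e / (127 / 128 * s) ≤ 1 / 9 := by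
    rw [div_le_iff₀ hs']
    linarith
  have hZeq : Z = Uz * Λ * Vzᵀ := hZsvd.eq
  have hB1 : ‖B'ᵀ‖ ≤ 1 := (norm_transpose _).trans_le
    (norm_trimRows_le hc0 (norm_le_one_of_transpose_mul_self hVzo))
  have hZhe : Zh = A' * Λ * B'ᵀ := rfl
  have hdist : fn (Z - Zh) ≤ 2 * ((κ * s + e) * (e / (127 / 128 * s))) := by
    have e1 : Z - Zh = Uz * (Λ * (Vz - B')ᵀ) - (A' - Uz) * Λ * B'ᵀ := by
      rw [hZhe, Matrix.transpose_sub, Matrix.mul_sub, Matrix.mul_sub, Matrix.sub_mul,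
        Matrix.sub_mul, ← Matrix.mul_assoc, ← Matrix.mul_assoc, ← hZeq]
      abel
    rw [e1]
    refine (fn_sub_le _ _).trans ?_
    have h1 : fn (Uz * (Λ * (Vz - B')ᵀ)) ≤ (κ * s + e) * (e / (127 / 128 * s)) := by
      rw [fn_mul_of_orth hUzo]
      refine (fn_mul_le _ _).trans ?_
      rw [fn_transpose, fn_sub_comm]
      exact mul_le_mul hΛn hVdist (fn_nonneg _) (by positivity)
    have h2 : fn ((A' - Uz) * Λ * B'ᵀ) ≤ (κ * s + e) * (e / (127 / 128 * s)) := by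
      refine (fn_mul_le' _ _).trans ((mul_le_of_le_one_right (fn_nonneg _) hB1).trans ?_)
      refine (fn_mul_le' _ _).trans ?_
      rw [mul_comm]
      exact mul_le_mul hΛn hUdist (fn_nonneg _) (by positivity)
    linarith
  have hE : fn (X - Zh) ≤ 4 * κ * e := by
    have h1 : fn (X - Zh) ≤ e + fn (Z - Zh) := by
      have := fn_add_le (X - Z) (Z - Zh)
      rw [sub_add_sub_cancel, fn_sub_comm X Z] at this
      exact this
    -- The two trimmed factors cost at most 5κe/4 each; adding e ≤ κe stays below 4κe.
    have h2 : (κ * s + e) * (e / (127 / 128 * s)) ≤ 5 / 4 * κ * e := by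
      rw [← mul_div_assoc, div_le_iff₀ hs']
      have h3 : κ * s + e ≤ κ * s * (129 / 128) := by
        have : s ≤ κ * s := le_mul_of_one_le_left hs.le hκ
        linarith
      have h4 := mul_le_mul_of_nonneg_right h3 e0
      have h5 : 0 ≤ κ * s * e := by positivity
      linarith
    have h6 : e ≤ κ * e := le_mul_of_one_le_left e0 hκ
    linarith
  have hXZh : ‖X - Zh‖ ≤ 4 * κ * e := (norm_le_fn _).trans hE
  have hZhf : Zh = A' * (Λ * B'ᵀ) := by rw [hZhe, Matrix.mul_assoc]
  have hsvh : ∀ k, 0 < S.topSV hr Zh k := fun k => by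
    have := S.topSV_lower hr h hs hσ (Y := Zh) k
    linarith
  have hsvd := S.isReducedSVD_of_factor hr hZhf hsvh
  have hUrow : ∀ i, ∑ k, S.leftFactor hr Zh i k ^ 2 ≤ 2 * μ₀ * r / n := by
    intro i
    have h1 := row_sq_le_of_factor (U' := S.leftFactor hr Zh) (A := A') (W := Uz)
      (M := Λ * B'ᵀ * (S.rightFactor hr Zh * Matrix.diagonal fun k => (S.topSV hr Zh k)⁻¹))
      (S.leftFactor_orth hr Zh) hUzo
      (by rw [← Matrix.mul_assoc, ← hZhf]; exact hsvd.left_eq) (hUdist.trans hd)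
      (fun i => trimRows_row_sq_le hc0 Uz i) i
    rw [hc2] at h1
    refine h1.trans_eq (by ring)
  have hVrow : ∀ i, ∑ k, S.rightFactor hr Zh i k ^ 2 ≤ 2 * μ₀ * r / n := by
    intro i
    have hZht : Zhᵀ = B' * (Λ * A'ᵀ) := by
      rw [hZhe, Matrix.transpose_mul, Matrix.transpose_mul, Matrix.transpose_transpose, hΛ,
        Matrix.diagonal_transpose]
    have h1 := row_sq_le_of_factor (U' := S.rightFactor hr Zh) (A := B') (W := Vz)
      (M := Λ * A'ᵀ * (S.leftFactor hr Zh * Matrix.diagonal fun k => (S.topSV hr Zh k)⁻¹))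
      (S.rightFactor_orth hr Zh) hVzo
      (by rw [← Matrix.mul_assoc, ← hZht]; exact hsvd.transpose.left_eq) (hVdist.trans hd)
      (fun i => trimRows_row_sq_le hc0 Vz i) i
    rw [hc2] at h1
    refine h1.trans_eq (by ring)
  have hcc : μ₀ * r / n ≤ 2 * μ₀ * r / n := by
    have : 0 ≤ μ₀ * r / n := by positivity
    have e2 : 2 * μ₀ * r / n = 2 * (μ₀ * r / n) := by ring
    linarith
  refine ⟨⟨_, _, hZhf⟩, hE, hUrow, hVrow, sq_sub_apply_le (by positivity) h.left_orth
    h.compl_left_mul (S.leftFactor_orth hr Zh) (S.rightFactor_orth hr Zh) hsvd.compl_left_mul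
    hsvd.mul_compl_right (fun i => (hUc i).trans hcc) hUrow hVrow, ?_, hsvd.mul_compl_right⟩
  rw [← hsvd.compl_left_mul, Matrix.sub_mul, Matrix.one_mul]

/-- One step of the initialization halves the error if the sampling deviation is small. -/
theorem fn_initStep_le (S : SVDRoutine n) (hr : r ≤ n) {X Z : Matrix (Fin n) (Fin n) ℝ}
    {U V : Matrix (Fin n) (Fin r) ℝ} {σ : Fin r → ℝ} (h : IsReducedSVD X U σ V) {s κ μ₀ : ℝ}
    (hs : 0 < s) (hσ : ∀ k, s ≤ σ k) (hκ : 1 ≤ κ) (hσκ : ∀ k, σ k ≤ κ * s) (hμ : 0 ≤ μ₀)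
    (hUc : ∀ i, ∑ k, U i k ^ 2 ≤ μ₀ * r / n) (hVc : ∀ j, ∑ k, V j k ^ 2 ≤ μ₀ * r / n)
    {A : Matrix (Fin n) (Fin r) ℝ} {B : Matrix (Fin r) (Fin n) ℝ} (hZ : Z = A * B)
    (hnear : fn (Z - X) ≤ s / (128 * κ ^ 2)) {G : Matrix (Fin n) (Fin n) ℝ}
    (hG : fn (G - tangentProjAt S hr (trim S hr μ₀ Z) (X - trim S hr μ₀ Z)) ≤
      1 / (32 * κ) * fn (X - trim S hr μ₀ Z)) :
    fn (S.hardThreshold r (trim S hr μ₀ Z + G) - X) ≤ fn (Z - X) / 2 := by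
  obtain ⟨-, hE, -, -, -, hl, hr'⟩ := trim_spec S hr h hs hσ hκ hσκ hμ hUc hVc hZ hnear
  set Zh := trim S hr μ₀ Z with hZh
  set e := fn (Z - X) with he
  have e0 : 0 ≤ e := fn_nonneg _
  have hκ0 : 0 < κ := by linarith
  have hsub : Zh + G - X = (G - tangentProjAt S hr Zh (X - Zh)) -
      (1 - S.leftFactor hr Zh * (S.leftFactor hr Zh)ᵀ) * X *
        (1 - S.rightFactor hr Zh * (S.rightFactor hr Zh)ᵀ) := by
    rw [← sub_tangentProj, tangentProjAt, tangentProj_sub]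
    have h1 : tangentProj (S.leftFactor hr Zh) (S.rightFactor hr Zh) Zh = Zh :=
      tangentProj_of_compl (by rw [Matrix.sub_mul, Matrix.one_mul]; exact hl)
    rw [h1]
    abel
  have hnorm := h.fn_normal_le hs hσ (Y := Zh)
    (norm_compl_proj_le (S.leftFactor_orth hr Zh)) (norm_compl_proj_le (S.rightFactor_orth hr Zh))
    (by rw [Matrix.sub_mul, Matrix.one_mul]; exact hl) hr'
  refine (S.fn_hardThreshold_sub_le hr _ X h.left_orth h.compl_left_mul).trans ?_
  rw [hsub]
  have h2 := (fn_sub_le _ _).trans (add_le_add hG hnorm)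
  have hE0 := fn_nonneg (X - Zh)
  have h3 : 1 / (32 * κ) * fn (X - Zh) ≤ e / 8 := by
    rw [div_mul_eq_mul_div, one_mul, div_le_iff₀ (by positivity)]
    linarith
  -- (4κe)²/s ≤ e/8 is what 128κ² in the radius is for; likewise 1/(32κ) cancels the 4κ of trimming
  -- in `h3`. Two eighths, doubled by thresholding, make one half.
  have h4 : fn (X - Zh) ^ 2 / s ≤ e / 8 := by
    rw [div_le_iff₀ hs]
    have h5 := pow_le_pow_left₀ hE0 hE 2
    rw [le_div_iff₀ (by positivity)] at hnear
    have h6 := mul_le_mul_of_nonneg_left hnear e0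
    linarith
  linarith

end Init

end

section

open scoped Matrix.Norms.L2Operator

/-! ### The initialization: probabilistic estimates -/

section InitProbability

variable {n r m : ℕ}

theorem samplingOp_congr {ω ω' : Fin m → Fin n × Fin n} {s : Finset (Fin m)}
    (h : ∀ k ∈ s, ω k = ω' k) (Z : Matrix (Fin n) (Fin n) ℝ) :
    samplingOp ω s Z = samplingOp ω' s Z := by
  rw [samplingOp, samplingOp, Finset.sum_congr rfl fun k hk => by rw [h k hk]]

/-- Z_l sees only the samples of groups 0 to l; this makes group l + 1 independent of it. -/
theorem initIter_congr (S : SVDRoutine n) (hr : r ≤ n) (μ₀ : ℝ) (X : Matrix (Fin n) (Fin n) ℝ)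
    {ω ω' : Fin m → Fin n × Fin n} (g : Fin m → ℕ) (mhat l : ℕ)
    (h : ∀ k, g k ≤ l → ω k = ω' k) :
    initIter S hr μ₀ X ω g mhat l = initIter S hr μ₀ X ω' g mhat l := by
  induction l with
  | zero =>
    rw [initIter, initIter, samplingOp_congr fun k hk => h k (Finset.mem_filter.1 hk).2.le]
  | succ l ih =>
    rw [initIter, initIter, ih fun k hk => h k (hk.trans (Nat.le_succ l))]
    rw [samplingOp_congr fun k hk => h k (Finset.mem_filter.1 hk).2.le]

theorem initIter_factor (S : SVDRoutine n) (hr : r ≤ n) (μ₀ : ℝ) (X : Matrix (Fin n) (Fin n) ℝ)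
    (ω : Fin m → Fin n × Fin n) (g : Fin m → ℕ) (mhat l : ℕ) :
    ∃ (A : Matrix (Fin n) (Fin r) ℝ) (B : Matrix (Fin r) (Fin n) ℝ),
      initIter S hr μ₀ X ω g mhat l = A * B := by
  cases l <;> exact S.hardThreshold_factor hr _

/-- The relative deviation of the `l`-th resampled gradient exceeds `δ`, while the error of the
current iterate is at most `e`. -/
def IsBadStep (S : SVDRoutine n) (hr : r ≤ n) (μ₀ : ℝ) (X : Matrix (Fin n) (Fin n) ℝ)
    (g : Fin m → ℕ) (mhat l : ℕ) (e δ : ℝ) (ω : Fin m → Fin n × Fin n) : Prop :=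
  fn (initIter S hr μ₀ X ω g mhat l - X) ≤ e ∧
    δ * fn (X - trim S hr μ₀ (initIter S hr μ₀ X ω g mhat l)) <
      fn (((n : ℝ) ^ 2 / mhat) • tangentProjAt S hr (trim S hr μ₀ (initIter S hr μ₀ X ω g mhat l))
          (samplingOp ω (Finset.univ.filter fun k => g k = l + 1)
            (X - trim S hr μ₀ (initIter S hr μ₀ X ω g mhat l))) -
        tangentProjAt S hr (trim S hr μ₀ (initIter S hr μ₀ X ω g mhat l))
          (X - trim S hr μ₀ (initIter S hr μ₀ X ω g mhat l)))

/-- Each good step halves the error, which keeps the iterate in the region where the next step is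
covered. Nearness is part of `IsBadStep`, so each bad event can be counted without conditioning on
success of the earlier steps. -/
theorem fn_initIter_sub_le (S : SVDRoutine n) (hr : r ≤ n) {X : Matrix (Fin n) (Fin n) ℝ}
    {U V : Matrix (Fin n) (Fin r) ℝ} {σ : Fin r → ℝ} (h : IsReducedSVD X U σ V) {s κ μ₀ : ℝ}
    (hs : 0 < s) (hσ : ∀ k, s ≤ σ k) (hκ : 1 ≤ κ) (hσκ : ∀ k, σ k ≤ κ * s) (hμ : 0 ≤ μ₀)
    (hUc : ∀ i, ∑ k, U i k ^ 2 ≤ μ₀ * r / n) (hVc : ∀ j, ∑ k, V j k ^ 2 ≤ μ₀ * r / n)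
    {ω : Fin m → Fin n × Fin n} {g : Fin m → ℕ} {mhat L : ℕ} {e : ℝ}
    (he : e ≤ s / (128 * κ ^ 2)) (h0 : fn (initIter S hr μ₀ X ω g mhat 0 - X) ≤ e)
    (hgood : ∀ l < L, ¬ IsBadStep S hr μ₀ X g mhat l (s / (128 * κ ^ 2)) (1 / (32 * κ)) ω)
    (l : ℕ) (hl : l ≤ L) : fn (initIter S hr μ₀ X ω g mhat l - X) ≤ e / 2 ^ l := by
  induction l with
  | zero => simpa using h0
  | succ l ih =>
    have ih' := ih (Nat.le_of_succ_le hl)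
    have he0 : 0 ≤ e := (fn_nonneg _).trans h0
    have hnear : fn (initIter S hr μ₀ X ω g mhat l - X) ≤ s / (128 * κ ^ 2) :=
      ih'.trans ((div_le_self he0 (one_le_pow₀ one_le_two)).trans he)
    obtain ⟨A, B, hZ⟩ := initIter_factor S hr μ₀ X ω g mhat l
    have hb := hgood l hl
    rw [IsBadStep, not_and, not_lt] at hb
    have hstep := fn_initStep_le S hr h hs hσ hκ hσκ hμ hUc hVc hZ hnear (hb hnear)
    refine (hstep.trans (div_le_div_of_nonneg_right ih' zero_le_two)).trans_eq ?_
    rw [pow_succ, div_div]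

/-- Freeze the samples outside group l + 1. Then Z_l and its trimmed version are fixed matrices,
trimming supplies incoherence 2μ₀ and the entry bound, and concentration at a fixed matrix applies;
`sum_sum_piecewise` averages over the frozen samples. -/
theorem card_isBadStep_le (S : SVDRoutine n) (hr : r ≤ n) {X : Matrix (Fin n) (Fin n) ℝ}
    {U V : Matrix (Fin n) (Fin r) ℝ} {σ : Fin r → ℝ} (h : IsReducedSVD X U σ V) {s κ μ₀ : ℝ}
    (hs : 0 < s) (hσ : ∀ k, s ≤ σ k) (hκ : 1 ≤ κ) (hσκ : ∀ k, σ k ≤ κ * s) (hμ : 0 ≤ μ₀)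
    (hUc : ∀ i, ∑ k, U i k ^ 2 ≤ μ₀ * r / n) (hVc : ∀ j, ∑ k, V j k ^ 2 ≤ μ₀ * r / n)
    (hn : 0 < n) (hr1 : 1 ≤ r) {g : Fin m → ℕ} {mhat l : ℕ} (hm : 0 < mhat)
    (hg : (Finset.univ.filter fun k => g k = l + 1).card = mhat) {δ : ℝ} (hδ : 0 < δ)
    (hδ1 : δ ≤ 1) (B : Finset (Fin m → Fin n × Fin n))
    (hB : ∀ ω ∈ B, IsBadStep S hr μ₀ X g mhat l (s / (128 * κ ^ 2)) δ ω) :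
    (B.card : ℝ) ≤ ((n : ℝ) ^ 2) ^ m *
      ((n ^ 2 + 1) * Real.exp (-(δ ^ 2 * mhat / (18 * (2 * μ₀ * r * n))))) := by
  classical
  set t := Finset.univ.filter fun k => g k = l + 1 with ht
  set b : ℝ := (n ^ 2 + 1) * Real.exp (-(δ ^ 2 * mhat / (18 * (2 * μ₀ * r * n)))) with hb
  have hb0 : 0 ≤ b := by positivity
  have hN : (0 : ℝ) < ((n : ℝ) ^ 2) ^ m := by positivity
  have hcard : (Fintype.card (Fin n × Fin n) : ℝ) = (n : ℝ) ^ 2 := by simp [sq]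
  have hind : ∀ D : Finset (Fin m → Fin n × Fin n),
      ∑ ω, (if ω ∈ D then (1 : ℝ) else 0) = D.card := by
    intro D
    simp
  have hsum := sum_sum_piecewise t (fun ω => if ω ∈ B then (1 : ℝ) else 0)
  rw [hind, hcard, Fintype.card_fin] at hsum
  have hinner : ∀ ω : Fin m → Fin n × Fin n,
      ∑ ω', (if t.piecewise ω' ω ∈ B then (1 : ℝ) else 0) ≤ ((n : ℝ) ^ 2) ^ m * b := by
    intro ω
    set D := Finset.univ.filter fun ω' : Fin m → Fin n × Fin n => t.piecewise ω' ω ∈ B with hD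
    have e1 : ∑ ω', (if t.piecewise ω' ω ∈ B then (1 : ℝ) else 0) = D.card := by
      rw [← hind]
      simp [hD]
    rw [e1]
    set Z := initIter S hr μ₀ X ω g mhat l with hZ
    have hZeq : ∀ ω', initIter S hr μ₀ X (t.piecewise ω' ω) g mhat l = Z := fun ω' =>
      initIter_congr S hr μ₀ X g mhat l fun k hk =>
        Finset.piecewise_eq_of_notMem _ _ _ fun hkt => by
          have := (Finset.mem_filter.1 hkt).2
          omega
    have hsam : ∀ ω' (E : Matrix (Fin n) (Fin n) ℝ),
        samplingOp (t.piecewise ω' ω) t E = samplingOp ω' t E := by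
      intro ω' E
      have h1 : ∀ k ∈ t, t.piecewise ω' ω k = ω' k := fun k hk =>
        Finset.piecewise_eq_of_mem t ω' ω hk
      exact samplingOp_congr h1 E
    have hDbad : ∀ ω' ∈ D, fn (Z - X) ≤ s / (128 * κ ^ 2) ∧ δ * fn (X - trim S hr μ₀ Z) <
        fn (((n : ℝ) ^ 2 / mhat) • tangentProjAt S hr (trim S hr μ₀ Z)
          (samplingOp ω' t (X - trim S hr μ₀ Z)) -
            tangentProjAt S hr (trim S hr μ₀ Z) (X - trim S hr μ₀ Z)) := by
      intro ω' hω'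
      have h1 := hB _ (Finset.mem_filter.1 hω').2
      rw [IsBadStep, hZeq, ← ht, hsam] at h1
      exact h1
    -- Nearness of Z does not depend on the fresh samples, so one bad sequence yields it; without
    -- any there is nothing to count.
    rcases D.eq_empty_or_nonempty with hemp | ⟨ω₀, hω₀⟩
    · rw [hemp]
      simp only [Finset.card_empty, Nat.cast_zero]
      positivity
    obtain ⟨hnear, hlt⟩ := hDbad ω₀ hω₀
    obtain ⟨A, A', hA⟩ := initIter_factor S hr μ₀ X ω g mhat l
    obtain ⟨-, -, hU', hV', hE, -, -⟩ := trim_spec S hr h hs hσ hκ hσκ hμ hUc hVc hA hnear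
    have hE0 : 0 < fn (X - trim S hr μ₀ Z) := by
      refine lt_of_le_of_ne (fn_nonneg _) fun h0 => ?_
      have h1 := eq_zero_of_fn_eq_zero h0.symm
      rw [h1] at hlt
      simp [samplingOp, tangentProjAt, tangentProj] at hlt
    have := card_fn_tangentProj_sampling_gt_le (S.leftFactor_orth hr (trim S hr μ₀ Z))
      (S.rightFactor_orth hr (trim S hr μ₀ Z)) hn hr1 hU' hV' hE0 hE hδ hδ1 t (by omega) D
      (fun ω' hω' => by rw [hg]; exact (hDbad ω' hω').2)
    rw [hg] at this
    exact this
  have htot := Finset.sum_le_sum fun ω (_ : ω ∈ Finset.univ) => hinner ω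
  rw [hsum] at htot
  simp only [Finset.sum_const, Finset.card_univ, nsmul_eq_mul, Fintype.card_fun, Fintype.card_fin,
    Nat.cast_pow, hcard] at htot
  exact le_of_mul_le_mul_left htot hN

/-- All but few samples give the restricted isometry property and a good initial guess. -/
theorem exists_exceptional_samples (S : SVDRoutine n) (hr : r ≤ n)
    {X : Matrix (Fin n) (Fin n) ℝ} {U V : Matrix (Fin n) (Fin r) ℝ} {σ : Fin r → ℝ}
    (h : IsReducedSVD X U σ V) {s κ μ₀ τ t η : ℝ} (hs : 0 < s) (hσ : ∀ k, s ≤ σ k) (hκ : 1 ≤ κ)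
    (hσκ : ∀ k, σ k ≤ κ * s) (hμ : 0 ≤ μ₀) (hUc : ∀ i, ∑ k, U i k ^ 2 ≤ μ₀ * r / n)
    (hVc : ∀ j, ∑ k, V j k ^ 2 ≤ μ₀ * r / n) (hn : 0 < n) (hr1 : 1 ≤ r) (hτ : 0 < τ)
    (hX : ∀ i j, |X i j| ≤ τ / n) (ht : 0 < t) (htτ : t ≤ τ)
    (hts : 4 * Real.sqrt r * t ≤ s / (128 * κ ^ 2)) (hη : 0 < η) (hη1 : η ≤ 1)
    (g : Fin m → ℕ) {mhat : ℕ} (L : ℕ) (hm : 0 < mhat)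
    (hg : ∀ l ≤ L, (Finset.univ.filter fun k => g k = l).card = mhat) :
    ∃ B : Finset (Fin m → Fin n × Fin n),
      (B.card : ℝ) ≤ ((n : ℝ) ^ 2) ^ m *
        (2 * (n ^ 2 * Real.exp (-(η ^ 2 * m / (8 * (μ₀ * r * n))))) +
          2 * (n * Real.exp (-(t ^ 2 * mhat / (4 * (n * τ ^ 2))))) +
          L * ((n ^ 2 + 1) *
            Real.exp (-((1 / (32 * κ)) ^ 2 * mhat / (18 * (2 * μ₀ * r * n)))))) ∧
      ∀ ω ∉ B, (∀ A, tangentProj U V A = A →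
          |fi A (Matrix.hadamard (sampleWeight ω Finset.univ) A) - m / (n : ℝ) ^ 2 * fn A ^ 2| ≤
            η * (m / (n : ℝ) ^ 2) * fn A ^ 2) ∧
        fn (initIter S hr μ₀ X ω g mhat L - X) ≤ 4 * Real.sqrt r * t / 2 ^ L := by
  classical
  set B₁ := Finset.univ.filter fun ω : Fin m → Fin n × Fin n => ∃ A, tangentProj U V A = A ∧
    η * (m / (n : ℝ) ^ 2) * fn A ^ 2 <
      |fi A (Matrix.hadamard (sampleWeight ω Finset.univ) A) - m / (n : ℝ) ^ 2 * fn A ^ 2| with hB₁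
  set s₀ := Finset.univ.filter fun k => g k = 0 with hs₀
  set B₂ := Finset.univ.filter fun ω : Fin m → Fin n × Fin n =>
    t < ‖((n : ℝ) ^ 2 / s₀.card) • samplingOp ω s₀ X - X‖ with hB₂
  set B₃ : ℕ → Finset (Fin m → Fin n × Fin n) := fun l => Finset.univ.filter fun ω =>
    IsBadStep S hr μ₀ X g mhat l (s / (128 * κ ^ 2)) (1 / (32 * κ)) ω with hB₃
  have hg0 : s₀.card = mhat := hg 0 (Nat.zero_le _)
  have hδ1 : 1 / (32 * κ) ≤ 1 := by
    rw [div_le_one (by positivity)]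
    linarith
  refine ⟨B₁ ∪ B₂ ∪ (Finset.range L).biUnion B₃, ?_, fun ω hω => ?_⟩
  · have h1 := card_not_rip_le h.left_orth h.right_orth hn hr1 hUc hVc hη hη1 B₁
      fun ω hω => (Finset.mem_filter.1 hω).2
    have h2 := card_norm_sampling_sub_gt_le hn hτ hX s₀ (by omega) ht htτ B₂
      fun ω hω => (Finset.mem_filter.1 hω).2
    rw [hg0] at h2
    have h3 : (((Finset.range L).biUnion B₃).card : ℝ) ≤ L * (((n : ℝ) ^ 2) ^ m * ((n ^ 2 + 1) *
        Real.exp (-((1 / (32 * κ)) ^ 2 * mhat / (18 * (2 * μ₀ * r * n)))))) := by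
      have h4 : (((Finset.range L).biUnion B₃).card : ℝ) ≤ ∑ l ∈ Finset.range L, ((B₃ l).card : ℝ) :=
        by exact_mod_cast Finset.card_biUnion_le
      refine h4.trans ?_
      refine (Finset.sum_le_sum fun l hl => card_isBadStep_le S hr h hs hσ hκ hσκ hμ hUc hVc hn hr1
        hm (hg (l + 1) (Finset.mem_range.1 hl)) (by positivity) hδ1 (B₃ l)
          fun ω hω => (Finset.mem_filter.1 hω).2).trans_eq ?_
      rw [Finset.sum_const, Finset.card_range, nsmul_eq_mul]
    have h5 : ((B₁ ∪ B₂ ∪ (Finset.range L).biUnion B₃).card : ℝ) ≤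
        B₁.card + B₂.card + ((Finset.range L).biUnion B₃).card := by
      exact_mod_cast (Finset.card_union_le _ _).trans
        (Nat.add_le_add_right (Finset.card_union_le _ _) _)
    refine h5.trans ((add_le_add (add_le_add h1 h2) h3).trans_eq ?_)
    ring
  · simp only [Finset.mem_union, not_or, Finset.mem_biUnion, not_exists, not_and,
      Finset.mem_range] at hω
    obtain ⟨⟨h1, h2⟩, h3⟩ := hω
    refine ⟨fun A hA => ?_, ?_⟩
    · by_contra hc
      exact h1 (Finset.mem_filter.2 ⟨Finset.mem_univ _, A, hA, not_le.1 hc⟩)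
    · refine fn_initIter_sub_le S hr h hs hσ hκ hσκ hμ hUc hVc hts ?_ (L := L)
        (fun l hl hbad => h3 l hl (Finset.mem_filter.2 ⟨Finset.mem_univ _, hbad⟩)) L le_rfl
      have h4 : ‖((n : ℝ) ^ 2 / s₀.card) • samplingOp ω s₀ X - X‖ ≤ t := by
        by_contra hc
        exact h2 (Finset.mem_filter.2 ⟨Finset.mem_univ _, not_le.1 hc⟩)
      rw [hg0] at h4
      rw [initIter]
      refine (S.fn_hardThreshold_sub_le_norm hr _ h).trans ?_
      exact mul_le_mul_of_nonneg_left h4 (by positivity)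

end InitProbability

end

section

open scoped Matrix.Norms.L2Operator

/-! ### Recovery with high probability -/

section Recovery

variable {n r m : ℕ}

/-- At ε = 0 the sum τ₁ + τ₂ is 3κ₁κ₂ and the denominators are 1 − κ₁ and 1. All strict inequalities
persist nearby. -/
theorem exists_rcgAdmissible {κ₁ κ₂ : ℝ} (h₁ : κ₁ < 1) (h₃ : κ₁ * κ₂ < 1 / 3) :
    ∃ εbar : ℝ, 0 < εbar ∧ ∀ ε₀ : ℝ, 0 < ε₀ → ε₀ < εbar → RCGAdmissible κ₁ κ₂ ε₀ := by
  have hc : ContinuousAt (fun ε => rcgTau₁ κ₁ κ₂ ε + rcgTau₂ κ₁ κ₂ ε) 0 := by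
    unfold rcgTau₁ rcgTau₂
    refine ContinuousAt.add (ContinuousAt.add (ContinuousAt.div (by fun_prop) (by fun_prop) ?_)
      (ContinuousAt.div (by fun_prop) (by fun_prop) ?_))
      (ContinuousAt.div (by fun_prop) (by fun_prop) ?_)
    · simp; linarith
    · simp
    · simp
  have h0 : rcgTau₁ κ₁ κ₂ 0 + rcgTau₂ κ₁ κ₂ 0 < 1 := by
    simp only [rcgTau₁, rcgTau₂]
    norm_num
    linarith
  have hd : ContinuousAt (fun ε : ℝ => κ₁ * (1 + 4 * ε) - (1 - 4 * ε)) 0 := by fun_prop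
  have e1 := hc.eventually (gt_mem_nhds h0)
  have hd0 : κ₁ * (1 + 4 * 0) - (1 - 4 * 0) < 0 := by linarith
  have e2 := hd.eventually (gt_mem_nhds hd0)
  have e3 : ∀ᶠ ε : ℝ in 𝓝 0, ε < 1 / 4 := gt_mem_nhds (by norm_num)
  obtain ⟨δ, hδ, h⟩ := Metric.eventually_nhds_iff.1 ((e1.and e2).and e3)
  refine ⟨δ, hδ, fun ε hε hεδ => ?_⟩
  obtain ⟨⟨h4, h5⟩, h6⟩ := h (y := ε) (by rwa [Real.dist_eq, sub_zero, abs_of_pos hε])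
  exact ⟨hε, by linarith, by linarith, h4⟩

theorem condNumber_bounds (hr : 1 ≤ r) {σ : Fin r → ℝ} (hpos : ∀ k, 0 < σ k) :
    0 < ⨅ k, σ k ∧ (∀ k, ⨅ k, σ k ≤ σ k) ∧ 1 ≤ condNumber σ ∧
      ∀ k, σ k ≤ condNumber σ * ⨅ k, σ k := by
  have : Nonempty (Fin r) := ⟨⟨0, hr⟩⟩
  obtain ⟨k₀, hk₀⟩ := exists_eq_ciInf_of_finite (f := σ)
  have h1 : 0 < ⨅ k, σ k := hk₀ ▸ hpos k₀
  have h2 : ∀ k, ⨅ k, σ k ≤ σ k := fun k => ciInf_le (Set.finite_range σ).bddBelow k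
  have h3 : ∀ k, σ k ≤ ⨆ k, σ k := fun k => le_ciSup (Set.finite_range σ).bddAbove k
  refine ⟨h1, h2, ?_, fun k => ?_⟩
  · rw [condNumber, one_le_div h1]
    exact (h2 k₀).trans (h3 k₀)
  · rw [condNumber, div_mul_cancel₀ _ h1.ne']
    exact h3 k

/-- The entry bound summed over n² entries bounds the Frobenius norm by τ = μ₁√r‖X‖, so τ is at
least the spectral norm and can play the scale in the concentration of Z₀. -/
theorem IsNonSpiky.bounds (hn : 0 < n) {X : Matrix (Fin n) (Fin n) ℝ} {μ₁ : ℝ}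
    (h : IsNonSpiky r X μ₁) (hX : 0 < ‖X‖) :
    ‖X‖ ≤ μ₁ * Real.sqrt r * ‖X‖ ∧ ∀ i j, |X i j| ≤ μ₁ * Real.sqrt r * ‖X‖ / n := by
  have hn0 : (0 : ℝ) < n := by exact_mod_cast hn
  have h1 : ∀ i j, |X i j| ≤ μ₁ * Real.sqrt r * ‖X‖ / n := by
    intro i j
    refine (h i j).trans_eq ?_
    rw [specNorm_eq_norm, Real.sqrt_div (Nat.cast_nonneg r), Real.sqrt_sq hn0.le]
    ring
  refine ⟨(norm_le_fn X).trans ?_, h1⟩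
  have h2 : 0 ≤ μ₁ * Real.sqrt r * ‖X‖ := by
    have := (abs_nonneg _).trans (h1 ⟨0, hn⟩ ⟨0, hn⟩)
    rwa [le_div_iff₀ hn0, zero_mul] at this
  refine Real.sqrt_le_iff.2 ⟨h2, ?_⟩
  calc ∑ i, ∑ j, X i j ^ 2
      ≤ ∑ _i : Fin n, ∑ _j : Fin n, (μ₁ * Real.sqrt r * ‖X‖ / n) ^ 2 :=
        Finset.sum_le_sum fun i _ => Finset.sum_le_sum fun j _ => by
          rw [← sq_abs]; exact pow_le_pow_left₀ (abs_nonneg _) (h1 i j) 2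
    _ = _ := by
        simp only [Finset.sum_const, Finset.card_univ, Fintype.card_fin, nsmul_eq_mul]
        field_simp

theorem IsReducedSVD.le_norm (S : SVDRoutine n) (hr : r ≤ n) (hr1 : 1 ≤ r)
    {X : Matrix (Fin n) (Fin n) ℝ} {U V : Matrix (Fin n) (Fin r) ℝ} {σ : Fin r → ℝ}
    (h : IsReducedSVD X U σ V) {s : ℝ} (hs : 0 < s) (hσ : ∀ k, s ≤ σ k) : s ≤ ‖X‖ := by
  have h1 := S.topSV_lower hr h hs hσ (Y := X) ⟨0, hr1⟩
  rw [sub_self, norm_zero, sub_zero] at h1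
  exact h1.trans (topSV_le_norm S hr X _)

/-- Size of the groups of the partition, and the number of groups. -/
theorem group_size_bounds {g : Fin m → ℕ} {L mhat : ℕ} {a b : ℝ}
    (hgL : ∀ k, g k ≤ L) (hg : ∀ l ≤ L, (Finset.univ.filter fun k => g k = l).card = mhat)
    (hb : 1 / 5 ≤ b) (hL : L = ⌈6 * b⌉₊) (hm : 16 * a * b ≤ m) : a ≤ mhat ∧ mhat ≤ m := by
  have hcard : m = (L + 1) * mhat := by
    have h1 := Finset.card_eq_sum_card_fiberwise (s := (Finset.univ : Finset (Fin m)))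
      (t := Finset.range (L + 1)) (f := g) (fun k _ => by
        simpa using Nat.lt_succ_of_le (hgL k))
    rw [Finset.card_univ, Fintype.card_fin] at h1
    rw [h1, Finset.sum_congr rfl fun l hl => hg l (Nat.lt_succ_iff.1 (Finset.mem_range.1 hl)),
      Finset.sum_const, Finset.card_range, smul_eq_mul]
  constructor
  · have h2 : (L : ℝ) < 6 * b + 1 := hL ▸ Nat.ceil_lt_add_one (by linarith)
    have h3 : (m : ℝ) = (L + 1) * mhat := by exact_mod_cast hcard
    have h4 : ((L : ℝ) + 1) * mhat ≤ 16 * b * mhat :=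
      mul_le_mul_of_nonneg_right (by linarith) (Nat.cast_nonneg _)
    have h5 : 16 * b * a ≤ 16 * b * mhat := by linarith
    exact le_of_mul_le_mul_left h5 (by linarith)
  · rw [hcard]
    exact Nat.le_mul_of_pos_left _ (Nat.succ_pos L)

/-- The constant in front of the sample size. -/
def sampleConst : ℝ := 10 ^ 11

theorem exp_neg_le_of_le {x y : ℝ} (h : y ≤ x) : Real.exp (-x) ≤ Real.exp (-y) :=
  Real.exp_le_exp.2 (neg_le_neg h)

/-- All exponentials are at most n^(−2β), so the sum is at most (12·lK + 5)n^(2−2β). Two of the five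
units go into 2n^(1−β), as β > 1. -/
theorem failure_sum_le {β lK E₁ E₂ E₃ : ℝ} {L : ℕ} (hn : 2 ≤ n) (hβ : 1 < β)
    (hlK : 0 ≤ lK) (hL : (L : ℝ) ≤ 6 * lK + 1)
    (h₁ : E₁ ≤ Real.exp (-(2 * β * Real.log n))) (h₂ : E₂ ≤ Real.exp (-(2 * β * Real.log n)))
    (h₃ : E₃ ≤ Real.exp (-(2 * β * Real.log n))) :
    2 * ((n : ℝ) ^ 2 * E₁) + 2 * (n * E₂) + L * (((n : ℝ) ^ 2 + 1) * E₃) ≤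
      2 * (n : ℝ) ^ (1 - β) + (24 * lK + 3) * (n : ℝ) ^ (2 - 2 * β) := by
  have hn2 : (2 : ℝ) ≤ n := by exact_mod_cast hn
  have hn0 : (0 : ℝ) < n := by linarith
  set E := Real.exp (-(2 * β * Real.log n)) with hE
  have hE0 : 0 < E := Real.exp_pos _
  have e1 : (n : ℝ) ^ (2 - 2 * β) = (n : ℝ) ^ 2 * E := by
    rw [sub_eq_add_neg, Real.rpow_add hn0, Real.rpow_two, Real.rpow_def_of_pos hn0 (-(2 * β)), hE]
    congr 2
    ring
  have e2 : (n : ℝ) ^ (2 - 2 * β) ≤ (n : ℝ) ^ (1 - β) :=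
    Real.rpow_le_rpow_of_exponent_le (by linarith) (by linarith)
  have hL0 : (0 : ℝ) ≤ L := Nat.cast_nonneg L
  have i1 : 2 * ((n : ℝ) ^ 2 * E₁) ≤ 2 * ((n : ℝ) ^ 2 * E) := by gcongr
  have i2 : 2 * (n * E₂) ≤ (n : ℝ) ^ 2 * E := by
    have : 2 * (n * E₂) ≤ 2 * (n * E) := by gcongr
    refine this.trans ?_
    rw [← mul_assoc, sq]
    gcongr
  have i3 : L * (((n : ℝ) ^ 2 + 1) * E₃) ≤ (6 * lK + 1) * (2 * ((n : ℝ) ^ 2 * E)) := by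
    have h4 : ((n : ℝ) ^ 2 + 1) * E₃ ≤ 2 * ((n : ℝ) ^ 2 * E) := by
      have : ((n : ℝ) ^ 2 + 1) * E₃ ≤ ((n : ℝ) ^ 2 + 1) * E := by gcongr
      have h5 : 1 * E ≤ (n : ℝ) ^ 2 * E := by gcongr; nlinarith
      linarith
    have h6 : 0 ≤ 2 * ((n : ℝ) ^ 2 * E) := by positivity
    exact (mul_le_mul_of_nonneg_left h4 hL0).trans (mul_le_mul_of_nonneg_right hL h6)
  have h7 : 0 ≤ lK * ((n : ℝ) ^ 2 * E) := by positivity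
  rw [e1] at e2 ⊢
  linarith

/-- 6 log 2 ≥ 1, so the number of halvings is ample. -/
theorem pow_ceil_ge {K : ℝ} (hK : 1 ≤ K) : K ≤ 2 ^ ⌈6 * Real.log K⌉₊ := by
  have h0 : 0 ≤ Real.log K := Real.log_nonneg hK
  have h1 := Nat.le_ceil (6 * Real.log K)
  have h2 : Real.log K ≤ ⌈6 * Real.log K⌉₊ * Real.log 2 := by
    have := Real.log_two_gt_d9
    nlinarith
  calc K = Real.exp (Real.log K) := (Real.exp_log (by linarith)).symm
    _ ≤ Real.exp (⌈6 * Real.log K⌉₊ * Real.log 2) := Real.exp_le_exp.2 h2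
    _ = _ := by rw [Real.exp_nat_mul, Real.exp_log two_pos]

set_option maxHeartbeats 1000000 in
/-- Every event that contains all samples with a regular neighborhood of `X` in which the initial
guess lies has high probability. -/
theorem sampleLaw_real_ge_of_regular {mhat L : ℕ} (hr : r ≤ n) {X : Matrix (Fin n) (Fin n) ℝ}
    {U V : Matrix (Fin n) (Fin r) ℝ} {σ : Fin r → ℝ} {μ₀ μ₁ β ε₀ : ℝ} (S : SVDRoutine n)
    (g : Fin m → ℕ) (hr1 : 1 ≤ r) (h : IsReducedSVD X U σ V) (hμ₀ : 0 < μ₀)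
    (hinc : IsIncoherent U V μ₀) (hspiky : IsNonSpiky r X μ₁) (hβ : 1 < β)
    (hε : RGradAdmissible ε₀) (hL : L = ⌈6 * Real.log (β * n * Real.log n / (24 * ε₀))⌉₊)
    (hgL : ∀ k, g k ≤ L) (hg : ∀ l ≤ L, (Finset.univ.filter fun k => g k = l).card = mhat)
    (hm : 16 * sampleConst * β * max (μ₀ / ε₀ ^ 2) (μ₁ ^ 2) * condNumber σ ^ 6 * n * (r : ℝ) ^ 2 *
      Real.log n * Real.log (β * n * Real.log n / (24 * ε₀)) ≤ m)
    {A : Set (Fin m → Fin n × Fin n)}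
    (hA : ∀ ω, ∀ p ρ : ℝ, 0 < p →
      (∀ Y, (∃ (A : Matrix (Fin n) (Fin r) ℝ) (B : Matrix (Fin r) (Fin n) ℝ), Y = A * B) →
        fn (Y - X) ≤ ρ → IsRegularAt (sampleWeight ω Finset.univ) X Y (S.leftFactor hr Y)
          (S.rightFactor hr Y) p (ε₀ / 10)) →
      fn (initIter S hr μ₀ X ω g mhat L - X) ≤ ρ → ω ∈ A) :
    1 - 2 * (n : ℝ) ^ (1 - β) -
        (24 * Real.log (β * n * Real.log n / (24 * ε₀)) + 3) * (n : ℝ) ^ (2 - 2 * β) ≤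
      (sampleLaw n m).real A := by
  have hn : 0 < n := by omega
  -- For n = 1 both logarithms are 0 and the claimed probability is 1 − 2 − 3 < 0.
  rcases Nat.lt_or_ge n 2 with hn1 | hn2
  · have h1 : n = 1 := by omega
    subst h1
    refine le_trans ?_ measureReal_nonneg
    norm_num
  have hn2' : (2 : ℝ) ≤ n := by exact_mod_cast hn2
  have hn0 : (0 : ℝ) < n := by linarith
  have hr0 : (1 : ℝ) ≤ r := by exact_mod_cast hr1
  have hε0 : 0 < ε₀ := hε.1
  have hε22 := hε.rate_lt
  have hβ0 : 0 < β := by linarith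
  obtain ⟨hs, hσ, hκ, hσκ⟩ := condNumber_bounds hr1 h.pos
  set s := ⨅ k, σ k with hs_def
  set κ := condNumber σ with hκ_def
  have hκ0 : 0 < κ := by linarith
  obtain ⟨hUc, hVc⟩ := hinc.row_sq_le hμ₀ h.left_orth h.right_orth
  have hℓ : Real.log 2 ≤ Real.log n := Real.log_le_log two_pos hn2'
  have hlog2 := Real.log_two_gt_d9
  set ℓ := Real.log n with hℓ_def
  have hℓ0 : 0 < ℓ := by linarith
  set K := β * n * ℓ / (24 * ε₀) with hK_def
  -- Uses log n ≥ log 2 > 0.69. With n ≥ 2 and ε₀ < 1/22 it also makes K ≥ 5/4, so that log K is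
  -- bounded below.
  have hKε : n * (69 / 100 / 24) ≤ ε₀ * K := by
    have e : ε₀ * K = β * (n * ℓ) / 24 := by rw [hK_def]; field_simp
    have h1 : n * (69 / 100) ≤ n * ℓ := by gcongr; linarith
    have h2 : n * ℓ ≤ β * (n * ℓ) := le_mul_of_one_le_left (by positivity) hβ.le
    rw [e]
    linarith
  have hK : 5 / 4 ≤ K := by
    have h1 : ε₀ * K ≤ 1 / 22 * K := mul_le_mul_of_nonneg_right hε22.le (by positivity)
    linarith
  have hlK : 1 / 5 ≤ Real.log K := by
    refine le_trans ?_ (Real.one_sub_inv_le_log_of_pos (by linarith))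
    have : K⁻¹ ≤ (5 / 4 : ℝ)⁻¹ := by gcongr
    norm_num at this ⊢
    linarith
  set Q := max (μ₀ / ε₀ ^ 2) (μ₁ ^ 2) with hQ_def
  have hQ0 : 0 < Q := lt_max_of_lt_left (by positivity)
  obtain ⟨hmhat, hmm⟩ := group_size_bounds
    (a := sampleConst * β * Q * κ ^ 6 * n * (r : ℝ) ^ 2 * ℓ) hgL hg hlK hL (by
      refine le_trans (le_of_eq ?_) hm
      ring)
  have hC : sampleConst = 10 ^ 11 := rfl
  have hmhat0 : 0 < (mhat : ℝ) := lt_of_lt_of_le (by rw [hC]; positivity) hmhat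
  have hm0 : (0 : ℝ) < m := hmhat0.trans_le (by exact_mod_cast hmm)
  have hXn : s ≤ ‖X‖ := h.le_norm S hr hr1 hs hσ
  have hXn' : ‖X‖ ≤ κ * s := h.norm_le (by positivity) hσκ
  obtain ⟨hτ1, hτ2⟩ := hspiky.bounds hn (hs.trans_le hXn)
  set τ := μ₁ * Real.sqrt r * ‖X‖ with hτ_def
  have hτ0 : 0 < τ := hs.trans_le (hXn.trans hτ1)
  have hsr : 1 ≤ Real.sqrt r := Real.one_le_sqrt.2 hr0
  have hsr2 : Real.sqrt r ^ 2 = r := Real.sq_sqrt (by linarith)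
  have hκ2 : 1 ≤ κ ^ 2 := one_le_pow₀ hκ
  -- The initial Frobenius error is 4√r·t = s/(20000κ²): inside the radius s/(128κ²) of the
  -- initialization, and small enough that L halvings reach the regular neighbourhood.
  set t := s / (80000 * Real.sqrt r * κ ^ 2) with ht_def
  have ht0 : 0 < t := by positivity
  have hts : 4 * Real.sqrt r * t = s / (20000 * κ ^ 2) := by
    rw [ht_def]; field_simp; norm_num
  have htτ : t ≤ τ := by
    refine le_trans ?_ (hXn.trans hτ1)
    refine div_le_self hs.le ?_
    have : 1 ≤ Real.sqrt r * κ ^ 2 := one_le_mul_of_one_le_of_one_le hsr hκ2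
    linarith
  have hβℓ : 0 < β * ℓ := by positivity
  have hμ₀m : sampleConst * β * μ₀ * κ ^ 2 * n * r * ℓ ≤ ε₀ ^ 2 * mhat := by
    have h1 : μ₀ ≤ ε₀ ^ 2 * Q := by
      have := le_max_left (μ₀ / ε₀ ^ 2) (μ₁ ^ 2)
      rw [div_le_iff₀ (by positivity)] at this
      linarith
    have h2 : κ ^ 2 ≤ κ ^ 6 := pow_le_pow_right₀ hκ (by norm_num)
    have h3 : (r : ℝ) ≤ (r : ℝ) ^ 2 := by nlinarith
    calc _ ≤ sampleConst * β * (ε₀ ^ 2 * Q) * κ ^ 6 * n * (r : ℝ) ^ 2 * ℓ := by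
          rw [hC]; gcongr
      _ = ε₀ ^ 2 * (sampleConst * β * Q * κ ^ 6 * n * (r : ℝ) ^ 2 * ℓ) := by ring
      _ ≤ _ := by gcongr
  -- Passing from the tangent space at X to nearby ones multiplies the isometry constant by 6, so
  -- ε₀/60 there yields the ε₀/10 used by the iterations.
  obtain ⟨B, hBcard, hB⟩ := exists_exceptional_samples (η := ε₀ / 60) S hr h hs hσ hκ hσκ hμ₀.le hUc
    hVc hn hr1 hτ0 hτ2 ht0 htτ (by
      rw [hts]
      gcongr
      norm_num) (by positivity) (by linarith) g L (by exact_mod_cast hmhat0) hg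
  have hX1 : 2 * β * ℓ ≤ (ε₀ / 60) ^ 2 * m / (8 * (μ₀ * r * n)) := by
    rw [le_div_iff₀ (by positivity)]
    have h1 : (mhat : ℝ) ≤ m := by exact_mod_cast hmm
    have h2 : ε₀ ^ 2 * mhat ≤ ε₀ ^ 2 * m := by gcongr
    have h3 : β * μ₀ * 1 * n * r * ℓ ≤ β * μ₀ * κ ^ 2 * n * r * ℓ := by gcongr
    have h4 : 0 ≤ β * μ₀ * n * r * ℓ := by positivity
    rw [hC] at hμ₀m
    linarith
  -- This estimate dictates κ⁶r²: t² is of order s²/(rκ⁴), while τ² ≤ μ₁²rκ²s². The constant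
  -- 10¹¹/80000² exceeds the required 8.
  have hX2 : 2 * β * ℓ ≤ t ^ 2 * mhat / (4 * (n * τ ^ 2)) := by
    rw [le_div_iff₀ (by positivity)]
    have h1 : sampleConst * β * μ₁ ^ 2 * κ ^ 6 * n * (r : ℝ) ^ 2 * ℓ ≤ mhat := by
      refine le_trans ?_ hmhat
      rw [hC]
      gcongr
      exact le_max_right _ _
    have h2 : τ ^ 2 ≤ μ₁ ^ 2 * r * (κ * s) ^ 2 := by
      rw [hτ_def, mul_pow, mul_pow, hsr2]
      gcongr
    have h3 : t ^ 2 * (sampleConst * β * μ₁ ^ 2 * κ ^ 6 * n * (r : ℝ) ^ 2 * ℓ) =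
        sampleConst / 6400000000 * (β * ℓ * n * (μ₁ ^ 2 * r * (κ * s) ^ 2)) := by
      rw [ht_def, div_pow, mul_pow, mul_pow, hsr2]
      field_simp
      ring
    have h4 := mul_le_mul_of_nonneg_left h1 (sq_nonneg t)
    rw [h3, hC] at h4
    have h5 : β * ℓ * n * τ ^ 2 ≤ β * ℓ * n * (μ₁ ^ 2 * r * (κ * s) ^ 2) := by gcongr
    have h6 : 0 ≤ β * ℓ * n * τ ^ 2 := by positivity
    linarith
  have hX3 : 2 * β * ℓ ≤ (1 / (32 * κ)) ^ 2 * mhat / (18 * (2 * μ₀ * r * n)) := by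
    have h1 : ε₀ ^ 2 * mhat ≤ mhat := mul_le_of_le_one_left hmhat0.le
      (pow_le_one₀ hε0.le (by linarith))
    have e : (1 / (32 * κ)) ^ 2 * mhat / (18 * (2 * μ₀ * r * n)) =
        mhat / (36864 * (κ ^ 2 * μ₀ * r * n)) := by
      field_simp; ring
    rw [e, le_div_iff₀ (by positivity)]
    have h4 : 0 ≤ β * μ₀ * κ ^ 2 * n * r * ℓ := by positivity
    rw [hC] at hμ₀m
    linarith
  have hL' : (L : ℝ) ≤ 6 * Real.log K + 1 := by
    rw [hL]
    exact (Nat.ceil_lt_add_one (by linarith)).le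
  have hfail := failure_sum_le hn2 hβ (by linarith : 0 ≤ Real.log K) hL' (exp_neg_le_of_le hX1)
    (exp_neg_le_of_le hX2) (exp_neg_le_of_le hX3)
  have hreal := sampleLaw_real_ge hn B (A := A) (fun ω hω => by
    obtain ⟨hrip, hinit⟩ := hB ω hω
    refine hA ω (m / (n : ℝ) ^ 2) (ε₀ / 60 * s / (8 * n)) (by positivity)
      (fun Y ⟨A, B, hY⟩ hnear => ?_) (hinit.trans ?_)
    · have := isRegularAt_of_near S hr h hs hσ hn (p := m / (n : ℝ) ^ 2) (by positivity)
        (by positivity : 0 < ε₀ / 60) (by linarith) (sampleWeight_nonneg ω Finset.univ)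
        (fun i j => by
          refine (sampleWeight_le ω Finset.univ i j).trans_eq ?_
          rw [div_mul_cancel₀ _ (by positivity), Finset.card_univ, Fintype.card_fin])
        hrip hY hnear
      rwa [show 6 * (ε₀ / 60) = ε₀ / 10 by ring] at this
    -- The radius of regularity is ε₀s/(480n). Since ε₀2^L ≥ ε₀K ≥ 0.69n/24, it exceeds s/20000
    -- divided by 2^L.
    · have hpow : K ≤ 2 ^ L := by
        rw [hL]
        exact pow_ceil_ge (by linarith)
      rw [hts, div_le_iff₀ (by positivity)]
      have h1 : s / (20000 * κ ^ 2) ≤ s / 20000 := by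
        gcongr
        linarith
      refine h1.trans ?_
      have h2 : n * (69 / 100 / 24) ≤ ε₀ * 2 ^ L := hKε.trans (by gcongr)
      have h3 : ε₀ / 60 * s / (8 * n) * 2 ^ L = s / (480 * n) * (ε₀ * 2 ^ L) := by
        field_simp; norm_num
      rw [h3]
      refine le_trans ?_ (mul_le_mul_of_nonneg_left h2 (by positivity))
      have h4 : s / (480 * n) * (n * (69 / 100 / 24)) = s * (69 / 1152000) := by
        field_simp; norm_num
      rw [h4]
      linarith)
  refine le_trans ?_ hreal
  have hB' : (B.card : ℝ) / ((n : ℝ) ^ 2) ^ m ≤ 2 * (n : ℝ) ^ (1 - β) +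
      (24 * Real.log K + 3) * (n : ℝ) ^ (2 - 2 * β) := by
    rw [div_le_iff₀ (by positivity), mul_comm]
    exact hBcard.trans (mul_le_mul_of_nonneg_left hfail (by positivity))
  linarith

end Recovery

end

end

end MatrixCompletion

/-! ### Assembly of the recovery guarantee. -/

open MatrixCompletion
theorem mainTheorem1 :
    (∀ κ₁ κ₂ : ℝ, 0 ≤ κ₁ → κ₁ < 1 → 0 ≤ κ₂ → κ₁ * κ₂ < 1 / 3 →
      ∃ εbar : ℝ, 0 < εbar ∧ ∀ ε₀ : ℝ, 0 < ε₀ → ε₀ < εbar → RCGAdmissible κ₁ κ₂ ε₀) ∧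
    ∃ C : ℝ, 0 < C ∧
      ∀ (n r m mhat L : ℕ) (hr : r ≤ n) (X : Matrix (Fin n) (Fin n) ℝ)
        (U V : Matrix (Fin n) (Fin r) ℝ) (σ : Fin r → ℝ) (μ₀ μ₁ β ε₀ : ℝ)
        (S : SVDRoutine n) (g : Fin m → Fin (L + 1)),
        1 ≤ r →
        IsReducedSVD X U σ V →
        0 < μ₀ → IsIncoherent U V μ₀ →
        IsNonSpiky r X μ₁ →
        1 < β → 0 < ε₀ →
        L = ⌈6 * Real.log (β * n * Real.log n / (24 * ε₀))⌉₊ →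
        (∀ l, (Finset.univ.filter fun k => g k = l).card = mhat) →
        C * β * max (μ₀ / ε₀ ^ 2) (μ₁ ^ 2) * condNumber σ ^ 6 * n * (r : ℝ) ^ 2 * Real.log n *
            Real.log (β * n * Real.log n / (24 * ε₀)) ≤ m →
        (RGradAdmissible ε₀ →
          1 - 2 * (n : ℝ) ^ (1 - β) -
              (24 * Real.log (β * n * Real.log n / (24 * ε₀)) + 3) * (n : ℝ) ^ (2 - 2 * β) ≤
            (sampleLaw n m).real
              {ω | ConvergesLinearly
                (rgradIter S hr X ω (initIter S hr μ₀ X ω (fun k => (g k : ℕ)) mhat L))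
                X (rgradRate ε₀)}) ∧
        (∀ κ₁ κ₂ : ℝ, 0 ≤ κ₁ → 0 ≤ κ₂ → κ₁ * κ₂ < 1 / 3 → RCGAdmissible κ₁ κ₂ ε₀ →
          1 - 2 * (n : ℝ) ^ (1 - β) -
              (24 * Real.log (β * n * Real.log n / (24 * ε₀)) + 3) * (n : ℝ) ^ (2 - 2 * β) ≤
            (sampleLaw n m).real
              {ω | ConvergesLinearly
                  (rgradIter S hr X ω (initIter S hr μ₀ X ω (fun k => (g k : ℕ)) mhat L))
                  X (rgradRate ε₀) ∧
                ConvergesLinearly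
                  (rcgIter S hr κ₁ κ₂ X ω (initIter S hr μ₀ X ω (fun k => (g k : ℕ)) mhat L))
                  X (rcgRate κ₁ κ₂ ε₀)}) := by
  refine ⟨fun κ₁ κ₂ _ h₁ _ h₃ => exists_rcgAdmissible h₁ h₃, 16 * sampleConst,
    by norm_num [sampleConst], ?_⟩
  intro n r m mhat L hr X U V σ μ₀ μ₁ β ε₀ S g hr1 h hμ₀ hinc hspiky hβ _ hL hg hm
  have hgL : ∀ k, (g k : ℕ) ≤ L := fun k => Nat.lt_succ_iff.1 (g k).2
  have hg' : ∀ l ≤ L, (Finset.univ.filter fun k => (g k : ℕ) = l).card = mhat := by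
    intro l hl
    rw [← hg ⟨l, Nat.lt_succ_of_le hl⟩]
    congr 1
    ext k
    simp [Fin.ext_iff]
  refine ⟨fun hε => ?_, fun κ₁ κ₂ h₁ h₂ _ hε => ?_⟩
  · exact sampleLaw_real_ge_of_regular hr S (fun k => (g k : ℕ)) hr1 h hμ₀ hinc hspiky hβ hε hL
      hgL hg' hm fun ω p ρ hp hreg hinit =>
        rgrad_convergesLinearly S hr hp hε h.left_orth h.compl_left_mul hreg
          (initIter_factor S hr μ₀ X ω _ mhat L) hinit
  -- Admissibility for RCG contains that for RGrad, so one good event serves both algorithms and no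
  -- second union bound is needed.
  · have hε' := (hε.bounds h₁ h₂).1
    exact sampleLaw_real_ge_of_regular hr S (fun k => (g k : ℕ)) hr1 h hμ₀ hinc hspiky hβ hε' hL
      hgL hg' hm fun ω p ρ hp hreg hinit =>
        ⟨rgrad_convergesLinearly S hr hp hε' h.left_orth h.compl_left_mul hreg
          (initIter_factor S hr μ₀ X ω _ mhat L) hinit,
        rcg_convergesLinearly S hr hp h₁ h₂ hε h.left_orth h.compl_left_mul hreg
          (initIter_factor S hr μ₀ X ω _ mhat L) hinit⟩
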